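/- **Setting.** Let $N\ge 2$ and let $\Omega\subset\mathbb{R}^N$ be a bounded connected open set with Lipschitz boundary. $H^1_0(\Omega)$ is the closure of $C_0^\infty(\Omega)$ in $H^1(\Omega)$ and $H^{-1}(\Omega)$ is its dual. For an $N\times N$ matrix put $A^{sym}=\frac12(A+A^t)$ and $A^{skew}=\frac12(A-A^t)$; the norms of $L^p$-spaces of matrix functions are taken with respect to the entrywise maximum $\max_{i,j}|a_{ij}|$. Let $0<\alpha\le\beta$, $c>0$, let $A^*\in L^2(\Omega;\mathbb{S}^N_{skew})$ be non-zero, and let $Q\subset L^2(\Omega;\mathbb{S}^N_{skew})$ be convex and compact with $0\in Q$. The set $\mathfrak{A}_{ad}$ of admissible controls consists of all $A\in L^2(\Omega;\mathbb{R}^{N\times N})$ such that $TV(a^{sym}_{ij})\le c$ for all $i,j$, $\alpha I\le A^{sym}\le\beta I$ a.e. in $\Omega$, $|a^{skew}_{ij}|\le|a^*_{ij}|$ a.e. in $\Omega$ for all $i<j$, and $A^{skew}\in Q$. For $A\in L^2(\Omega;\mathbb{R}^{N\times N})$ let $D(A)$ be the set of $y\in H^1_0(\Omega)$ for which there is a constant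 $C$ with $\left|\int_\Omega(\nabla\varphi,A^{skew}\nabla y)\,dx\right|\le C\|\nabla\varphi\|_{L^2(\Omega)}$ for all $\varphi\in C_0^\infty(\Omega)$. For $y\in D(A)$ and $p\in H^1_0(\Omega)$ let $[y,p]_A=\lim_k\int_\Omega(\nabla\varphi_k,A^{skew}\nabla y)\,dx$ for any $\varphi_k\in C_0^\infty(\Omega)$ with $\varphi_k\to p$ in $H^1_0(\Omega)$. Let $f\in H^{-1}(\Omega)$ and $y_d\in L^2(\Omega)$. A function $y\in H^1_0(\Omega)$ is a weak solution for the control $A$ if $\int_\Omega(\nabla\varphi,A\nabla y)\,dx=\langle f,\varphi\rangle$ for all $\varphi\in C_0^\infty(\Omega)$. Let $\Xi$ be the set of pairs $(A,y)$ with $A\in\mathfrak{A}_{ad}$, $y\in D(A)$ and $y$ a weak solution for $A$. A pair $(A_0,y_0)\in\Xi$ is optimal if it minimizes $I(A,y)=\|y-y_d\|^2_{L^2(\Omega)}+\int_\Omega(\nabla y,A^{sym}\nabla y)\,dx$ over $\Xi$. **Hypotheses.** Let $(A_0,y_0)$ be an optimal pair, and for $\widehat A\in\mathfrak{A}_{ad}$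 and $\theta\in(0,1]$ put $A_\theta=A_0+\theta(\widehat A-A_0)$. (H1) $D(A^*)\subseteq D(A)$ for every $A\in\mathfrak{A}_{ad}$. (H2) $y_0\in D(A^*)$. For every $\widehat A\in\mathfrak{A}_{ad}$ there is a family $\{y_\theta\}_{\theta\in(0,1]}\subset H^1_0(\Omega)$ such that the following two hypotheses hold. (H3) Each $y_\theta$ is a weak solution for $A_\theta$, $y_\theta\rightharpoonup y_0$ weakly in $H^1_0(\Omega)$ as $\theta\to0^+$, and $y_\theta\in D(A^*)$ for all sufficiently small $\theta$. (H4) For every choice of values $\varepsilon_\theta\in[0,1]$ there are $\psi_\theta\in H^1_0(\Omega)$, $\theta\in(0,1]$, such that, with $z_\theta=y_0+\varepsilon_\theta(y_\theta-y_0)$, $$\int_\Omega\big(\nabla\varphi,(A_\theta^{sym}-A_\theta^{skew})\nabla\psi_\theta\big)\,dx=-2\int_\Omega(z_\theta-y_d)\varphi\,dx-2\int_\Omega(\nabla\varphi,A_\theta^{sym}\nabla z_\theta)\,dx\quad\forall\,\varphi\in H^1_0(\Omega)$$ (the integrand on the left being integrable); for each $\theta$ there is $\gamma\in(0,\infty]$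 such that either $\nabla\psi_\theta\in L^\infty(\Omega)$, or $A^*\in L^{2+4/\gamma}(\Omega)$ and $\nabla\psi_\theta\in L^{2+\gamma}(\Omega)$; and $\{\psi_\theta\}_{\theta\to0}$ is relatively compact in the norm of $H^1_0(\Omega)$, i.e. for every sequence $\theta_k\in(0,1]$ with $\theta_k\to0$ some subsequence of $(\psi_{\theta_k})$ converges strongly in $H^1_0(\Omega)$. **Theorem.** Let $(A_0,y_0)$ be an optimal pair such that (H1)–(H4) hold and $$\lim_{p\to\infty}p^{-1}\|A_0^{skew}\|_{L^p(\Omega;\mathbb{S}^N_{skew})}=0.$$ Then there is $\overline\psi\in H^1_0(\Omega)$ such that $$\int_\Omega(\nabla\varphi,A_0\nabla y_0)\,dx=\langle f,\varphi\rangle\quad\forall\,\varphi\in C_0^\infty(\Omega),$$ $$\int_\Omega(\nabla\varphi,A_0^t\nabla\overline\psi)\,dx=-2\int_\Omega(y_0-y_d)\varphi\,dx-2\int_\Omega(\nabla\varphi,A_0^{sym}\nabla y_0)\,dx\quad\forall\,\varphi\in C_0^\infty(\Omega),$$ $$\int_\Omega\big(\nabla y_0,(A^{sym}-A_0^{sym})(\nabla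 y_0+\nabla\overline\psi)\big)\,dx\ \ge\ [y_0,\overline\psi]_{A_0}-[y_0,\overline\psi]_A\quad\forall\,A\in\mathfrak{A}_{ad}.$$ -/

import Mathlib

open MeasureTheory Filter Topology Set
open scoped ENNReal NNReal Matrix ContDiff Gradient Distributions Matrix.Norms.Elementwise

noncomputable section

namespace SkewOCP

/-- `ℝ^N` with the Euclidean norm. -/
abbrev Rn (N : ℕ) : Type := EuclideanSpace ℝ (Fin N)

/-- Real `N × N` matrices. The norm in force is the entrywise maximum. -/
abbrev Mat (N : ℕ) : Type := Matrix (Fin N) (Fin N) ℝ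

variable {N : ℕ}

/-- Lebesgue measure on the open set `Ω`. -/
abbrev vol (Ω : TopologicalSpace.Opens (Rn N)) : Measure (Rn N) :=
  volume.restrict (Ω : Set (Rn N))

/-- `Ω` has a Lipschitz boundary: near each boundary point, in a suitable direction `ν`,
`Ω` is the strict epigraph of a Lipschitz function of the component orthogonal to `ν`. -/
def HasLipschitzBoundary (Ω : Set (Rn N)) : Prop :=
  ∀ x ∈ frontier Ω, ∃ (ν : Rn N) (g : Rn N → ℝ) (K : ℝ≥0) (r : ℝ),
    ‖ν‖ = 1 ∧ LipschitzWith K g ∧ 0 < r ∧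
      ∀ z ∈ Metric.ball x r, z ∈ Ω ↔ g (z - inner ℝ ν z • ν) < inner ℝ ν z

/-! ### Matrices -/

/-- The symmetric part `(M + Mᵗ) / 2`. -/
def symPart (M : Mat N) : Mat N := (1 / 2 : ℝ) • (M + Mᵀ)

/-- The skew-symmetric part `(M - Mᵗ) / 2`. -/
def skewPart (M : Mat N) : Mat N := (1 / 2 : ℝ) • (M - Mᵀ)

/-- The scalar product `(ξ, M η)` in `ℝ^N`. -/
def form (M : Mat N) (ξ η : Rn N) : ℝ := ξ.ofLp ⬝ᵥ (M *ᵥ η.ofLp)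

/-- The skew-symmetric part as a continuous linear map. -/
def skewPartL : Mat N →L[ℝ] Mat N :=
  LinearMap.toContinuousLinearMap
    { toFun := skewPart
      map_add' := fun A B => by
        simp only [skewPart, Matrix.transpose_add, ← smul_add]
        congr 1
        abel
      map_smul' := fun c A => by
        simp only [skewPart, Matrix.transpose_smul, ← smul_sub, RingHom.id_apply]
        rw [smul_comm] }

/-- `L²(Ω; 𝕄^N)`. -/
abbrev L2Mat (Ω : TopologicalSpace.Opens (Rn N)) : Type := Lp (Mat N) 2 (vol Ω)

/-- The skew-symmetric part of an element of `L²(Ω; 𝕄^N)`. -/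
def L2Mat.skew {Ω : TopologicalSpace.Opens (Rn N)} (A : L2Mat Ω) : L2Mat Ω :=
  skewPartL.compLp A

/-- `A` takes almost everywhere skew-symmetric values, i.e. `A ∈ L²(Ω; 𝕊_skew)`. -/
def L2Mat.IsSkew {Ω : TopologicalSpace.Opens (Rn N)} (A : L2Mat Ω) : Prop :=
  ∀ᵐ x ∂(vol Ω), (A x)ᵀ = - A x

/-! ### The space `H¹₀(Ω)` -/

variable (Ω : TopologicalSpace.Opens (Rn N))

theorem memLp_test (φ : 𝓓(Ω, ℝ)) : MemLp (φ : Rn N → ℝ) 2 (vol Ω) :=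
  (φ.continuous.memLp_of_hasCompactSupport φ.hasCompactSupport).restrict _

theorem continuous_gradient_test (φ : 𝓓(Ω, ℝ)) : Continuous (∇ (φ : Rn N → ℝ)) :=
  (InnerProductSpace.toDual ℝ (Rn N)).symm.continuous.comp
    (φ.contDiff.continuous_fderiv (by simp))

theorem hasCompactSupport_gradient_test (φ : 𝓓(Ω, ℝ)) :
    HasCompactSupport (∇ (φ : Rn N → ℝ)) :=
  (φ.hasCompactSupport.fderiv (𝕜 := ℝ)).comp_left
    (g := (InnerProductSpace.toDual ℝ (Rn N)).symm) (map_zero _)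

theorem memLp_gradient_test (φ : 𝓓(Ω, ℝ)) : MemLp (∇ (φ : Rn N → ℝ)) 2 (vol Ω) :=
  ((continuous_gradient_test Ω φ).memLp_of_hasCompactSupport
    (hasCompactSupport_gradient_test Ω φ)).restrict _

theorem gradient_test_add (φ ψ : 𝓓(Ω, ℝ)) :
    ∇ ((φ + ψ : 𝓓(Ω, ℝ)) : Rn N → ℝ) = ∇ (φ : Rn N → ℝ) + ∇ (ψ : Rn N → ℝ) := by
  funext x
  have h1 : DifferentiableAt ℝ (φ : Rn N → ℝ) x := (φ.contDiff.differentiable (by simp)) x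
  have h2 : DifferentiableAt ℝ (ψ : Rn N → ℝ) x := (ψ.contDiff.differentiable (by simp)) x
  have h3 : ((φ + ψ : 𝓓(Ω, ℝ)) : Rn N → ℝ) = (φ : Rn N → ℝ) + (ψ : Rn N → ℝ) := rfl
  rw [h3]
  simp only [gradient, Pi.add_apply, fderiv_add h1 h2, map_add]

theorem gradient_test_smul (c : ℝ) (φ : 𝓓(Ω, ℝ)) :
    ∇ ((c • φ : 𝓓(Ω, ℝ)) : Rn N → ℝ) = c • ∇ (φ : Rn N → ℝ) := by
  funext x
  have h1 : DifferentiableAt ℝ (φ : Rn N → ℝ) x := (φ.contDiff.differentiable (by simp)) x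
  have h3 : ((c • φ : 𝓓(Ω, ℝ)) : Rn N → ℝ) = c • (φ : Rn N → ℝ) := rfl
  rw [h3]
  simp only [gradient, Pi.smul_apply, fderiv_const_smul h1, map_smul]

/-- Pairs (function, gradient field) in `L²(Ω) × L²(Ω; ℝ^N)`, with the Hilbert norm of the
product; on pairs `(u, ∇u)` this is the norm of `H¹(Ω)`. -/
abbrev L2Pair : Type := WithLp 2 (Lp ℝ 2 (vol Ω) × Lp (Rn N) 2 (vol Ω))

/-- The map `φ ↦ (φ, ∇φ)` from `C₀^∞(Ω)`. -/
def testPair : 𝓓(Ω, ℝ) →ₗ[ℝ] L2Pair Ω where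
  toFun φ := WithLp.toLp 2 ((memLp_test Ω φ).toLp _, (memLp_gradient_test Ω φ).toLp _)
  map_add' φ ψ := by
    apply (WithLp.ofLp_injective 2)
    refine Prod.ext ?_ ?_
    · exact MemLp.toLp_add (memLp_test Ω φ) (memLp_test Ω ψ)
    · refine Eq.trans ?_ (MemLp.toLp_add (memLp_gradient_test Ω φ) (memLp_gradient_test Ω ψ))
      exact MemLp.toLp_congr (memLp_gradient_test Ω (φ + ψ)) _ (by rw [gradient_test_add])
  map_smul' c φ := by
    apply (WithLp.ofLp_injective 2)
    refine Prod.ext ?_ ?_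
    · exact MemLp.toLp_const_smul c (memLp_test Ω φ)
    · refine Eq.trans ?_ (MemLp.toLp_const_smul c (memLp_gradient_test Ω φ))
      exact MemLp.toLp_congr (memLp_gradient_test Ω (c • φ)) _ (by rw [gradient_test_smul])

/-- `H¹₀(Ω)`: the closure of `C₀^∞(Ω)` in the norm of `H¹(Ω)`. An element is the pair of a
function and its weak gradient (which the function determines). -/
def H10 : Submodule ℝ (L2Pair Ω) := (LinearMap.range (testPair Ω)).topologicalClosure

/-- A test function as an element of `H¹₀(Ω)`. -/
def testH10 : 𝓓(Ω, ℝ) →ₗ[ℝ] H10 Ω :=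
  (testPair Ω).codRestrict (H10 Ω) fun φ =>
    (LinearMap.range (testPair Ω)).le_topologicalClosure (LinearMap.mem_range_self _ φ)

variable {Ω}

/-- The underlying function in `L²(Ω)`. -/
def fn (y : H10 Ω) : Lp ℝ 2 (vol Ω) := (y : L2Pair Ω).fst

/-- The weak gradient in `L²(Ω; ℝ^N)`. -/
def wgrad (y : H10 Ω) : Lp (Rn N) 2 (vol Ω) := (y : L2Pair Ω).snd

/-! ### The unbounded forms generated by skew-symmetric parts -/

/-- `∫_Ω (∇φ, A^skew ∇y) dx` for a test function `φ`. -/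
def skewForm (A : L2Mat Ω) (y : H10 Ω) (φ : 𝓓(Ω, ℝ)) : ℝ :=
  ∫ x, form (skewPart (A x)) (∇ (φ : Rn N → ℝ) x) (wgrad y x) ∂(vol Ω)

/-- The set `D(A)` of those `y ∈ H¹₀(Ω)` for which `φ ↦ ∫_Ω (∇φ, A^skew ∇y) dx` is bounded in
the norm `(∫_Ω |∇φ|² dx)^{1/2}`. -/
def D (A : L2Mat Ω) : Set (H10 Ω) :=
  {y | ∃ C : ℝ, ∀ φ : 𝓓(Ω, ℝ),
    |skewForm A y φ| ≤ C * √(∫ x, ‖∇ (φ : Rn N → ℝ) x‖ ^ 2 ∂(vol Ω))}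

/-- `[y, p]_A`, the limit of `∫_Ω (∇φ, A^skew ∇y) dx` as the test functions `φ` tend to `p`
in `H¹₀(Ω)`. The limit exists for `y ∈ D(A)`, see `tendsto_bracket`. -/
def bracket (A : L2Mat Ω) (y p : H10 Ω) : ℝ :=
  limUnder (comap (testH10 Ω) (𝓝 p)) (skewForm A y)

theorem integrable_skewForm (A : L2Mat Ω) (y : H10 Ω) (φ : 𝓓(Ω, ℝ)) :
    Integrable (fun x => form (skewPart (A x)) (∇ (φ : Rn N → ℝ) x) (wgrad y x)) (vol Ω) := by
  have hA : ∀ i j, MemLp (fun x => skewPart (A x) i j) 2 (vol Ω) := fun i j =>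
    (((LinearMap.toContinuousLinearMap (Matrix.entryLinearMap ℝ ℝ i j)).comp
      (skewPartL (N := N))).comp_memLp' (Lp.memLp A))
  have hy : ∀ j, MemLp (fun x => (wgrad y x) j) 2 (vol Ω) := fun j =>
    (EuclideanSpace.proj (𝕜 := ℝ) j).comp_memLp' (Lp.memLp (wgrad y))
  have hφ : ∀ i, Continuous (fun x => (∇ (φ : Rn N → ℝ) x) i) := fun i =>
    (EuclideanSpace.proj (𝕜 := ℝ) i).continuous.comp (continuous_gradient_test Ω φ)
  have hφc : ∀ i, HasCompactSupport (fun x => (∇ (φ : Rn N → ℝ) x) i) := fun i =>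
    (hasCompactSupport_gradient_test Ω φ).comp_left (g := fun v : Rn N => v i) rfl
  simp only [form, dotProduct, Matrix.mulVec]
  refine integrable_finsetSum _ fun i _ => ?_
  obtain ⟨C, hC⟩ := (hφ i).bounded_above_of_compact_support (hφc i)
  refine Integrable.bdd_mul (c := C) ?_ (hφ i).aestronglyMeasurable (Eventually.of_forall hC)
  exact integrable_finsetSum _ fun j _ => (hA i j).integrable_mul (hy j)

theorem skewForm_sub (A : L2Mat Ω) (y : H10 Ω) (φ ψ : 𝓓(Ω, ℝ)) :
    skewForm A y (φ - ψ) = skewForm A y φ - skewForm A y ψ := by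
  have h : ∇ ((φ - ψ : 𝓓(Ω, ℝ)) : Rn N → ℝ) = ∇ (φ : Rn N → ℝ) - ∇ (ψ : Rn N → ℝ) := by
    rw [sub_eq_add_neg, ← neg_one_smul ℝ ψ, gradient_test_add, gradient_test_smul]
    simp [sub_eq_add_neg]
  rw [skewForm, skewForm, skewForm,
    ← integral_sub (integrable_skewForm A y φ) (integrable_skewForm A y ψ)]
  rw [h]
  simp only [form, Pi.sub_apply, WithLp.ofLp_sub, sub_dotProduct]

theorem sqrt_integral_gradient_le (φ : 𝓓(Ω, ℝ)) :
    √(∫ x, ‖∇ (φ : Rn N → ℝ) x‖ ^ 2 ∂(vol Ω)) ≤ ‖testH10 Ω φ‖ := by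
  apply Real.sqrt_le_iff.2 ⟨norm_nonneg _, ?_⟩
  have h1 : ‖testH10 Ω φ‖ = ‖testPair Ω φ‖ := rfl
  rw [h1, WithLp.prod_norm_sq_eq_of_L2]
  have h2 : ‖(testPair Ω φ).snd‖ ^ 2 = ∫ x, ‖∇ (φ : Rn N → ℝ) x‖ ^ 2 ∂(vol Ω) := by
    rw [← real_inner_self_eq_norm_sq, L2.inner_def]
    apply integral_congr_ae
    filter_upwards [(memLp_gradient_test Ω φ).coeFn_toLp] with x hx
    have : (testPair Ω φ).snd x = ∇ (φ : Rn N → ℝ) x := hx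
    rw [this, real_inner_self_eq_norm_sq]
  rw [h2]
  nlinarith [sq_nonneg ‖(testPair Ω φ).fst‖]

theorem denseRange_testH10 : DenseRange (testH10 Ω) := by
  intro p
  have hp : (p : L2Pair Ω) ∈ closure (LinearMap.range (testPair Ω) : Set (L2Pair Ω)) := p.2
  rw [closure_subtype]
  convert hp using 2
  ext q
  constructor
  · rintro ⟨_, ⟨φ, rfl⟩, rfl⟩
    exact ⟨φ, rfl⟩
  · rintro ⟨φ, rfl⟩
    exact ⟨_, ⟨φ, rfl⟩, rfl⟩

/-- The defining limit of `[y, p]_A` exists for `y ∈ D(A)` and every `p ∈ H¹₀(Ω)`. -/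
theorem tendsto_bracket {A : L2Mat Ω} {y : H10 Ω} (hy : y ∈ D A) (p : H10 Ω) :
    Tendsto (skewForm A y) (comap (testH10 Ω) (𝓝 p)) (𝓝 (bracket A y p)) := by
  obtain ⟨C, hC⟩ := hy
  have hne : (comap (testH10 Ω) (𝓝 p)).NeBot := 
    comap_neBot_iff_frequently.2 (mem_closure_iff_frequently.1 (denseRange_testH10 p))
  have hb : ∀ φ ψ : 𝓓(Ω, ℝ), dist (skewForm A y φ) (skewForm A y ψ) ≤
      (|C| + 1) * dist (testH10 Ω φ) (testH10 Ω ψ) := fun φ ψ => by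
    rw [Real.dist_eq, ← skewForm_sub, dist_eq_norm, ← map_sub]
    refine (hC _).trans (mul_le_mul ?_ (sqrt_integral_gradient_le _) (Real.sqrt_nonneg _)
      (by positivity))
    linarith [le_abs_self C]
  have hc : Cauchy (map (skewForm A y) (comap (testH10 Ω) (𝓝 p))) := by
    rw [Metric.cauchy_iff]
    refine ⟨inferInstance, fun ε hε => ?_⟩
    have hC1 : 0 < |C| + 1 := by positivity
    refine ⟨skewForm A y '' (testH10 Ω ⁻¹' Metric.ball p (ε / (|C| + 1) / 2)),
      image_mem_map (preimage_mem_comap (Metric.ball_mem_nhds p (by positivity))), ?_⟩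
    rintro _ ⟨φ, hφ, rfl⟩ _ ⟨ψ, hψ, rfl⟩
    have h1 : dist (testH10 Ω φ) (testH10 Ω ψ) < ε / (|C| + 1) := by
      have h2 := dist_triangle_right (testH10 Ω φ) (testH10 Ω ψ) p
      have h3 : dist (testH10 Ω φ) p < ε / (|C| + 1) / 2 := hφ
      have h4 : dist (testH10 Ω ψ) p < ε / (|C| + 1) / 2 := hψ
      linarith
    calc _ ≤ _ := hb φ ψ
      _ < (|C| + 1) * (ε / (|C| + 1)) := by gcongr
      _ = ε := by field_simp
  obtain ⟨l, hl⟩ := cauchy_iff_exists_le_nhds.1 hc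
  exact tendsto_nhds_limUnder ⟨l, hl⟩

/-! ### Admissible controls -/

/-- Total variation on `Ω`: the supremum of `∫_Ω u div φ dx` over `φ ∈ C¹₀(Ω; ℝ^N)`
with `|φ| ≤ 1`. -/
def totalVariation (Ω : TopologicalSpace.Opens (Rn N)) (u : Rn N → ℝ) : ℝ≥0∞ :=
  ⨆ (φ : 𝓓^{1}(Ω, Rn N)) (_ : ∀ x, ‖φ x‖ ≤ 1),
    ENNReal.ofReal (∫ x, u x *
      (∑ i, (fderiv ℝ (φ : Rn N → Rn N) x (EuclideanSpace.single i 1)) i) ∂(vol Ω))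

/-- The conditions on the symmetric part of a control: total variations of the entries at most
`c`, and `α I ≤ A^sym ≤ β I` almost everywhere. -/
def SymAdmissible (α β c : ℝ) (A : L2Mat Ω) : Prop :=
  (∀ i j, totalVariation Ω (fun x => symPart (A x) i j) ≤ ENNReal.ofReal c) ∧
  ∀ᵐ x ∂(vol Ω), ∀ ξ : Rn N,
    α * ‖ξ‖ ^ 2 ≤ form (symPart (A x)) ξ ξ ∧ form (symPart (A x)) ξ ξ ≤ β * ‖ξ‖ ^ 2

/-- The conditions on the skew-symmetric part of a control: entries dominated by those of `Astar`
almost everywhere, and membership in `Q`. -/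
def SkewAdmissible (Astar : L2Mat Ω) (Q : Set (L2Mat Ω)) (A : L2Mat Ω) : Prop :=
  (∀ᵐ x ∂(vol Ω), ∀ i j, i < j → |skewPart (A x) i j| ≤ |Astar x i j|) ∧ A.skew ∈ Q

/-- The set of admissible controls. -/
def admissible (α β c : ℝ) (Astar : L2Mat Ω) (Q : Set (L2Mat Ω)) : Set (L2Mat Ω) :=
  {A | SymAdmissible α β c A ∧ SkewAdmissible Astar Q A}

/-! ### The optimal control problem -/

/-- `y` is a weak solution of `-div (A ∇y) = f` in `Ω`, `y = 0` on `∂Ω`;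
here `f ∈ H⁻¹(Ω)`. -/
def IsWeakSolution (f : StrongDual ℝ (H10 Ω)) (A : L2Mat Ω) (y : H10 Ω) : Prop :=
  ∀ φ : 𝓓(Ω, ℝ),
    ∫ x, form (A x) (∇ (φ : Rn N → ℝ) x) (wgrad y x) ∂(vol Ω) = f (testH10 Ω φ)

/-- The set `Ξ` of admissible pairs for the set `𝔄` of controls. -/
def admissiblePairs (𝔄 : Set (L2Mat Ω)) (f : StrongDual ℝ (H10 Ω)) : Set (L2Mat Ω × H10 Ω) :=
  {P | P.1 ∈ 𝔄 ∧ P.2 ∈ D P.1 ∧ IsWeakSolution f P.1 P.2}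

/-- The cost `‖y - y_d‖² + ∫_Ω (∇y, A^sym ∇y) dx`. -/
def cost (yd : Lp ℝ 2 (vol Ω)) (A : L2Mat Ω) (y : H10 Ω) : ℝ :=
  ‖fn y - yd‖ ^ 2 + ∫ x, form (symPart (A x)) (wgrad y x) (wgrad y x) ∂(vol Ω)

/-- `(A, y)` is an optimal pair. -/
def IsOptimalPair (𝔄 : Set (L2Mat Ω)) (f : StrongDual ℝ (H10 Ω)) (yd : Lp ℝ 2 (vol Ω))
    (A : L2Mat Ω) (y : H10 Ω) : Prop :=
  (A, y) ∈ admissiblePairs 𝔄 f ∧ ∀ P ∈ admissiblePairs 𝔄 f, cost yd A y ≤ cost yd P.1 P.2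

/-! ### Hypotheses of the optimality theorem -/

/-- The control `A_θ = A₀ + θ (Â - A₀)`. -/
def controlPath (A₀ Ahat : L2Mat Ω) (θ : ℝ) : L2Mat Ω := A₀ + θ • (Ahat - A₀)

/-- `ψ` solves the quasi-adjoint problem with multiplier `lam`, control `A` and state `z`. -/
def IsQuasiAdjoint (yd : Lp ℝ 2 (vol Ω)) (lam : ℝ) (A : L2Mat Ω) (z ψ : H10 Ω) : Prop :=
  ∀ φ : H10 Ω,
    Integrable (fun x => form (symPart (A x) - skewPart (A x)) (wgrad φ x) (wgrad ψ x)) (vol Ω) ∧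
    ∫ x, form (symPart (A x) - skewPart (A x)) (wgrad φ x) (wgrad ψ x) ∂(vol Ω) =
      - 2 * lam * (∫ x, (fn z x - yd x) * fn φ x ∂(vol Ω))
      - 2 * lam * ∫ x, form (symPart (A x)) (wgrad φ x) (wgrad z x) ∂(vol Ω)

/-- The integrability condition: for some `γ ∈ (0, ∞]`, either `∇ψ ∈ L^∞`, or
`A* ∈ L^{2 + 4/γ}` and `∇ψ ∈ L^{2 + γ}`. -/
def RegularFor (Astar : L2Mat Ω) (ψ : H10 Ω) : Prop :=
  ∃ γ : ℝ≥0∞, 0 < γ ∧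
    (MemLp (wgrad ψ) ∞ (vol Ω) ∨ (MemLp Astar (2 + 4 / γ) (vol Ω) ∧ MemLp (wgrad ψ) (2 + γ) (vol Ω)))

/-- Hypothesis (H1): `D(A*) ⊆ D(A)` for each admissible control `A`. -/
def HypH1 (𝔄 : Set (L2Mat Ω)) (Astar : L2Mat Ω) : Prop := ∀ A ∈ 𝔄, D Astar ⊆ D A

/-- Hypothesis (H3) for the admissible control `Ahat`, satisfied by the family `y`:
`y θ` is a weak solution for `A_θ`, it tends weakly to `y₀` in `H¹₀(Ω)` as `θ → 0+`, and it lies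
in `D(A*)` for small `θ`. -/
def HypH3 (f : StrongDual ℝ (H10 Ω)) (Astar A₀ : L2Mat Ω) (y₀ : H10 Ω) (Ahat : L2Mat Ω)
    (y : ℝ → H10 Ω) : Prop :=
  (∀ θ ∈ Ioc (0 : ℝ) 1, IsWeakSolution f (controlPath A₀ Ahat θ) (y θ)) ∧
  (∀ l : StrongDual ℝ (H10 Ω), Tendsto (fun θ => l (y θ)) (𝓝[>] 0) (𝓝 (l y₀))) ∧
  ∀ᶠ θ in 𝓝[>] (0 : ℝ), y θ ∈ D Astar

/-- Hypothesis (H4) for the admissible control `Ahat` and the family `y` of states, with the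
multiplier normalized to `1`: for any values `ε θ ∈ [0, 1]` there are quasi-adjoint states `ψ θ`
with the integrability condition, and they are relatively compact in `H¹₀(Ω)` as `θ → 0+`. -/
def HypH4 (yd : Lp ℝ 2 (vol Ω)) (Astar A₀ : L2Mat Ω) (y₀ : H10 Ω) (Ahat : L2Mat Ω)
    (y : ℝ → H10 Ω) : Prop :=
  ∀ ε : ℝ → ℝ, (∀ θ, ε θ ∈ Icc (0 : ℝ) 1) → ∃ ψ : ℝ → H10 Ω,
    (∀ θ ∈ Ioc (0 : ℝ) 1,
      IsQuasiAdjoint yd 1 (controlPath A₀ Ahat θ) (y₀ + ε θ • (y θ - y₀)) (ψ θ) ∧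
      RegularFor Astar (ψ θ)) ∧
    ∀ t : ℕ → ℝ, (∀ k, t k ∈ Ioc (0 : ℝ) 1) → Tendsto t atTop (𝓝 0) →
      ∃ (σ : ℕ → ℕ) (ψlim : H10 Ω), StrictMono σ ∧
        Tendsto (fun k => ψ (t (σ k))) atTop (𝓝 ψlim)

end SkewOCP

end

/-! The argument has two halves: a first-order analysis for one fixed competitor `A`, and a
uniqueness theorem that makes the resulting adjoint state independent of `A`.

First-order analysis. The cost is quadratic in the state, so its increment from `y₀` to `y_θ` with
the control `A_θ` frozen equals its derivative at the midpoint `(y₀ + y_θ)/2` in the direction `y_θ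
- y₀`, with no remainder. Hence (H4) is used only with `ε_θ = 1/2`. Testing the quasi-adjoint
equation with `y_θ - y₀` and the two state equations with `ψ_θ` turns the increment of the cost into
exactly `θ` times an expression in `A`, `A₀`, `y₀`, `ψ_θ` (`cost_controlPath_sub_cost`). Optimality
makes it nonnegative. After division by `θ`, strong compactness of the `ψ_θ` and boundedness of
`[y₀, ·]_A` give the variational inequality in the limit, where the limit of `ψ_θ` solves the
adjoint problem (`exists_isAdjoint_and_variational_le`). The skew coefficients are unbounded, so the
state equation can be tested with `ψ_θ` only through the bracket, whereas the quasi-adjoint equation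
contains an honest integral. `bracket_eq_integral` identifies the two under the integrability
condition in (H4).

Uniqueness. The limit above could depend on `A`. It does not, because the adjoint problem for `A₀`
has at most one solution (`eq_zero_of_adjoint_eq_zero`); this is where the growth condition on the
`L^p` norms enters. A solution `u` of the homogeneous problem cannot be tested with itself. It is
tested with Lipschitz truncations `V_j` that satisfy `|∇V_j| ≤ C 2^j` and have the gradient of `u`
off a small set `B_j`. With `g = |∇u|` and `a = |A₀^skew|`, ellipticity bounds `∫ g²` by a vanishing
term plus a multiple of `2^j ∫_{B_j} (1 + a) g`. Where `a ≤ j`, this costs about `j b_j` with `b_j =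
2^j ∫_{g > 2^{j-1}} g`. Since `∑ b_j ≤ 4 ∫ g²` and the harmonic series diverges, `j b_j` is
arbitrarily small for infinitely many `j`. Where `a > j`, Chebyshev's inequality with exponent `4j`
makes `4^j ∫_{a > j} a²` tend to zero. So `∫ g² = 0` (`frequently_truncation_error_le`).

The truncation (`exists_lipschitz_truncation`) rests on the maximal function of `|∇u|`: on its
sublevel sets `u` is Lipschitz, exterior balls of the Lipschitz domain extend this estimate across
the boundary, and an extension theorem for Lipschitz functions does the rest. That the extension may
serve as a test function against merely integrable fields is `exists_H10_of_lipschitzWith`. -/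

noncomputable section

namespace SkewOCP

/-! ### The Hardy-Littlewood maximal function -/

section Maximal

variable {E : Type*} [NormedAddCommGroup E] [MeasurableSpace E] {μ : Measure E}

/-- The set where the centred maximal function of `g` is at most `L`. -/
def maximalSublevel (μ : Measure E) (g : E → ℝ≥0∞) (L : ℝ≥0∞) : Set E :=
  {x | ∀ s : ℝ, 0 < s → ∫⁻ y in Metric.closedBall x s, g y ∂μ ≤ L * μ (Metric.closedBall x s)}

theorem mem_maximalSublevel_add {g₁ g₂ g : E → ℝ≥0∞} {L₁ L₂ : ℝ≥0∞} {x : E}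
    (hg : ∀ᵐ y ∂μ, g y ≤ g₁ y + g₂ y) (hm : AEMeasurable g₁ μ)
    (h₁ : x ∈ maximalSublevel μ g₁ L₁) (h₂ : x ∈ maximalSublevel μ g₂ L₂) :
    x ∈ maximalSublevel μ g (L₁ + L₂) := by
  intro s hs
  calc ∫⁻ y in Metric.closedBall x s, g y ∂μ
      ≤ ∫⁻ y in Metric.closedBall x s, (g₁ y + g₂ y) ∂μ :=
        lintegral_mono_ae (ae_restrict_of_ae hg)
    _ = ∫⁻ y in Metric.closedBall x s, g₁ y ∂μ + ∫⁻ y in Metric.closedBall x s, g₂ y ∂μ :=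
        lintegral_add_left' hm.restrict _
    _ ≤ _ := by rw [add_mul]; exact add_le_add (h₁ s hs) (h₂ s hs)

theorem maximalSublevel_eq_univ {g : E → ℝ≥0∞} {L : ℝ≥0∞} (hg : ∀ᵐ y ∂μ, g y ≤ L) :
    maximalSublevel μ g L = univ := by
  refine eq_univ_of_forall fun x s _ => ?_
  calc ∫⁻ y in Metric.closedBall x s, g y ∂μ ≤ ∫⁻ _ in Metric.closedBall x s, L ∂μ :=
        lintegral_mono_ae (ae_restrict_of_ae hg)
    _ = _ := by simp

variable [NormedSpace ℝ E] [FiniteDimensional ℝ E] [Nontrivial E] [BorelSpace E]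
  [μ.IsAddHaarMeasure]

/-- The weak type `(1,1)` inequality. -/
theorem mul_measure_compl_maximalSublevel_le {g : E → ℝ≥0∞} {L : ℝ≥0∞} (hL : L ≠ 0)
    (hL' : L ≠ ⊤) (hg : ∫⁻ y, g y ∂μ ≠ ⊤) :
    L * μ (maximalSublevel μ g L)ᶜ ≤ 5 ^ Module.finrank ℝ E * ∫⁻ y, g y ∂μ := by
  classical
  set t : Set (E × ℝ) := {a | 0 < a.2 ∧
    L * μ (Metric.closedBall a.1 a.2) < ∫⁻ y in Metric.closedBall a.1 a.2, g y ∂μ} with ht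
  -- The Vitali covering lemma needs bounded radii. A ball in `t` has measure below `(∫ g) / L`, and
  -- for radius `r ≥ 1` its measure is at least `r` times that of the unit ball.
  have hbd : ∃ R : ℝ, ∀ a ∈ t, a.2 ≤ R := by
    have hB : μ (Metric.closedBall (0 : E) 1) ≠ 0 :=
      (Metric.measure_closedBall_pos μ _ one_pos).ne'
    have hB' : μ (Metric.closedBall (0 : E) 1) ≠ ⊤ := measure_closedBall_lt_top.ne
    have hfin : (∫⁻ y, g y ∂μ) / (L * μ (Metric.closedBall (0 : E) 1)) ≠ ⊤ :=
      ENNReal.div_ne_top hg (mul_ne_zero hL hB)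
    refine ⟨max 1 ((∫⁻ y, g y ∂μ) / (L * μ (Metric.closedBall (0 : E) 1))).toReal,
      fun a ha => le_max_iff.2 ?_⟩
    by_cases h1 : a.2 ≤ 1
    · exact Or.inl h1
    right
    rw [← ENNReal.ofReal_le_iff_le_toReal hfin,
      ENNReal.le_div_iff_mul_le (Or.inl (mul_ne_zero hL hB)) (Or.inl (ENNReal.mul_ne_top hL' hB'))]
    have h2 := ha.2.le.trans (setLIntegral_le_lintegral _ _)
    rw [Measure.addHaar_closedBall' μ _ ha.1.le] at h2
    refine le_trans ?_ h2
    rw [mul_left_comm]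
    gcongr
    exact le_self_pow₀ (not_le.1 h1).le Module.finrank_pos.ne'
  obtain ⟨R, hR⟩ := hbd
  obtain ⟨u, hut, hdis, hcov⟩ := Vitali.exists_disjoint_subfamily_covering_enlargement_closedBall
    t Prod.fst Prod.snd R hR 5 (by norm_num)
  have hcount : u.Countable := by
    refine hdis.countable_of_nonempty_interior fun a ha => ?_
    exact ⟨a.1, interior_mono Metric.ball_subset_closedBall
      (by rw [Metric.isOpen_ball.interior_eq]; exact Metric.mem_ball_self (hut ha).1)⟩
  have hsub : (maximalSublevel μ g L)ᶜ ⊆ ⋃ a ∈ u, Metric.closedBall a.1 (5 * a.2) := by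
    intro x hx
    have hx' : ∃ s : ℝ, 0 < s ∧
        L * μ (Metric.closedBall x s) < ∫⁻ y in Metric.closedBall x s, g y ∂μ := by
      by_contra! hcon
      exact hx hcon
    obtain ⟨s, hs, hlt⟩ := hx'
    obtain ⟨b, hb, hsub⟩ := hcov (x, s) ⟨hs, hlt⟩
    exact mem_biUnion hb (hsub (Metric.mem_closedBall_self hs.le))
  have hu := hcount.toEncodable
  calc L * μ (maximalSublevel μ g L)ᶜ
      ≤ L * ∑' a : u, μ (Metric.closedBall a.1.1 (5 * a.1.2)) := by
        gcongr
        exact (measure_mono hsub).trans (measure_biUnion_le μ hcount _)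
    _ = ∑' a : u, 5 ^ Module.finrank ℝ E * (L * μ (Metric.closedBall a.1.1 a.1.2)) := by
        rw [← ENNReal.tsum_mul_left]
        congr 1; ext a
        rw [Measure.addHaar_closedBall_mul_of_pos μ _ (by norm_num),
          Measure.addHaar_closedBall_center μ a.1.1 a.1.2,
          ENNReal.ofReal_pow (by norm_num)]
        norm_num
        ring
    _ ≤ ∑' a : u, 5 ^ Module.finrank ℝ E * ∫⁻ y in Metric.closedBall a.1.1 a.1.2, g y ∂μ := by
        gcongr with a
        exact (hut a.2).2.le
    _ = 5 ^ Module.finrank ℝ E * ∫⁻ y in ⋃ a ∈ u, Metric.closedBall a.1 a.2, g y ∂μ := by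
        rw [ENNReal.tsum_mul_left, lintegral_biUnion hcount
          (fun a _ => Metric.isClosed_closedBall.measurableSet) hdis]
    _ ≤ _ := by gcongr; exact Measure.restrict_le_self

/-- The part of `g` below `L / 2` contributes at most `L / 2` to any average, so only the part above
matters, at level `L / 2`. Restricting the integral to `{g > L / 2}` is what later makes the sum
over dyadic levels converge. -/
theorem mul_measure_compl_maximalSublevel_le_setLIntegral {g : E → ℝ≥0∞} {L : ℝ≥0∞} (hL : L ≠ 0)
    (hL' : L ≠ ⊤) (hgm : Measurable g) (hg : ∫⁻ y, g y ∂μ ≠ ⊤) :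
    L * μ (maximalSublevel μ g L)ᶜ ≤
      2 * 5 ^ Module.finrank ℝ E * ∫⁻ y in {y | L / 2 < g y}, g y ∂μ := by
  have hms : MeasurableSet {y | L / 2 < g y} := measurableSet_lt measurable_const hgm
  set g' := indicator {y | L / 2 < g y} g
  have hg' : ∫⁻ y, g' y ∂μ = ∫⁻ y in {y | L / 2 < g y}, g y ∂μ := lintegral_indicator hms _
  have hsub : (maximalSublevel μ g L)ᶜ ⊆ (maximalSublevel μ g' (L / 2))ᶜ := by
    refine compl_subset_compl.2 fun x hx s hs => ?_
    calc ∫⁻ y in Metric.closedBall x s, g y ∂μ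
        ≤ ∫⁻ y in Metric.closedBall x s, (g' y + L / 2) ∂μ := by
          refine lintegral_mono fun y => ?_
          by_cases hy : L / 2 < g y
          · simp [g', hy]
          · exact (not_lt.1 hy).trans le_add_self
      _ = ∫⁻ y in Metric.closedBall x s, g' y ∂μ + L / 2 * μ (Metric.closedBall x s) := by
          rw [lintegral_add_right _ measurable_const]; simp
      _ ≤ L / 2 * μ (Metric.closedBall x s) + L / 2 * μ (Metric.closedBall x s) := by
          gcongr; exact hx s hs
      _ = _ := by rw [← add_mul, ENNReal.add_halves]
  have h := mul_measure_compl_maximalSublevel_le (μ := μ) (g := g') (L := L / 2) (by simp [hL])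
    (ENNReal.div_ne_top hL' (by norm_num))
    (ne_top_of_le_ne_top hg (lintegral_mono fun y => indicator_le_self _ _ _))
  calc L * μ (maximalSublevel μ g L)ᶜ ≤ L * μ (maximalSublevel μ g' (L / 2))ᶜ := by gcongr
    _ = 2 * (L / 2 * μ (maximalSublevel μ g' (L / 2))ᶜ) := by
        rw [← mul_assoc, ENNReal.mul_div_cancel two_ne_zero ENNReal.ofNat_ne_top]
    _ ≤ 2 * (5 ^ Module.finrank ℝ E * ∫⁻ y, g' y ∂μ) := by gcongr
    _ = _ := by rw [hg', mul_assoc]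

end Maximal

/-! ### Pointwise Poincaré inequalities -/

section Poincare

variable {E : Type*} [NormedAddCommGroup E] [NormedSpace ℝ E]

theorem enorm_sub_le_lintegral_segment {φ : E → ℝ} (hφ : ContDiff ℝ 1 φ) (x z : E) :
    ‖φ z - φ x‖ₑ ≤ ∫⁻ τ in Ioc (0 : ℝ) 1, ‖fderiv ℝ φ (x + τ • (z - x))‖ₑ * ‖z - x‖ₑ := by
  have hd : ∀ τ : ℝ, HasDerivAt (fun τ : ℝ => φ (x + τ • (z - x)))
      (fderiv ℝ φ (x + τ • (z - x)) (z - x)) τ := fun τ => by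
    have h1 : HasDerivAt (fun τ : ℝ => x + τ • (z - x)) (z - x) τ := by
      simpa using ((hasDerivAt_id τ).smul_const (z - x)).const_add x
    exact ((hφ.differentiable one_ne_zero) _).hasFDerivAt.comp_hasDerivAt τ h1
  have hc : Continuous fun τ : ℝ => fderiv ℝ φ (x + τ • (z - x)) (z - x) := by
    have := hφ.continuous_fderiv one_ne_zero
    fun_prop
  have h := intervalIntegral.integral_eq_sub_of_hasDerivAt (fun τ _ => hd τ)
    (hc.intervalIntegrable 0 1)
  simp only [one_smul, add_sub_cancel, zero_smul, add_zero] at h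
  rw [← h, intervalIntegral.integral_of_le zero_le_one]
  refine (enorm_integral_le_lintegral_enorm _).trans (lintegral_mono fun τ => ?_)
  exact ContinuousLinearMap.le_opENorm _ _

variable [FiniteDimensional ℝ E]
  [MeasurableSpace E] [BorelSpace E] {μ : Measure E} [μ.IsAddHaarMeasure]

theorem exists_measure_closedBall_eq : ∃ V : ℝ, 0 < V ∧ ∀ (x : E) {r : ℝ}, 0 ≤ r →
    μ (Metric.closedBall x r) = ENNReal.ofReal (r ^ Module.finrank ℝ E * V) := by
  refine ⟨(μ (Metric.closedBall (0 : E) 1)).toReal, ENNReal.toReal_pos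
    (Metric.measure_closedBall_pos μ _ one_pos).ne' measure_closedBall_lt_top.ne, fun x r hr => ?_⟩
  rw [ENNReal.ofReal_mul (by positivity), ENNReal.ofReal_toReal measure_closedBall_lt_top.ne,
    Measure.addHaar_closedBall' μ x hr]

/-- The homothety with centre `x` and ratio `τ` carries the ball of radius `r` to that of radius `τ
r`. Its Jacobian cancels the ratio of their measures, so the bound on averages is the same for every
`τ`. -/
theorem setLIntegral_homothety_le {g : E → ℝ≥0∞} (hg : Measurable g) {L : ℝ≥0∞} {x : E}
    (hx : x ∈ maximalSublevel μ g L) {τ r : ℝ} (hτ : 0 < τ) (hr : 0 < r) :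
    ∫⁻ z in Metric.closedBall x r, g (x + τ • (z - x)) ∂μ ≤ L * μ (Metric.closedBall 0 r) := by
  set F : E → ℝ≥0∞ := indicator (Metric.closedBall x (τ * r)) g
  have hF : Measurable F := hg.indicator Metric.isClosed_closedBall.measurableSet
  have h1 : ∫⁻ z in Metric.closedBall x r, g (x + τ • (z - x)) ∂μ ≤
      ∫⁻ z, F (x + τ • (z - x)) ∂μ := by
    rw [← lintegral_indicator Metric.isClosed_closedBall.measurableSet]
    refine lintegral_mono fun z => ?_
    by_cases hz : z ∈ Metric.closedBall x r
    · have : x + τ • (z - x) ∈ Metric.closedBall x (τ * r) := by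
        rw [mem_closedBall_iff_norm, add_sub_cancel_left, norm_smul, Real.norm_of_nonneg hτ.le]
        gcongr
        exact mem_closedBall_iff_norm.1 hz
      simp [F, hz, this]
    · simp [hz]
  have h2 : ∫⁻ z, F (x + τ • (z - x)) ∂μ = ∫⁻ w, F (x + τ • w) ∂μ :=
    lintegral_sub_right_eq_self (fun w => F (x + τ • w)) x
  have h3 : ∫⁻ w, F (x + τ • w) ∂μ =
      ENNReal.ofReal |(τ ^ Module.finrank ℝ E)⁻¹| * ∫⁻ w, F (x + w) ∂μ := by
    have := lintegral_map (μ := μ) (f := fun w => F (x + w)) (g := fun w : E => τ • w)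
      (by fun_prop) (by fun_prop)
    rw [← this, Measure.map_addHaar_smul μ hτ.ne', lintegral_smul_measure]
    rfl
  have h4 : ∫⁻ w, F (x + w) ∂μ = ∫⁻ w, F w ∂μ := lintegral_add_left_eq_self F x
  have h5 : ∫⁻ w, F w ∂μ = ∫⁻ w in Metric.closedBall x (τ * r), g w ∂μ :=
    lintegral_indicator Metric.isClosed_closedBall.measurableSet _
  have h6 : ENNReal.ofReal |(τ ^ Module.finrank ℝ E)⁻¹| *
      ENNReal.ofReal (τ ^ Module.finrank ℝ E) = 1 := by
    have hp : 0 < τ ^ Module.finrank ℝ E := by positivity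
    rw [← ENNReal.ofReal_mul (abs_nonneg _), abs_of_pos (by positivity), inv_mul_cancel₀ hp.ne',
      ENNReal.ofReal_one]
  calc _ ≤ ENNReal.ofReal |(τ ^ Module.finrank ℝ E)⁻¹| *
        ∫⁻ w in Metric.closedBall x (τ * r), g w ∂μ := by
        rw [← h5, ← h4, ← h3, ← h2]; exact h1
    _ ≤ ENNReal.ofReal |(τ ^ Module.finrank ℝ E)⁻¹| *
        (L * μ (Metric.closedBall x (τ * r))) := by gcongr; exact hx _ (by positivity)
    _ = (ENNReal.ofReal |(τ ^ Module.finrank ℝ E)⁻¹| *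
      ENNReal.ofReal (τ ^ Module.finrank ℝ E)) * (L * μ (Metric.closedBall 0 r)) := by
        rw [Measure.addHaar_closedBall_mul_of_pos μ _ hτ]; ring
    _ = _ := by rw [h6, one_mul]

/-- The oscillation of a `C¹` function around a point where the maximal function of its gradient
is at most `L`. -/
theorem setLIntegral_enorm_sub_le {φ : E → ℝ} (hφ : ContDiff ℝ 1 φ) {L : ℝ≥0∞} {x : E}
    (hx : x ∈ maximalSublevel μ (fun y => ‖fderiv ℝ φ y‖ₑ) L) {r : ℝ} (hr : 0 < r) :
    ∫⁻ z in Metric.closedBall x r, ‖φ z - φ x‖ₑ ∂μ ≤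
      ENNReal.ofReal r * (L * μ (Metric.closedBall 0 r)) := by
  have hcont := hφ.continuous_fderiv one_ne_zero
  have hg : Measurable fun y => ‖fderiv ℝ φ y‖ₑ := by fun_prop
  calc ∫⁻ z in Metric.closedBall x r, ‖φ z - φ x‖ₑ ∂μ
      ≤ ∫⁻ z in Metric.closedBall x r, (∫⁻ τ in Ioc (0 : ℝ) 1,
        ENNReal.ofReal r * ‖fderiv ℝ φ (x + τ • (z - x))‖ₑ) ∂μ := by
        refine setLIntegral_mono' Metric.isClosed_closedBall.measurableSet fun z hz => ?_
        refine (enorm_sub_le_lintegral_segment hφ x z).trans (lintegral_mono fun τ => ?_)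
        rw [mul_comm]
        gcongr
        rw [← ofReal_norm]
        exact ENNReal.ofReal_le_ofReal (mem_closedBall_iff_norm.1 hz)
    _ = ∫⁻ τ in Ioc (0 : ℝ) 1, (∫⁻ z in Metric.closedBall x r,
        ENNReal.ofReal r * ‖fderiv ℝ φ (x + τ • (z - x))‖ₑ ∂μ) := by
        refine lintegral_lintegral_swap (Measurable.aemeasurable ?_)
        refine Measurable.const_mul ?_ _
        exact hg.comp (by fun_prop : Measurable fun p : E × ℝ => x + p.2 • (p.1 - x))
    _ ≤ ∫⁻ τ in Ioc (0 : ℝ) 1, ENNReal.ofReal r * (L * μ (Metric.closedBall 0 r)) := by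
        refine setLIntegral_mono' measurableSet_Ioc fun τ hτ => ?_
        have hm : Measurable fun z : E => ‖fderiv ℝ φ (x + τ • (z - x))‖ₑ :=
          hg.comp (by fun_prop : Measurable fun z : E => x + τ • (z - x))
        rw [lintegral_const_mul _ hm]
        gcongr
        exact setLIntegral_homothety_le hg hx hτ.1 hr
    _ = _ := by simp

/-- A `C¹` function which vanishes on a ball of radius `κ t` at distance at most `t`. -/
theorem abs_le_of_eqOn_zero_closedBall {φ : E → ℝ} (hφ : ContDiff ℝ 1 φ) {L : ℝ} (hL : 0 ≤ L)
    {x c : E} (hx : x ∈ maximalSublevel μ (fun y => ‖fderiv ℝ φ y‖ₑ) (ENNReal.ofReal L)) {t κ : ℝ}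
    (ht : 0 < t) (hκ : 0 < κ) (hκ1 : κ ≤ 1) (hxc : dist c x ≤ t)
    (h0 : ∀ z ∈ Metric.closedBall c (κ * t), φ z = 0) :
    |φ x| ≤ 2 * t * (2 / κ) ^ Module.finrank ℝ E * L := by
  obtain ⟨V, hB, hV⟩ := exists_measure_closedBall_eq (μ := μ)
  have hsub : Metric.closedBall c (κ * t) ⊆ Metric.closedBall x (2 * t) :=
    Metric.closedBall_subset_closedBall' (by nlinarith)
  -- On the small ball `|φ z - φ x| = |φ x|`. That ball lies in the ball of radius `2 t` about `x`,
  -- where the oscillation estimate applies; the ratio of the two measures produces `(2 / κ) ^ n`.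
  have h1 : ‖φ x‖ₑ * μ (Metric.closedBall c (κ * t)) ≤
      ENNReal.ofReal (2 * t) * (ENNReal.ofReal L * μ (Metric.closedBall 0 (2 * t))) := by
    calc ‖φ x‖ₑ * μ (Metric.closedBall c (κ * t))
        = ∫⁻ z in Metric.closedBall c (κ * t), ‖φ z - φ x‖ₑ ∂μ := by
          rw [← setLIntegral_const]
          refine setLIntegral_congr_fun Metric.isClosed_closedBall.measurableSet fun z hz => ?_
          simp [h0 z hz]
      _ ≤ ∫⁻ z in Metric.closedBall x (2 * t), ‖φ z - φ x‖ₑ ∂μ := lintegral_mono_set hsub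
      _ ≤ _ := setLIntegral_enorm_sub_le hφ hx (by positivity)
  rw [hV _ (by positivity), hV _ (by positivity), ← ofReal_norm,
    ← ENNReal.ofReal_mul (by positivity), ← ENNReal.ofReal_mul (by positivity),
    ← ENNReal.ofReal_mul (by positivity), ENNReal.ofReal_le_ofReal_iff (by positivity),
    Real.norm_eq_abs] at h1
  set n := Module.finrank ℝ E
  have h2 : |φ x| * (κ * t) ^ n ≤ 2 * t * L * (2 * t) ^ n := by
    refine le_of_mul_le_mul_right ?_ hB
    linarith
  rw [mul_pow, mul_pow] at h2
  have htn : 0 < t ^ n := by positivity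
  have hκn : 0 < κ ^ n := by positivity
  have h3 : |φ x| * κ ^ n ≤ 2 * t * L * 2 ^ n := by
    refine le_of_mul_le_mul_right ?_ htn
    linarith
  rw [div_pow]
  calc |φ x| ≤ 2 * t * L * 2 ^ n / κ ^ n := (le_div_iff₀ hκn).2 h3
    _ = _ := by ring

/-- The Lipschitz estimate for a `C¹` function on sublevels of the maximal function. -/
theorem abs_sub_le_of_mem_maximalSublevel {φ : E → ℝ} (hφ : ContDiff ℝ 1 φ) {L : ℝ} (hL : 0 ≤ L)
    {x y : E} (hx : x ∈ maximalSublevel μ (fun y => ‖fderiv ℝ φ y‖ₑ) (ENNReal.ofReal L))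
    (hy : y ∈ maximalSublevel μ (fun y => ‖fderiv ℝ φ y‖ₑ) (ENNReal.ofReal L)) :
    |φ x - φ y| ≤ 4 * 2 ^ Module.finrank ℝ E * L * dist x y := by
  rcases eq_or_ne x y with rfl | hxy
  · simp
  set t := dist x y with htdef
  have ht : 0 < t := dist_pos.2 hxy
  obtain ⟨V, hB, hV⟩ := exists_measure_closedBall_eq (μ := μ)
  have hsub : Metric.closedBall x t ⊆ Metric.closedBall y (2 * t) :=
    Metric.closedBall_subset_closedBall' (by linarith)
  have hsub' : Metric.closedBall x t ⊆ Metric.closedBall x (2 * t) :=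
    Metric.closedBall_subset_closedBall (by linarith)
  -- Average `|φ x - φ y| ≤ |φ z - φ x| + |φ z - φ y|` over `z` in the ball of radius `t` about `x`,
  -- which lies in the balls of radius `2 t` about both points.
  have h1 : ‖φ x - φ y‖ₑ * μ (Metric.closedBall x t) ≤
      ENNReal.ofReal (2 * t) * (ENNReal.ofReal L * μ (Metric.closedBall 0 (2 * t))) +
      ENNReal.ofReal (2 * t) * (ENNReal.ofReal L * μ (Metric.closedBall 0 (2 * t))) := by
    have hm : Measurable fun z => ‖φ z - φ x‖ₑ := by
      have := hφ.continuous
      fun_prop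
    calc ‖φ x - φ y‖ₑ * μ (Metric.closedBall x t)
        = ∫⁻ z in Metric.closedBall x t, ‖φ x - φ y‖ₑ ∂μ := by rw [← setLIntegral_const]
      _ ≤ ∫⁻ z in Metric.closedBall x t, (‖φ z - φ x‖ₑ + ‖φ z - φ y‖ₑ) ∂μ := by
          refine lintegral_mono fun z => ?_
          rw [add_comm, ← enorm_neg (φ z - φ x)]
          refine le_trans (le_of_eq ?_) (enorm_add_le _ _)
          congr 1; ring
      _ = ∫⁻ z in Metric.closedBall x t, ‖φ z - φ x‖ₑ ∂μ +
          ∫⁻ z in Metric.closedBall x t, ‖φ z - φ y‖ₑ ∂μ := lintegral_add_left hm _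
      _ ≤ ∫⁻ z in Metric.closedBall x (2 * t), ‖φ z - φ x‖ₑ ∂μ +
          ∫⁻ z in Metric.closedBall y (2 * t), ‖φ z - φ y‖ₑ ∂μ :=
          add_le_add (lintegral_mono_set hsub') (lintegral_mono_set hsub)
      _ ≤ _ := add_le_add (setLIntegral_enorm_sub_le hφ hx (by positivity))
          (setLIntegral_enorm_sub_le hφ hy (by positivity))
  rw [hV _ ht.le, hV _ (by positivity), ← ofReal_norm,
    ← ENNReal.ofReal_mul (by positivity), ← ENNReal.ofReal_mul (by positivity),
    ← ENNReal.ofReal_mul (by positivity), ← ENNReal.ofReal_add (by positivity) (by positivity),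
    ENNReal.ofReal_le_ofReal_iff (by positivity), Real.norm_eq_abs] at h1
  set n := Module.finrank ℝ E
  have htn : 0 < t ^ n := by positivity
  rw [mul_pow] at h1
  refine le_of_mul_le_mul_right ?_ (mul_pos htn hB)
  linarith

end Poincare

/-! ### Exterior balls of Lipschitz domains -/

section Exterior

variable {N : ℕ} {Ω : Set (Rn N)}

/-- The point `b - s ν` lies at least `s` below the graph. A displacement `e` changes the height by
at most `|e|` and the graph by at most `2 K |e|`, so the points with `|e| ≤ s / (2 K + 2)` stay
strictly below it. -/
theorem HasLipschitzBoundary.exists_ball_of_mem_frontier (hΩ : HasLipschitzBoundary Ω)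
    (hΩo : IsOpen Ω) {p : Rn N} (hp : p ∈ frontier Ω) :
    ∃ κ s₀ : ℝ, 0 < κ ∧ 0 < s₀ ∧ ∃ U ∈ 𝓝 p, ∀ b ∈ U ∩ frontier Ω, ∀ s, 0 < s → s < s₀ →
      ∃ c, dist c b ≤ s ∧ Metric.closedBall c (κ * s) ⊆ Ωᶜ := by
  obtain ⟨ν, g, K, r, hν, hg, hr, hΩr⟩ := hΩ p hp
  set κ : ℝ := 1 / (2 * K + 2) with hκdef
  have hK : (0 : ℝ) ≤ K := K.2
  have hκ : 0 < κ := by positivity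
  have hκK : κ * (2 * K + 2) = 1 := by rw [hκdef]; field_simp
  have hκ1 : κ ≤ 1 := by nlinarith
  -- The budget `r / 2 + r / 4 + r / 4` for `|b - p|`, `s` and `κ s` keeps the exterior ball within
  -- the chart of radius `r`.
  refine ⟨κ, r / 4, hκ, by positivity, Metric.ball p (r / 2),
    Metric.ball_mem_nhds p (by positivity), ?_⟩
  rintro b ⟨hb, hbf⟩ s hs hsr
  have hbr : b ∈ Metric.ball p r := Metric.ball_subset_ball (by linarith) hb
  have hbΩ : b ∉ Ω := fun h => by
    rw [hΩo.frontier_eq] at hbf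
    exact hbf.2 h
  have hb1 : inner ℝ ν b ≤ g (b - inner ℝ ν b • ν) := by
    by_contra! hlt
    exact hbΩ ((hΩr b hbr).2 hlt)
  refine ⟨b - s • ν, by simp [norm_smul, hν, abs_of_pos hs], fun z hz hzΩ => ?_⟩
  set e := z - (b - s • ν) with he
  have hez : z = b - s • ν + e := by rw [he]; abel
  have hen : ‖e‖ ≤ κ * s := mem_closedBall_iff_norm.1 hz
  have hzr : z ∈ Metric.ball p r := by
    rw [mem_ball_iff_norm] at hb ⊢
    have : z - p = (b - p) - s • ν + e := by rw [hez]; abel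
    rw [this]
    calc ‖b - p - s • ν + e‖ ≤ ‖b - p‖ + ‖s • ν‖ + ‖e‖ :=
          (norm_add_le _ _).trans (by gcongr; exact norm_sub_le _ _)
      _ < r := by
          rw [norm_smul, hν, Real.norm_of_nonneg hs.le]
          nlinarith
  have hz1 := (hΩr z hzr).1 hzΩ
  have hνν : inner ℝ ν ν = (1 : ℝ) := by rw [real_inner_self_eq_norm_sq, hν]; norm_num
  have hin : inner ℝ ν z = inner ℝ ν b - s + inner ℝ ν e := by
    rw [hez, inner_add_right, inner_sub_right, inner_smul_right, hνν]; ring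
  have hine : |inner ℝ ν e| ≤ ‖e‖ := by
    have := abs_real_inner_le_norm ν e
    rwa [hν, one_mul] at this
  have hproj : z - inner ℝ ν z • ν - (b - inner ℝ ν b • ν) = e - (inner ℝ ν e : ℝ) • ν := by
    rw [hin, hez]; module
  have hgl : g (b - inner ℝ ν b • ν) - g (z - inner ℝ ν z • ν) ≤ K * (2 * ‖e‖) := by
    have h1 := hg.dist_le_mul (b - inner ℝ ν b • ν) (z - inner ℝ ν z • ν)
    rw [Real.dist_eq, dist_comm, dist_eq_norm, hproj] at h1
    have h2 : ‖e - (inner ℝ ν e : ℝ) • ν‖ ≤ 2 * ‖e‖ := by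
      refine (norm_sub_le _ _).trans ?_
      rw [norm_smul, hν, mul_one, Real.norm_eq_abs]
      linarith
    exact (le_abs_self _).trans (h1.trans (by gcongr))
  have h3 := (abs_le.1 hine).2
  nlinarith

/-- A bounded Lipschitz domain has exterior balls of proportional size near its boundary. -/
theorem HasLipschitzBoundary.exists_exterior_closedBall (hΩ : HasLipschitzBoundary Ω)
    (hΩo : IsOpen Ω) (hb : Bornology.IsBounded Ω) :
    ∃ κ C : ℝ, 0 < κ ∧ κ ≤ 1 ∧ 0 < C ∧ ∀ x ∈ Ω, ∀ y ∉ Ω, ∃ (c : Rn N) (t : ℝ),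
      0 < t ∧ dist c x ≤ t ∧ t ≤ C * dist x y ∧ Metric.closedBall c (κ * t) ⊆ Ωᶜ := by
  have hcomp : IsCompact (frontier Ω) :=
    Metric.isCompact_of_isClosed_isBounded isClosed_frontier
      (hb.closure.subset frontier_subset_closure)
  have huni : ∃ κ s₀ : ℝ, 0 < κ ∧ 0 < s₀ ∧ ∀ b ∈ frontier Ω, ∀ s, 0 < s → s < s₀ →
      ∃ c, dist c b ≤ s ∧ Metric.closedBall c (κ * s) ⊆ Ωᶜ := by
    refine hcomp.induction_on (p := fun S => ∃ κ s₀ : ℝ, 0 < κ ∧ 0 < s₀ ∧ ∀ b ∈ S, ∀ s, 0 < s →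
      s < s₀ → ∃ c, dist c b ≤ s ∧ Metric.closedBall c (κ * s) ⊆ Ωᶜ) ?_ ?_ ?_ ?_
    · exact ⟨1, 1, one_pos, one_pos, fun b hb => hb.elim⟩
    · rintro S T hST ⟨κ, s₀, h1, h2, h3⟩
      exact ⟨κ, s₀, h1, h2, fun b hb => h3 b (hST hb)⟩
    · rintro S T ⟨κ, s₀, h1, h2, h3⟩ ⟨κ', s₀', h1', h2', h3'⟩
      refine ⟨min κ κ', min s₀ s₀', lt_min h1 h1', lt_min h2 h2', fun b hb s hs hs' => ?_⟩
      rcases hb with hb | hb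
      · obtain ⟨c, hc, hc'⟩ := h3 b hb s hs (hs'.trans_le (min_le_left _ _))
        refine ⟨c, hc, (Metric.closedBall_subset_closedBall ?_).trans hc'⟩
        gcongr; exact min_le_left _ _
      · obtain ⟨c, hc, hc'⟩ := h3' b hb s hs (hs'.trans_le (min_le_right _ _))
        refine ⟨c, hc, (Metric.closedBall_subset_closedBall ?_).trans hc'⟩
        gcongr; exact min_le_right _ _
    · intro p hp
      obtain ⟨κ, s₀, h1, h2, U, hU, h3⟩ := hΩ.exists_ball_of_mem_frontier hΩo hp
      exact ⟨U ∩ frontier Ω, mem_nhdsWithin.2 (by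
        obtain ⟨V, hVU, hV, hpV⟩ := mem_nhds_iff.1 hU
        exact ⟨V, hV, hpV, fun z hz => ⟨hVU hz.1, hz.2⟩⟩), κ, s₀, h1, h2, h3⟩
  obtain ⟨κ, s₀, hκ, hs₀, huni⟩ := huni
  obtain ⟨D, hD, hdiam⟩ : ∃ D : ℝ, 0 < D ∧ ∀ x ∈ closure Ω, ∀ y ∈ closure Ω, dist x y ≤ D := by
    obtain ⟨D, hD⟩ := Metric.isBounded_iff.1 hb.closure
    exact ⟨max D 1, lt_max_of_lt_right one_pos, fun x hx y hy =>
      (hD hx hy).trans (le_max_left _ _)⟩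
  -- Exterior balls are available only at scales below `s₀`. The factor `η` brings every distance `d
  -- ≤ D` into that range, so one proportionality constant serves points far from the boundary too.
  set η : ℝ := min 1 (s₀ / (2 * D)) with hη
  have hη0 : 0 < η := lt_min one_pos (by positivity)
  have hη1 : η ≤ 1 := min_le_left _ _
  refine ⟨min 1 (κ * η / 2), 2, lt_min one_pos (by positivity), min_le_left _ _, two_pos,
    fun x hx y hy => ?_⟩
  -- The exterior ball is taken near a boundary point on the segment from `x` to `y`, which is no
  -- farther from `x` than `y` is.
  obtain ⟨b, hbs, hbf⟩ : (segment ℝ x y ∩ frontier Ω).Nonempty := by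
    by_contra hne
    have hout : ∀ z ∈ segment ℝ x y, z ∉ Ω → z ∉ closure Ω := fun z hz hzΩ hzc =>
      hne ⟨z, hz, by rw [hΩo.frontier_eq]; exact ⟨hzc, hzΩ⟩⟩
    obtain ⟨z, -, hz, hz'⟩ := (convex_segment x y).isPreconnected Ω (closure Ω)ᶜ hΩo
      isClosed_closure.isOpen_compl (fun z hz => or_iff_not_imp_left.2 (hout z hz))
      ⟨x, left_mem_segment ℝ x y, hx⟩
      ⟨y, right_mem_segment ℝ x y, hout y (right_mem_segment ℝ x y) hy⟩
    exact hz' (subset_closure hz)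
  have hbx : b ≠ x := by
    rintro rfl
    rw [hΩo.frontier_eq] at hbf
    exact hbf.2 hx
  set d := dist b x with hd
  have hd0 : 0 < d := dist_pos.2 hbx
  have hdy : d ≤ dist x y := by
    have := dist_add_dist_of_mem_segment hbs
    rw [hd, dist_comm]
    linarith [dist_nonneg (x := b) (y := y)]
  have hdD : d ≤ D := hdiam b (frontier_subset_closure hbf) x (subset_closure hx)
  have hsd : η * d < s₀ := by
    calc η * d ≤ s₀ / (2 * D) * D := by gcongr; exact min_le_right _ _
      _ = s₀ / 2 := by field_simp
      _ < s₀ := by linarith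
  obtain ⟨c, hc, hcb⟩ := huni b hbf (η * d) (by positivity) hsd
  refine ⟨c, 2 * d, by positivity, ?_, by linarith,
    (Metric.closedBall_subset_closedBall ?_).trans hcb⟩
  · have := dist_triangle c b x
    nlinarith
  · calc min 1 (κ * η / 2) * (2 * d) ≤ κ * η / 2 * (2 * d) := by gcongr; exact min_le_right _ _
      _ = κ * (η * d) := by ring

end Exterior

/-! ### Basic facts on `H¹₀(Ω)` -/

section Basic

variable {N : ℕ} {Ω : TopologicalSpace.Opens (Rn N)}

instance : CompleteSpace (H10 Ω) :=
  (Submodule.isClosed_topologicalClosure _).completeSpace_coe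

variable (Ω) in
/-- The underlying function as a continuous linear map. -/
def fnL : H10 Ω →L[ℝ] Lp ℝ 2 (vol Ω) :=
  (WithLp.fstL 2 ℝ (Lp ℝ 2 (vol Ω)) (Lp (Rn N) 2 (vol Ω))).comp (H10 Ω).subtypeL

variable (Ω) in
/-- The weak gradient as a continuous linear map. -/
def wgradL : H10 Ω →L[ℝ] Lp (Rn N) 2 (vol Ω) :=
  (WithLp.sndL 2 ℝ (Lp ℝ 2 (vol Ω)) (Lp (Rn N) 2 (vol Ω))).comp (H10 Ω).subtypeL

theorem wgrad_add (y z : H10 Ω) : wgrad (y + z) = wgrad y + wgrad z := map_add (wgradL Ω) y z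

theorem wgrad_sub (y z : H10 Ω) : wgrad (y - z) = wgrad y - wgrad z := map_sub (wgradL Ω) y z

theorem fn_add (y z : H10 Ω) : fn (y + z) = fn y + fn z := map_add (fnL Ω) y z

theorem fn_sub (y z : H10 Ω) : fn (y - z) = fn y - fn z := map_sub (fnL Ω) y z

theorem fn_smul (c : ℝ) (y : H10 Ω) : fn (c • y) = c • fn y := map_smul (fnL Ω) c y

theorem fn_test_ae (φ : 𝓓(Ω, ℝ)) : fn (testH10 Ω φ) =ᵐ[vol Ω] φ :=
  (memLp_test Ω φ).coeFn_toLp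

theorem wgrad_test_ae (φ : 𝓓(Ω, ℝ)) : wgrad (testH10 Ω φ) =ᵐ[vol Ω] ∇ (φ : Rn N → ℝ) :=
  (memLp_gradient_test Ω φ).coeFn_toLp

theorem norm_sq_eq (y : H10 Ω) : ‖y‖ ^ 2 = ‖fn y‖ ^ 2 + ‖wgrad y‖ ^ 2 :=
  WithLp.prod_norm_sq_eq_of_L2 (y : L2Pair Ω)

theorem norm_wgrad_le (y : H10 Ω) : ‖wgrad y‖ ≤ ‖y‖ := by
  have := norm_sq_eq y
  refine (sq_le_sq₀ (norm_nonneg _) (norm_nonneg _)).1 ?_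
  nlinarith [sq_nonneg ‖fn y‖]

theorem eq_of_fn_eq_of_wgrad_eq {y z : H10 Ω} (h₁ : fn y = fn z) (h₂ : wgrad y = wgrad z) :
    y = z :=
  Subtype.ext (WithLp.ofLp_injective 2 (Prod.ext h₁ h₂))

theorem norm_gradient_eq (φ : Rn N → ℝ) (x : Rn N) : ‖∇ φ x‖ = ‖fderiv ℝ φ x‖ :=
  LinearIsometryEquiv.norm_map _ _

theorem fderiv_eq_inner_gradient (φ : Rn N → ℝ) (x v : Rn N) :
    fderiv ℝ φ x v = inner ℝ (∇ φ x) v := by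
  rw [gradient, InnerProductSpace.toDual_symm_apply]

theorem gradient_eq_zero_of_notMem {φ : 𝓓(Ω, ℝ)} {x : Rn N} (hx : x ∉ Ω) :
    ∇ (φ : Rn N → ℝ) x = 0 := by
  rw [← norm_eq_zero, norm_gradient_eq, norm_eq_zero]
  exact image_eq_zero_of_notMem_tsupport fun h =>
    hx (φ.tsupport_subset (tsupport_fderiv_subset ℝ h))

theorem test_eq_zero_of_notMem {φ : 𝓓(Ω, ℝ)} {x : Rn N} (hx : x ∉ Ω) : φ x = 0 :=
  image_eq_zero_of_notMem_tsupport fun h => hx (φ.tsupport_subset h)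

theorem exists_seq_test_tendsto (u : H10 Ω) :
    ∃ φ : ℕ → 𝓓(Ω, ℝ), Tendsto (fun k => testH10 Ω (φ k)) atTop (𝓝 u) := by
  obtain ⟨x, hx, hlim⟩ := mem_closure_iff_seq_limit.1 (denseRange_testH10 u)
  choose φ hφ using hx
  exact ⟨φ, by simpa only [hφ] using hlim⟩

theorem isFiniteMeasure_vol (hΩ : Bornology.IsBounded (Ω : Set (Rn N))) :
    IsFiniteMeasure (vol Ω) :=
  isFiniteMeasure_restrict.2 hΩ.measure_lt_top.ne

theorem lintegral_enorm_le_of_L2 {F : Type*} [NormedAddCommGroup F] (f : Lp F 2 (vol Ω)) :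
    ∫⁻ x, ‖f x‖ₑ ∂(vol Ω) ≤ ENNReal.ofReal ‖f‖ * (vol Ω) univ ^ (1 / 2 : ℝ) := by
  have h := eLpNorm_le_eLpNorm_mul_rpow_measure_univ (μ := vol Ω) (f := f) (p := 1) (q := 2)
    (by norm_num) (Lp.aestronglyMeasurable f)
  rw [eLpNorm_one_eq_lintegral_enorm] at h
  refine h.trans (le_of_eq ?_)
  rw [Lp.norm_def, ENNReal.ofReal_toReal (Lp.eLpNorm_ne_top f)]
  norm_num

theorem tendsto_ae_subseq_of_tendsto {φ : ℕ → 𝓓(Ω, ℝ)} {u : H10 Ω}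
    (h : Tendsto (fun k => testH10 Ω (φ k)) atTop (𝓝 u)) :
    ∃ σ : ℕ → ℕ, StrictMono σ ∧
      ∀ᵐ x ∂(vol Ω), Tendsto (fun k => φ (σ k) x) atTop (𝓝 (fn u x)) := by
  have h1 : Tendsto (fun k => fn (testH10 Ω (φ k))) atTop (𝓝 (fn u)) :=
    ((fnL Ω).continuous.tendsto u).comp h
  obtain ⟨σ, hσ, hae⟩ := (tendstoInMeasure_of_tendsto_Lp h1).exists_seq_tendsto_ae
  refine ⟨σ, hσ, ?_⟩
  have h2 : ∀ᵐ x ∂(vol Ω), ∀ k, fn (testH10 Ω (φ k)) x = φ k x :=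
    ae_all_iff.2 fun k => fn_test_ae (φ k)
  filter_upwards [hae, h2] with x hx hx2
  simpa only [hx2] using hx

theorem lintegral_gradient_sub_le (φ : 𝓓(Ω, ℝ)) (u : H10 Ω) :
    ∫⁻ x, ‖∇ (φ : Rn N → ℝ) x - wgrad u x‖ₑ ∂(vol Ω) ≤
      ENNReal.ofReal ‖testH10 Ω φ - u‖ * (vol Ω) univ ^ (1 / 2 : ℝ) := by
  calc ∫⁻ x, ‖∇ (φ : Rn N → ℝ) x - wgrad u x‖ₑ ∂(vol Ω)
      = ∫⁻ x, ‖wgrad (testH10 Ω φ - u) x‖ₑ ∂(vol Ω) := by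
        refine lintegral_congr_ae ?_
        rw [wgrad_sub]
        filter_upwards [Lp.coeFn_sub (wgrad (testH10 Ω φ)) (wgrad u), wgrad_test_ae φ] with x h1 h2
        rw [h1, Pi.sub_apply, h2]
    _ ≤ _ := lintegral_enorm_le_of_L2 _
    _ ≤ _ := by gcongr; exact norm_wgrad_le _

/-- The norm of the weak gradient, extended by zero. -/
def gradENorm (u : H10 Ω) : Rn N → ℝ≥0∞ := indicator (Ω : Set (Rn N)) fun x => ‖wgrad u x‖ₑ

theorem measurable_gradENorm (u : H10 Ω) : Measurable (gradENorm u) :=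
  (Lp.stronglyMeasurable (wgrad u)).measurable.enorm.indicator Ω.isOpen.measurableSet

theorem lintegral_gradENorm_ne_top (hΩ : Bornology.IsBounded (Ω : Set (Rn N))) (u : H10 Ω) :
    ∫⁻ x, gradENorm u x ≠ ⊤ := by
  have := isFiniteMeasure_vol hΩ
  rw [gradENorm, lintegral_indicator Ω.isOpen.measurableSet]
  exact ne_top_of_le_ne_top (ENNReal.mul_ne_top ENNReal.ofReal_ne_top
    (ENNReal.rpow_ne_top_of_nonneg (by norm_num) (measure_ne_top _ _)))
    (lintegral_enorm_le_of_L2 (wgrad u))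

/-- Elements of `H¹₀(Ω)` are limits of test functions with control of the maximal functions of
the gradients. -/
theorem exists_seq_test_maximalSublevel [Nontrivial (Rn N)]
    (hΩ : Bornology.IsBounded (Ω : Set (Rn N))) (u : H10 Ω) :
    ∃ φ : ℕ → 𝓓(Ω, ℝ),
      (∀ᵐ x ∂(vol Ω), Tendsto (fun k => φ k x) atTop (𝓝 (fn u x))) ∧
      ∀ᵐ x, ∀ L : ℝ≥0∞, x ∈ maximalSublevel volume (gradENorm u) L → ∀ᶠ k in atTop,
        x ∈ maximalSublevel volume (fun y => ‖fderiv ℝ (φ k : Rn N → ℝ) y‖ₑ)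
          (L + ENNReal.ofReal ((1 / 2) ^ k)) := by
  have hfin := isFiniteMeasure_vol hΩ
  obtain ⟨φ₀, hφ₀⟩ := exists_seq_test_tendsto u
  obtain ⟨σ, hσ, hae⟩ := tendsto_ae_subseq_of_tendsto hφ₀
  have hφ₁ := hφ₀.comp hσ.tendsto_atTop
  set M : ℝ≥0∞ := (vol Ω) univ ^ (1 / 2 : ℝ) with hM
  have hMt : M ≠ ⊤ := ENNReal.rpow_ne_top_of_nonneg (by norm_num) (measure_ne_top _ _)
  have hlim : Tendsto (fun k => ENNReal.ofReal ‖testH10 Ω (φ₀ (σ k)) - u‖ * M) atTop (𝓝 0) := by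
    have h1 : Tendsto (fun k => ‖testH10 Ω (φ₀ (σ k)) - u‖) atTop (𝓝 0) :=
      tendsto_iff_norm_sub_tendsto_zero.1 hφ₁
    have h2 := ENNReal.Tendsto.mul_const (ENNReal.tendsto_ofReal h1) (Or.inr hMt)
    simpa using h2
  -- A fast subsequence: an `L¹` gradient error of `4 ^ (-k)`, tested at level `2 ^ (-k)` in the
  -- weak type inequality, leaves exceptional sets of measure at most `5 ^ N * 2 ^ (-k)`, which is
  -- summable.
  have hex : ∀ k : ℕ, ∃ m, k ≤ m ∧ ENNReal.ofReal ‖testH10 Ω (φ₀ (σ m)) - u‖ * M ≤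
      ENNReal.ofReal ((1 / 4) ^ k) := fun k => by
    have h3 : ∀ᶠ m in atTop, ENNReal.ofReal ‖testH10 Ω (φ₀ (σ m)) - u‖ * M ≤
        ENNReal.ofReal ((1 / 4) ^ k) :=
      hlim.eventually_le_const (by positivity)
    obtain ⟨m, hm⟩ := (h3.and (eventually_ge_atTop k)).exists
    exact ⟨m, hm.2, hm.1⟩
  choose m hkm hm using hex
  have hmlim : Tendsto m atTop atTop := tendsto_atTop_mono hkm tendsto_id
  set φ : ℕ → 𝓓(Ω, ℝ) := fun k => φ₀ (σ (m k)) with hφ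
  refine ⟨φ, ?_, ?_⟩
  · filter_upwards [hae] with x hx using hx.comp hmlim
  set G : ℕ → Rn N → ℝ≥0∞ := fun k => indicator (Ω : Set (Rn N))
    fun x => ‖∇ (φ k : Rn N → ℝ) x - wgrad u x‖ₑ with hG
  have hGint : ∀ k, ∫⁻ x, G k x ≤ ENNReal.ofReal ((1 / 4) ^ k) := fun k => by
    rw [hG, lintegral_indicator Ω.isOpen.measurableSet]
    exact (lintegral_gradient_sub_le (φ k) u).trans (hm k)
  have hbad : ∀ k, volume (maximalSublevel volume (G k) (ENNReal.ofReal ((1 / 2) ^ k)))ᶜ ≤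
      5 ^ N * ENNReal.ofReal ((1 / 2) ^ k) := fun k => by
    have h1 := mul_measure_compl_maximalSublevel_le (μ := (volume : Measure (Rn N))) (g := G k)
      (L := ENNReal.ofReal ((1 / 2) ^ k)) (by positivity) ENNReal.ofReal_ne_top
      (ne_top_of_le_ne_top ENNReal.ofReal_ne_top (hGint k))
    rw [finrank_euclideanSpace_fin] at h1
    have h2 : ENNReal.ofReal ((1 / 2) ^ k) *
        volume (maximalSublevel volume (G k) (ENNReal.ofReal ((1 / 2) ^ k)))ᶜ ≤
        ENNReal.ofReal ((1 / 2) ^ k) * (5 ^ N * ENNReal.ofReal ((1 / 2) ^ k)) := by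
      refine h1.trans ?_
      rw [mul_left_comm, ← ENNReal.ofReal_mul (by positivity), ← mul_pow]
      gcongr
      refine (hGint k).trans (le_of_eq ?_)
      norm_num
    exact (ENNReal.mul_le_mul_iff_right (by positivity) ENNReal.ofReal_ne_top).1 h2
  have hsum : ∑' k, volume (maximalSublevel volume (G k) (ENNReal.ofReal ((1 / 2) ^ k)))ᶜ ≠ ⊤ := by
    refine ne_top_of_le_ne_top ?_ (ENNReal.tsum_le_tsum hbad)
    rw [ENNReal.tsum_mul_left, ← ENNReal.ofReal_tsum_of_nonneg (fun _ => by positivity)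
      summable_geometric_two]
    exact ENNReal.mul_ne_top (by simp) ENNReal.ofReal_ne_top
  -- By Borel-Cantelli almost every `x` leaves the exceptional sets for good. The null set does not
  -- depend on `L`, so all levels are handled at once.
  filter_upwards [ae_eventually_notMem hsum] with x hx L hxL
  filter_upwards [hx] with k hk
  refine mem_maximalSublevel_add (Eventually.of_forall fun y => ?_)
    (measurable_gradENorm u).aemeasurable hxL (not_not.1 hk)
  by_cases hy : y ∈ (Ω : Set (Rn N))
  · simp only [gradENorm, hG, indicator_of_mem hy]
    rw [← ofReal_norm, ← norm_gradient_eq, ofReal_norm]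
    refine le_trans (le_of_eq ?_) (enorm_add_le _ _)
    rw [add_sub_cancel]
  · rw [← ofReal_norm, ← norm_gradient_eq, gradient_eq_zero_of_notMem hy]
    simp

end Basic

/-! ### Locality of the weak gradient -/

section Locality

variable {N : ℕ} {Ω : TopologicalSpace.Opens (Rn N)}

theorem integral_comp_mul_fderiv_test {G : ℝ → ℝ} (hG : ContDiff ℝ 1 G) (φ η : 𝓓(Ω, ℝ))
    (e : Rn N) :
    ∫ x, G (φ x) * fderiv ℝ (η : Rn N → ℝ) x e ∂(vol Ω) =
      - ∫ x, deriv G (φ x) * inner ℝ (∇ (φ : Rn N → ℝ) x) e * η x ∂(vol Ω) := by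
  have hη1 : ContDiff ℝ 1 (η : Rn N → ℝ) := η.contDiff.of_le (by simp)
  have hφ1 : ContDiff ℝ 1 (φ : Rn N → ℝ) := φ.contDiff.of_le (by simp)
  have hcη : HasCompactSupport fun x => fderiv ℝ (η : Rn N → ℝ) x e :=
    η.hasCompactSupport.fderiv_apply (𝕜 := ℝ) e
  have hderiv : ∀ x, fderiv ℝ (fun x => G (φ x)) x e =
      deriv G (φ x) * inner ℝ (∇ (φ : Rn N → ℝ) x) e := fun x => by
    have h1 : HasDerivAt G (deriv G (φ x)) (φ x) :=
      ((hG.differentiable one_ne_zero) _).hasDerivAt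
    have h2 : HasFDerivAt (φ : Rn N → ℝ) (fderiv ℝ (φ : Rn N → ℝ) x) x :=
      ((hφ1.differentiable one_ne_zero) x).hasFDerivAt
    have h3 : HasFDerivAt (fun x => G (φ x)) _ x := h1.comp_hasFDerivAt x h2
    rw [h3.fderiv, ← fderiv_eq_inner_gradient]
    simp
  have hGφ : ContDiff ℝ 1 fun x => G (φ x) := hG.comp hφ1
  have hc1 : Continuous fun x => fderiv ℝ (fun x => G (φ x)) x e :=
    (hGφ.continuous_fderiv one_ne_zero).clm_apply continuous_const
  have hc2 : Continuous fun x => fderiv ℝ (η : Rn N → ℝ) x e :=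
    (hη1.continuous_fderiv one_ne_zero).clm_apply continuous_const
  have h := integral_mul_fderiv_eq_neg_fderiv_mul_of_integrable (μ := (volume : Measure (Rn N)))
    (f := fun x => G (φ x)) (g := (η : Rn N → ℝ)) (v := e)
    ((hc1.mul η.continuous).integrable_of_hasCompactSupport η.hasCompactSupport.mul_left)
    ((hGφ.continuous.mul hc2).integrable_of_hasCompactSupport hcη.mul_left)
    ((hGφ.continuous.mul η.continuous).integrable_of_hasCompactSupport
      η.hasCompactSupport.mul_left)
    (fun x _ => (hGφ.differentiable one_ne_zero) x)
    (fun x _ => (hη1.differentiable one_ne_zero) x)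
  simp only [hderiv] at h
  rw [setIntegral_eq_integral_of_forall_compl_eq_zero fun x hx => ?_,
    setIntegral_eq_integral_of_forall_compl_eq_zero fun x hx => ?_]
  · exact h
  · rw [test_eq_zero_of_notMem (φ := η) hx, mul_zero]
  · rw [fderiv_eq_inner_gradient, gradient_eq_zero_of_notMem hx, inner_zero_left, mul_zero]

theorem integrable_inner_wgrad (hΩ : Bornology.IsBounded (Ω : Set (Rn N))) (w : H10 Ω)
    (e : Rn N) : Integrable (fun x => inner ℝ (wgrad w x) e) (vol Ω) := by
  have := isFiniteMeasure_vol hΩ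
  exact ((Lp.memLp (wgrad w)).integrable (by norm_num)).inner_const e

/-- The chain rule `∇(G ∘ w) = G'(w) ∇w` in weak form. It passes from test functions to `w`: `G` and
`G'` are bounded, so dominated convergence handles the composed factors, and the gradient error is
small in `L¹`. -/
theorem integral_comp_mul_fderiv_eq (hΩ : Bornology.IsBounded (Ω : Set (Rn N))) {G : ℝ → ℝ}
    (hG : ContDiff ℝ 1 G) {C : ℝ} (hGC : ∀ s, |G s| ≤ C) (hGd : ∀ s, |deriv G s| ≤ C)
    (w : H10 Ω) (η : 𝓓(Ω, ℝ)) (e : Rn N) :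
    ∫ x, G (fn w x) * fderiv ℝ (η : Rn N → ℝ) x e ∂(vol Ω) =
      - ∫ x, deriv G (fn w x) * inner ℝ (wgrad w x) e * η x ∂(vol Ω) := by
  have hfin := isFiniteMeasure_vol hΩ
  obtain ⟨φ₀, hφ₀⟩ := exists_seq_test_tendsto w
  obtain ⟨σ, hσ, hae⟩ := tendsto_ae_subseq_of_tendsto hφ₀
  have hφ₁ := hφ₀.comp hσ.tendsto_atTop
  set φ : ℕ → 𝓓(Ω, ℝ) := fun k => φ₀ (σ k) with hφ
  have hC : 0 ≤ C := (abs_nonneg _).trans (hGC 0)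
  have hGc := hG.continuous
  have hGdc : Continuous (deriv G) := hG.continuous_deriv le_rfl
  obtain ⟨M, hM⟩ := η.continuous.bounded_above_of_compact_support η.hasCompactSupport
  have hM0 : 0 ≤ M := (norm_nonneg _).trans (hM 0)
  have hη1 : ContDiff ℝ 1 (η : Rn N → ℝ) := η.contDiff.of_le (by simp)
  have hηe : Continuous fun x => fderiv ℝ (η : Rn N → ℝ) x e :=
    (hη1.continuous_fderiv one_ne_zero).clm_apply continuous_const
  have hηi : Integrable (fun x => fderiv ℝ (η : Rn N → ℝ) x e) (vol Ω) :=
    (hηe.integrable_of_hasCompactSupport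
      (η.hasCompactSupport.fderiv_apply (𝕜 := ℝ) e)).restrict
  have hwe := integrable_inner_wgrad hΩ w e
  have hfn : AEStronglyMeasurable (fn w) (vol Ω) := Lp.aestronglyMeasurable _
  have hL : Tendsto (fun k => ∫ x, G (φ k x) * fderiv ℝ (η : Rn N → ℝ) x e ∂(vol Ω)) atTop
      (𝓝 (∫ x, G (fn w x) * fderiv ℝ (η : Rn N → ℝ) x e ∂(vol Ω))) := by
    refine tendsto_integral_of_dominated_convergence
      (fun x => C * ‖fderiv ℝ (η : Rn N → ℝ) x e‖) (fun k => ?_) (hηi.norm.const_mul C)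
      (fun k => Eventually.of_forall fun x => ?_) ?_
    · exact ((hGc.comp (φ k).continuous).mul hηe).aestronglyMeasurable
    · rw [norm_mul]; gcongr; exact hGC _
    · filter_upwards [hae] with x hx
      exact ((hGc.tendsto _).comp hx).mul_const _
  have hR1 : Tendsto (fun k => ∫ x, deriv G (φ k x) * inner ℝ (wgrad w x) e * η x ∂(vol Ω)) atTop
      (𝓝 (∫ x, deriv G (fn w x) * inner ℝ (wgrad w x) e * η x ∂(vol Ω))) := by
    refine tendsto_integral_of_dominated_convergence
      (fun x => C * ‖(inner ℝ (wgrad w x) e : ℝ)‖ * M) (fun k => ?_)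
      ((hwe.norm.const_mul C).mul_const M) (fun k => Eventually.of_forall fun x => ?_) ?_
    · exact (((hGdc.comp (φ k).continuous).aestronglyMeasurable).mul hwe.1).mul
        η.continuous.aestronglyMeasurable
    · rw [norm_mul, norm_mul]; gcongr
      · exact hGd _
      · exact hM x
    · filter_upwards [hae] with x hx
      exact (((hGdc.tendsto _).comp hx).mul_const _).mul_const _
  have hR2 : Tendsto (fun k => ∫ x, deriv G (φ k x) *
      inner ℝ (∇ (φ k : Rn N → ℝ) x - wgrad w x) e * η x ∂(vol Ω)) atTop (𝓝 0) := by
    rw [tendsto_zero_iff_enorm_tendsto_zero]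
    have hlim : Tendsto (fun k => ENNReal.ofReal (C * ‖e‖ * M) * (ENNReal.ofReal
        ‖testH10 Ω (φ k) - w‖ * (vol Ω) univ ^ (1 / 2 : ℝ))) atTop (𝓝 0) := by
      have h1 : Tendsto (fun k => ‖testH10 Ω (φ k) - w‖) atTop (𝓝 0) :=
        tendsto_iff_norm_sub_tendsto_zero.1 hφ₁
      have h2 := ENNReal.Tendsto.const_mul (a := ENNReal.ofReal (C * ‖e‖ * M))
        (ENNReal.Tendsto.mul_const (b := (vol Ω) univ ^ (1 / 2 : ℝ)) (ENNReal.tendsto_ofReal h1)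
        (Or.inr (ENNReal.rpow_ne_top_of_nonneg (by norm_num) (measure_ne_top _ _))))
        (Or.inr ENNReal.ofReal_ne_top)
      simpa using h2
    refine tendsto_of_tendsto_of_tendsto_of_le_of_le tendsto_const_nhds hlim
      (fun _ => zero_le) fun k => ?_
    refine (enorm_integral_le_lintegral_enorm _).trans ?_
    refine le_trans ?_ (mul_le_mul_right (lintegral_gradient_sub_le (φ k) w) _)
    rw [← lintegral_const_mul' _ _ ENNReal.ofReal_ne_top]
    refine lintegral_mono fun x => ?_
    rw [← ofReal_norm, ← ofReal_norm, ← ENNReal.ofReal_mul (by positivity)]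
    refine ENNReal.ofReal_le_ofReal ?_
    rw [norm_mul, norm_mul]
    calc ‖deriv G (φ k x)‖ * ‖(inner ℝ (∇ (φ k : Rn N → ℝ) x - wgrad w x) e : ℝ)‖ * ‖η x‖
        ≤ C * (‖∇ (φ k : Rn N → ℝ) x - wgrad w x‖ * ‖e‖) * M := by
          gcongr
          · exact hGd _
          · exact abs_real_inner_le_norm _ _
          · exact hM x
      _ = _ := by ring
  have hint1 : ∀ k, Integrable (fun x => deriv G (φ k x) * inner ℝ (wgrad w x) e * η x) (vol Ω) :=
    fun k => by
      refine Integrable.mul_bdd (c := M) ?_ η.continuous.aestronglyMeasurable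
        (Eventually.of_forall hM)
      exact Integrable.bdd_mul (c := C) hwe (hGdc.comp (φ k).continuous).aestronglyMeasurable
        (Eventually.of_forall fun x => hGd _)
  have hint2 : ∀ k, Integrable (fun x => deriv G (φ k x) *
      inner ℝ (∇ (φ k : Rn N → ℝ) x - wgrad w x) e * η x) (vol Ω) := fun k => by
    refine Integrable.mul_bdd (c := M) ?_ η.continuous.aestronglyMeasurable
      (Eventually.of_forall hM)
    refine Integrable.bdd_mul (c := C) ?_ (hGdc.comp (φ k).continuous).aestronglyMeasurable
      (Eventually.of_forall fun x => hGd _)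
    have h1 : Integrable (fun x => (inner ℝ (∇ (φ k : Rn N → ℝ) x) e : ℝ)) (vol Ω) :=
      ((memLp_gradient_test Ω (φ k)).integrable (by norm_num)).inner_const e
    simp only [inner_sub_left]
    exact h1.sub hwe
  refine tendsto_nhds_unique hL ?_
  have hsum := (hR1.add hR2).neg
  rw [add_zero] at hsum
  refine hsum.congr fun k => ?_
  rw [integral_comp_mul_fderiv_test hG, ← integral_add (hint1 k) (hint2 k)]
  congr 2
  ext x
  rw [inner_sub_left]
  ring

/-- As `δ → 0` these functions tend to zero uniformly, while their derivatives `1 / (1 + (s / δ)²)`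
tend boundedly to the indicator of `{0}`. This is what isolates the set where a function vanishes.
-/
theorem contDiff_scaled_arctan (δ : ℝ) : ContDiff ℝ 1 fun s : ℝ => δ * Real.arctan (s / δ) :=
  contDiff_const.mul (Real.contDiff_arctan.comp (contDiff_id.div_const δ))

theorem deriv_scaled_arctan {δ : ℝ} (hδ : 0 < δ) (s : ℝ) :
    deriv (fun s : ℝ => δ * Real.arctan (s / δ)) s = 1 / (1 + (s / δ) ^ 2) := by
  have h := (((hasDerivAt_id s).div_const δ).arctan).const_mul δ
  have h2 := h.deriv
  simp only [id] at h2
  rw [h2]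
  field_simp

/-- The weak gradient of `w` vanishes almost everywhere on the set where `w` vanishes. -/
theorem wgrad_ae_eq_zero (hΩ : Bornology.IsBounded (Ω : Set (Rn N))) (w : H10 Ω) :
    ∀ᵐ x ∂(vol Ω), fn w x = 0 → wgrad w x = 0 := by
  have hfin := isFiniteMeasure_vol hΩ
  have key : ∀ (η : 𝓓(Ω, ℝ)) (e : Rn N),
      ∫ x, η x * (if fn w x = 0 then (inner ℝ (wgrad w x) e : ℝ) else 0) ∂(vol Ω) = 0 := by
    intro η e
    obtain ⟨M, hM⟩ := η.continuous.bounded_above_of_compact_support η.hasCompactSupport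
    have hη1 : ContDiff ℝ 1 (η : Rn N → ℝ) := η.contDiff.of_le (by simp)
    have hηe : Continuous fun x => fderiv ℝ (η : Rn N → ℝ) x e :=
      (hη1.continuous_fderiv one_ne_zero).clm_apply continuous_const
    have hηi : Integrable (fun x => fderiv ℝ (η : Rn N → ℝ) x e) (vol Ω) :=
      (hηe.integrable_of_hasCompactSupport
        (η.hasCompactSupport.fderiv_apply (𝕜 := ℝ) e)).restrict
    have hwe := integrable_inner_wgrad hΩ w e
    have hfn : AEStronglyMeasurable (fn w) (vol Ω) := Lp.aestronglyMeasurable _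
    set δ : ℕ → ℝ := fun m => 1 / ((m : ℝ) + 1) with hδ
    have hδ0 : ∀ m, 0 < δ m := fun m => by positivity
    have hδ1 : ∀ m, δ m ≤ 1 := fun m => by
      rw [hδ, div_le_one (by positivity)]; linarith [(Nat.cast_nonneg m : (0:ℝ) ≤ m)]
    have hδlim : Tendsto δ atTop (𝓝 0) := tendsto_one_div_add_atTop_nhds_zero_nat
    have hat : ∀ m s, |δ m * Real.arctan (s / δ m)| ≤ δ m * 2 := fun m s => by
      rw [abs_mul, abs_of_pos (hδ0 m)]
      refine mul_le_mul_of_nonneg_left ?_ (hδ0 m).le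
      rw [abs_le]
      constructor <;> linarith [Real.neg_pi_div_two_lt_arctan (s / δ m),
          Real.arctan_lt_pi_div_two (s / δ m), Real.pi_lt_four]
    have hid : ∀ m, ∫ x, δ m * Real.arctan (fn w x / δ m) * fderiv ℝ (η : Rn N → ℝ) x e ∂(vol Ω) =
        - ∫ x, 1 / (1 + (fn w x / δ m) ^ 2) * inner ℝ (wgrad w x) e * η x ∂(vol Ω) := fun m => by
      have := integral_comp_mul_fderiv_eq hΩ (contDiff_scaled_arctan (δ m)) (C := 2)
        (fun s => (hat m s).trans (by linarith [hδ1 m])) (fun s => ?_) w η e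
      · simpa only [deriv_scaled_arctan (hδ0 m)] using this
      · rw [deriv_scaled_arctan (hδ0 m), abs_of_nonneg (by positivity), div_le_iff₀ (by positivity)]
        nlinarith [sq_nonneg (s / δ m)]
    have hL : Tendsto (fun m => ∫ x, δ m * Real.arctan (fn w x / δ m) *
        fderiv ℝ (η : Rn N → ℝ) x e ∂(vol Ω)) atTop (𝓝 (∫ _, (0 : ℝ) ∂(vol Ω))) := by
      refine tendsto_integral_of_dominated_convergence
        (fun x => 2 * ‖fderiv ℝ (η : Rn N → ℝ) x e‖) (fun m => ?_) (hηi.norm.const_mul 2)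
        (fun m => Eventually.of_forall fun x => ?_) (Eventually.of_forall fun x => ?_)
      · exact ((contDiff_scaled_arctan (δ m)).continuous.comp_aestronglyMeasurable hfn).mul
          hηe.aestronglyMeasurable
      · rw [norm_mul]; gcongr
        exact (hat m _).trans (by linarith [hδ1 m])
      · have h0 : Tendsto (fun m => δ m * 2) atTop (𝓝 0) := by simpa using hδlim.mul_const 2
        have := squeeze_zero_norm (f := fun m => δ m * Real.arctan (fn w x / δ m))
          (fun m => hat m (fn w x)) h0
        simpa using this.mul_const (fderiv ℝ (η : Rn N → ℝ) x e)
    have hR : Tendsto (fun m => ∫ x, 1 / (1 + (fn w x / δ m) ^ 2) * inner ℝ (wgrad w x) e *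
        η x ∂(vol Ω)) atTop (𝓝 (∫ x, η x * (if fn w x = 0 then (inner ℝ (wgrad w x) e : ℝ) else 0)
          ∂(vol Ω))) := by
      refine tendsto_integral_of_dominated_convergence
        (fun x => 1 * ‖(inner ℝ (wgrad w x) e : ℝ)‖ * M) (fun m => ?_)
        ((hwe.norm.const_mul 1).mul_const M)
        (fun m => Eventually.of_forall fun x => ?_) (Eventually.of_forall fun x => ?_)
      · refine (AEStronglyMeasurable.mul ?_ hwe.1).mul η.continuous.aestronglyMeasurable
        have hc : Continuous fun s : ℝ => 1 / (1 + (s / δ m) ^ 2) := by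
          refine continuous_const.div (by fun_prop) fun s => by positivity
        exact hc.comp_aestronglyMeasurable hfn
      · rw [norm_mul, norm_mul]; gcongr
        · rw [Real.norm_of_nonneg (by positivity), div_le_one (by positivity)]
          nlinarith [sq_nonneg (fn w x / δ m)]
        · exact hM x
      · by_cases h0 : fn w x = 0
        · simp [h0, mul_comm]
        · simp only [h0, if_false, mul_zero]
          have h1 : Tendsto (fun m => 1 / (1 + (fn w x / δ m) ^ 2)) atTop (𝓝 0) := by
            have h2 : Tendsto (fun m : ℕ => (fn w x) ^ 2 * ((m : ℝ) + 1)) atTop atTop :=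
              (tendsto_atTop_add_const_right _ _ tendsto_natCast_atTop_atTop).const_mul_atTop
                (by positivity)
            refine squeeze_zero (fun m => by positivity) (fun m => ?_) h2.inv_tendsto_atTop
            rw [Pi.inv_apply, ← one_div]
            have hm : (1 : ℝ) ≤ (m : ℝ) + 1 := by linarith [(Nat.cast_nonneg m : (0:ℝ) ≤ m)]
            have h3 : (fn w x / δ m) ^ 2 = (fn w x) ^ 2 * ((m : ℝ) + 1) ^ 2 := by
              rw [hδ]; field_simp
            rw [h3]
            have h4 : 0 < (fn w x) ^ 2 := by positivity
            apply one_div_le_one_div_of_le (by positivity)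
            nlinarith [mul_nonneg h4.le (by nlinarith : (0:ℝ) ≤ ((m : ℝ) + 1) ^ 2 - ((m : ℝ) + 1))]
          simpa using (h1.mul_const (inner ℝ (wgrad w x) e : ℝ)).mul_const (η x)
    -- In the chain rule for `δ arctan(w / δ)`, one side vanishes in the limit and the other becomes
    -- the integral of `η (∇w, e)` over `{w = 0}`.
    have h1 := tendsto_nhds_unique (hL.congr hid) hR.neg
    simpa using h1.symm
  have hcoord : ∀ i : Fin N, ∀ᵐ x ∂(vol Ω), fn w x = 0 → wgrad w x i = 0 := by
    intro i
    set e : Rn N := EuclideanSpace.single i 1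
    have hint : Integrable (fun x => if fn w x = 0 then (inner ℝ (wgrad w x) e : ℝ) else 0)
        (vol Ω) := by
      have hms : MeasurableSet {x | fn w x = 0} :=
        (Lp.stronglyMeasurable (fn w)).measurable (measurableSet_singleton 0)
      refine ((integrable_inner_wgrad hΩ w e).indicator hms).congr
        (Eventually.of_forall fun x => ?_)
      simp [indicator]
    have h := Ω.isOpen.ae_eq_zero_of_integral_contDiff_smul_eq_zero
      (μ := (volume : Measure (Rn N)))
      (f := fun x => if fn w x = 0 then (inner ℝ (wgrad w x) e : ℝ) else 0)
      (IntegrableOn.locallyIntegrableOn hint) (fun g hg hgc hgs => ?_)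
    · rw [ae_restrict_iff' Ω.isOpen.measurableSet]
      filter_upwards [h] with x hx hxΩ h0
      have := hx hxΩ
      rw [if_pos h0] at this
      simpa [e, EuclideanSpace.inner_single_right] using this
    · have h2 := key ⟨g, hg, hgc, hgs⟩ e
      rw [setIntegral_eq_integral_of_forall_compl_eq_zero fun x hx => ?_] at h2
      · exact h2
      · rw [test_eq_zero_of_notMem hx, zero_mul]
  filter_upwards [ae_all_iff.2 hcoord] with x hx h0
  ext i
  exact hx i h0

theorem wgrad_ae_eq_of_fn_eq (hΩ : Bornology.IsBounded (Ω : Set (Rn N))) (u v : H10 Ω) :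
    ∀ᵐ x ∂(vol Ω), fn u x = fn v x → wgrad u x = wgrad v x := by
  have h := wgrad_ae_eq_zero hΩ (u - v)
  rw [fn_sub, wgrad_sub] at h
  filter_upwards [h, Lp.coeFn_sub (fn u) (fn v), Lp.coeFn_sub (wgrad u) (wgrad v)] with x h1 h2 h3 h4
  rw [h2, h3, Pi.sub_apply, Pi.sub_apply] at h1
  exact sub_eq_zero.1 (h1 (sub_eq_zero.2 h4))

theorem fn_injective (hΩ : Bornology.IsBounded (Ω : Set (Rn N))) {u v : H10 Ω}
    (h : fn u = fn v) : u = v := by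
  refine eq_of_fn_eq_of_wgrad_eq h (Lp.ext ?_)
  filter_upwards [wgrad_ae_eq_of_fn_eq hΩ u v] with x hx using hx (by rw [h])

end Locality

/-! ### Lipschitz functions which vanish outside `Ω` -/

section Weak

variable {H : Type*} [NormedAddCommGroup H] [InnerProductSpace ℝ H] [CompleteSpace H]

/-- Banach-Alaoglu in the dual, carried back by the Riesz isomorphism. Convergence along an
ultrafilter replaces the extraction of a subsequence; only the passage of identities and
inequalities to the limit is needed. -/
theorem exists_ultrafilter_weak_limit {x : ℕ → H} {C : ℝ} (hx : ∀ n, ‖x n‖ ≤ C) :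
    ∃ (U : Ultrafilter ℕ) (V : H), (U : Filter ℕ) ≤ atTop ∧
      ∀ l : StrongDual ℝ H, Tendsto (fun n => l (x n)) U (𝓝 (l V)) := by
  set U : Ultrafilter ℕ := Ultrafilter.of atTop
  set F : ℕ → WeakDual ℝ H := fun n =>
    StrongDual.toWeakDual (InnerProductSpace.toDual ℝ H (x n)) with hF
  have hcomp := WeakDual.isCompact_closedBall (𝕜 := ℝ) (E := H) 0 C
  have hmem : WeakDual.toStrongDual ⁻¹' Metric.closedBall (0 : StrongDual ℝ H) C ∈ U.map F := by
    refine Filter.mem_map.2 (univ_mem' fun n => ?_)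
    simp only [mem_preimage, hF, mem_closedBall_zero_iff]
    exact ((InnerProductSpace.toDual ℝ H).norm_map _).trans_le (hx n)
  obtain ⟨W, -, hW⟩ := hcomp.ultrafilter_le_nhds' _ hmem
  set V := (InnerProductSpace.toDual ℝ H).symm (WeakDual.toStrongDual W) with hV
  refine ⟨U, V, Ultrafilter.of_le _, fun l => ?_⟩
  set z := (InnerProductSpace.toDual ℝ H).symm l with hz
  have hl : ∀ v, l v = inner ℝ z v := fun v => by
    rw [hz, InnerProductSpace.toDual_symm_apply]
  have h1 : Tendsto (fun n => F n z) U (𝓝 (W z)) :=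
    ((WeakDual.eval_continuous z).tendsto W).comp hW
  have h2 : l V = W z := by
    rw [hl, real_inner_comm, hV, InnerProductSpace.toDual_symm_apply]
    rfl
  rw [h2]
  refine h1.congr fun n => ?_
  rw [hl, real_inner_comm]
  exact InnerProductSpace.toDual_apply_apply

end Weak

section LipschitzFunctions

variable {N : ℕ} {Ω : TopologicalSpace.Opens (Rn N)}

/-- The functional `z ↦ ∫_Ω (e, ∇z) dx` for a square integrable field `e`. -/
def gradFunctional {e : Rn N → Rn N} (he : MemLp e 2 (vol Ω)) : StrongDual ℝ (H10 Ω) :=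
  (innerSL ℝ (he.toLp e)).comp (wgradL Ω)

theorem gradFunctional_apply {e : Rn N → Rn N} (he : MemLp e 2 (vol Ω)) (z : H10 Ω) :
    gradFunctional he z = ∫ x, inner ℝ (e x) (wgrad z x) ∂(vol Ω) := by
  have h : gradFunctional he z = inner ℝ (he.toLp e) (wgrad z) := rfl
  rw [h, L2.inner_def]
  refine integral_congr_ae ?_
  filter_upwards [he.coeFn_toLp] with x hx
  rw [hx]

theorem integrable_inner_wgrad_of_memLp {e : Rn N → Rn N} (he : MemLp e 2 (vol Ω)) (z : H10 Ω) :
    Integrable (fun x => inner ℝ (e x) (wgrad z x)) (vol Ω) := by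
  refine (L2.integrable_inner (𝕜 := ℝ) (he.toLp e) (wgrad z)).congr ?_
  filter_upwards [he.coeFn_toLp] with x hx
  rw [hx]

/-- Identities of the form `l φ = ∫_Ω (h, ∇φ) dx`, with `h` integrable and `l` bounded on
`H¹₀(Ω)`, that hold for test functions also hold for `V`. -/
def IsTestable (V : H10 Ω) : Prop :=
  ∀ h : Rn N → Rn N, Integrable h (vol Ω) → ∀ l : StrongDual ℝ (H10 Ω),
    (∀ φ : 𝓓(Ω, ℝ), l (testH10 Ω φ) = ∫ x, inner ℝ (h x) (∇ (φ : Rn N → ℝ) x) ∂(vol Ω)) →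
    l V = ∫ x, inner ℝ (h x) (wgrad V x) ∂(vol Ω)

theorem lipschitzWith_convolution {v : Rn N → ℝ} {K : ℝ≥0} (hv : LipschitzWith K v)
    (b : ContDiffBump (0 : Rn N)) :
    LipschitzWith K (convolution (b.normed volume) v (ContinuousLinearMap.lsmul ℝ ℝ) volume) := by
  refine LipschitzWith.of_dist_le_mul fun x y => ?_
  have hint : ∀ x, Integrable (fun t => b.normed volume t • v (x - t)) volume := fun x =>
    (b.continuous_normed.smul (hv.continuous.comp (by fun_prop))).integrable_of_hasCompactSupport
      (b.hasCompactSupport_normed.smul_right)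
  rw [dist_eq_norm]
  simp only [convolution, ContinuousLinearMap.lsmul_apply]
  rw [← integral_sub (hint x) (hint y)]
  calc ‖∫ t, (b.normed volume t • v (x - t) - b.normed volume t • v (y - t))‖
      ≤ ∫ t, b.normed volume t * (K * dist x y) := by
        refine norm_integral_le_of_norm_le (b.integrable_normed.mul_const _)
          (Eventually.of_forall fun t => ?_)
        rw [← smul_sub, norm_smul, Real.norm_of_nonneg (b.nonneg_normed t), ← dist_eq_norm]
        refine mul_le_mul_of_nonneg_left ?_ (b.nonneg_normed t)
        simpa using hv.dist_le_mul (x - t) (y - t)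
    _ = K * dist x y := by rw [integral_mul_const, b.integral_normed, one_mul]

/-- Soft thresholding by `δ` moves the support of `v` into the compact set `{|v| ≥ δ}` inside `Ω`
without raising the Lipschitz constant. Mollification is an averaging, so it does not raise it
either. -/
theorem exists_test_lipschitz_near (hΩ : Bornology.IsBounded (Ω : Set (Rn N))) {v : Rn N → ℝ}
    {K : ℝ≥0} (hv : LipschitzWith K v) (hv0 : ∀ x ∉ Ω, v x = 0) {ε : ℝ} (hε : 0 < ε) :
    ∃ φ : 𝓓(Ω, ℝ), LipschitzWith K φ ∧ ∀ x, |φ x - v x| ≤ ε := by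
  set δ := ε / 2 with hδ
  have hδ0 : 0 < δ := by positivity
  set w : Rn N → ℝ := fun x => max (v x - δ) (min (v x + δ) 0) with hw
  have hwl : LipschitzWith K w := by
    have h1 : LipschitzWith K fun x => v x - δ := by
      simpa using hv.sub (LipschitzWith.const δ)
    have h2 : LipschitzWith K fun x => v x + δ := by
      simpa using hv.add (LipschitzWith.const δ)
    simpa using h1.max (h2.min_const 0)
  have hwv : ∀ x, |w x - v x| ≤ δ := fun x => by
    simp only [hw, abs_le]
    constructor
    · linarith [le_max_left (v x - δ) (min (v x + δ) 0)]
    · have : max (v x - δ) (min (v x + δ) 0) ≤ v x + δ :=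
        max_le (by linarith) (min_le_left _ _)
      linarith
  set S : Set (Rn N) := {x | δ ≤ |v x|} with hS
  have hwS : Function.support w ⊆ S := fun x hx => by
    by_contra hlt
    simp only [hS, mem_ofPred_eq, not_le, abs_lt] at hlt
    refine hx ?_
    simp only [hw]
    rw [min_eq_right (by linarith), max_eq_right (by linarith)]
  have hSΩ : S ⊆ Ω := fun x hx => by
    by_contra hxΩ
    simp only [hS, mem_ofPred_eq, hv0 x hxΩ, abs_zero] at hx
    linarith
  have hSc : IsCompact S := Metric.isCompact_of_isClosed_isBounded
    (isClosed_le continuous_const hv.continuous.abs) (hΩ.subset hSΩ)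
  obtain ⟨r, hr, hrΩ⟩ := hSc.exists_cthickening_subset_open Ω.isOpen hSΩ
  -- The first bound keeps the mollified support inside `Ω`, the second keeps the mollification
  -- error `K ρ` below `δ`.
  set ρ := min r (δ / (K + 1)) with hρ
  have hK : (0 : ℝ) ≤ K := K.2
  have hρ0 : 0 < ρ := lt_min hr (by positivity)
  set b : ContDiffBump (0 : Rn N) := ⟨ρ / 2, ρ, by positivity, by linarith⟩ with hb
  set φ : Rn N → ℝ := convolution (b.normed volume) w (ContinuousLinearMap.lsmul ℝ ℝ) volume
    with hφ
  have hts : tsupport φ ⊆ Metric.cthickening r S := by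
    refine closure_minimal ?_ Metric.isClosed_cthickening
    refine (support_convolution_subset _).trans ?_
    rintro _ ⟨x, hx, y, hy, rfl⟩
    rw [b.support_normed_eq, mem_ball_zero_iff] at hx
    refine Metric.mem_cthickening_of_dist_le _ y r S (hwS hy) ?_
    rw [dist_eq_norm, add_sub_cancel_right]
    exact hx.le.trans (min_le_left _ _)
  have hdiff : ContDiff ℝ (⊤ : ℕ∞) φ := by
    exact b.hasCompactSupport_normed.contDiff_convolution_left _ b.contDiff_normed
      (hwl.continuous.locallyIntegrable)
  refine ⟨⟨φ, hdiff, ?_, hts.trans hrΩ⟩, lipschitzWith_convolution hwl b, fun x => ?_⟩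
  · exact HasCompactSupport.of_support_subset_isCompact (hSc.cthickening (r := r))
      ((subset_tsupport _).trans hts)
  · have h1 : dist (φ x) (w x) ≤ δ := by
      refine ContDiffBump.dist_normed_convolution_le hwl.continuous.aestronglyMeasurable
        fun y hy => ?_
      have h2 : dist y x ≤ δ / (K + 1) := (Metric.mem_ball.1 hy).le.trans (min_le_right _ _)
      calc dist (w y) (w x) ≤ K * dist y x := hwl.dist_le_mul _ _
        _ ≤ (K + 1) * (δ / (K + 1)) := by gcongr; linarith
        _ = δ := by field_simp
    rw [Real.dist_eq] at h1
    calc |φ x - v x| ≤ |φ x - w x| + |w x - v x| := abs_sub_le _ _ _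
      _ ≤ δ + δ := add_le_add h1 (hwv x)
      _ = ε := by rw [hδ]; ring

/-- A pointwise gradient bound survives weak limits. With `e = ∇V / |∇V|` on `S = {|∇V| > K}` and
zero elsewhere, the limit of `∫ (e, ∇φ_n) ≤ K |S|` reads `∫_S |∇V| ≤ K |S|`, so `S` is null. -/
theorem norm_wgrad_ae_le_of_weak_limit (hΩ : Bornology.IsBounded (Ω : Set (Rn N))) {U : Filter ℕ}
    [U.NeBot] {φ : ℕ → 𝓓(Ω, ℝ)} {V : H10 Ω} {K : ℝ} (hK : 0 ≤ K)
    (hφ : ∀ n x, ‖∇ (φ n : Rn N → ℝ) x‖ ≤ K)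
    (hV : ∀ l : StrongDual ℝ (H10 Ω), Tendsto (fun n => l (testH10 Ω (φ n))) U (𝓝 (l V))) :
    ∀ᵐ x ∂(vol Ω), ‖wgrad V x‖ ≤ K := by
  have hfin := isFiniteMeasure_vol hΩ
  have hm : Measurable (wgrad V) := (Lp.stronglyMeasurable (wgrad V)).measurable
  set S : Set (Rn N) := {x | K < ‖wgrad V x‖} with hS
  have hSm : MeasurableSet S := measurableSet_lt measurable_const hm.norm
  set e : Rn N → Rn N := indicator S fun x => ‖wgrad V x‖⁻¹ • wgrad V x with he
  have hem : Measurable e := (hm.norm.inv.smul hm).indicator hSm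
  have he1 : ∀ x, ‖e x‖ ≤ indicator S (fun _ => (1 : ℝ)) x := fun x => by
    by_cases hx : x ∈ S
    · simp only [he, indicator_of_mem hx, norm_smul, norm_inv, norm_norm]
      exact inv_mul_le_one
    · simp [he, hx]
  have heL : MemLp e 2 (vol Ω) := MemLp.of_bound hem.aestronglyMeasurable 1
    (Eventually.of_forall fun x => (he1 x).trans (indicator_le_self' (fun _ _ => zero_le_one) x))
  have hle : gradFunctional heL V ≤ ∫ x, indicator S (fun _ => K) x ∂(vol Ω) := by
    refine le_of_tendsto (hV (gradFunctional heL)) (Eventually.of_forall fun n => ?_)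
    rw [gradFunctional_apply]
    refine integral_mono_ae (integrable_inner_wgrad_of_memLp heL _)
      ((integrable_const K).indicator hSm) ?_
    filter_upwards [wgrad_test_ae (φ n)] with x hx
    rw [hx]
    refine (real_inner_le_norm _ _).trans ?_
    calc ‖e x‖ * ‖∇ (φ n : Rn N → ℝ) x‖ ≤ indicator S (fun _ => (1 : ℝ)) x * K :=
          mul_le_mul (he1 x) (hφ n x) (norm_nonneg _) ((norm_nonneg _).trans (he1 x))
      _ = indicator S (fun _ => K) x := by
          by_cases hx : x ∈ S <;> simp [hx]
  rw [gradFunctional_apply] at hle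
  have hzero : ∫ x, (inner ℝ (e x) (wgrad V x) - indicator S (fun _ => K) x) ∂(vol Ω) = 0 := by
    refine le_antisymm ?_ (integral_nonneg fun x => ?_)
    · rw [integral_sub (integrable_inner_wgrad_of_memLp heL _)
        ((integrable_const K).indicator hSm)]
      linarith
    · by_cases hx : x ∈ S
      · have hpos : 0 < ‖wgrad V x‖ := hK.trans_lt hx
        simp only [he, indicator_of_mem hx, Pi.zero_apply, real_inner_smul_left,
          real_inner_self_eq_norm_sq]
        have : ‖wgrad V x‖⁻¹ * ‖wgrad V x‖ ^ 2 = ‖wgrad V x‖ := by field_simp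
        rw [this]
        exact sub_nonneg.2 hx.le
      · simp [he, hx]
  rw [integral_eq_zero_iff_of_nonneg] at hzero
  · filter_upwards [hzero] with x hx
    by_contra hlt
    have hxS : x ∈ S := not_le.1 hlt
    have hpos : 0 < ‖wgrad V x‖ := hK.trans_lt hxS
    simp only [he, indicator_of_mem hxS, Pi.zero_apply, real_inner_smul_left,
      real_inner_self_eq_norm_sq] at hx
    have : ‖wgrad V x‖⁻¹ * ‖wgrad V x‖ ^ 2 = ‖wgrad V x‖ := by field_simp
    rw [this] at hx
    exact hlt (sub_eq_zero.1 hx).le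
  · intro x
    by_cases hx : x ∈ S
    · have hpos : 0 < ‖wgrad V x‖ := hK.trans_lt hx
      simp only [he, indicator_of_mem hx, Pi.zero_apply, real_inner_smul_left,
        real_inner_self_eq_norm_sq]
      have : ‖wgrad V x‖⁻¹ * ‖wgrad V x‖ ^ 2 = ‖wgrad V x‖ := by field_simp
      rw [this]
      exact sub_nonneg.2 hx.le
    · simp [he, hx]
  · exact (integrable_inner_wgrad_of_memLp heL _).sub ((integrable_const K).indicator hSm)

/-- The bounded fields `(1 + ε ‖h‖)⁻¹ h` approximate the integrable field `h`. -/
theorem tendsto_integral_norm_sub_damped {h : Rn N → Rn N} (hh : Integrable h (vol Ω)) :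
    Tendsto (fun m : ℕ => ∫ x, ‖h x - (1 + (1 / ((m : ℝ) + 1)) * ‖h x‖)⁻¹ • h x‖ ∂(vol Ω)) atTop
      (𝓝 0) := by
  have h0 : ∫ _, (0 : ℝ) ∂(vol Ω) = 0 := by simp
  rw [← h0]
  refine tendsto_integral_of_dominated_convergence (fun x => 2 * ‖h x‖) (fun m => ?_)
    (hh.norm.const_mul 2) (fun m => Eventually.of_forall fun x => ?_)
    (Eventually.of_forall fun x => ?_)
  · have hc : Continuous fun z : Rn N => ‖z - (1 + (1 / ((m : ℝ) + 1)) * ‖z‖)⁻¹ • z‖ := by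
      have : ∀ z : Rn N, (1 + (1 / ((m : ℝ) + 1)) * ‖z‖) ≠ 0 := fun z => by positivity
      fun_prop (disch := assumption)
    exact hc.comp_aestronglyMeasurable hh.1
  · rw [norm_norm]
    refine (norm_sub_le _ _).trans ?_
    rw [norm_smul, two_mul]
    gcongr
    refine mul_le_of_le_one_left (norm_nonneg _) ?_
    rw [Real.norm_of_nonneg (by positivity)]
    refine inv_le_one_of_one_le₀ ?_
    have : 0 ≤ (1 / ((m : ℝ) + 1)) * ‖h x‖ := by positivity
    linarith
  · have h1 : Tendsto (fun m : ℕ => (1 + (1 / ((m : ℝ) + 1)) * ‖h x‖)⁻¹) atTop (𝓝 1) := by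
      have h2 : Tendsto (fun m : ℕ => 1 + (1 / ((m : ℝ) + 1)) * ‖h x‖) atTop (𝓝 (1 + 0 * ‖h x‖)) :=
        (tendsto_one_div_add_atTop_nhds_zero_nat.mul_const _).const_add 1
      simpa using h2.inv₀ (by simp)
    have h3 := ((h1.smul_const (h x)).const_sub (h x)).norm
    simpa using h3

/-- Weak convergence of gradients pairs with square integrable fields, while `h` is only integrable.
Replacing `h` by a bounded damped field `h'` costs at most `K ‖h - h'‖₁`, uniformly along the
sequence and in the limit, because all gradients are bounded by `K`. -/
theorem isTestable_of_weak_limit (hΩ : Bornology.IsBounded (Ω : Set (Rn N))) {U : Filter ℕ}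
    [U.NeBot] {φ : ℕ → 𝓓(Ω, ℝ)} {V : H10 Ω} {K : ℝ} (hK : 0 ≤ K)
    (hφ : ∀ n x, ‖∇ (φ n : Rn N → ℝ) x‖ ≤ K)
    (hV : ∀ l : StrongDual ℝ (H10 Ω), Tendsto (fun n => l (testH10 Ω (φ n))) U (𝓝 (l V))) :
    IsTestable V := by
  have hfin := isFiniteMeasure_vol hΩ
  have hVK := norm_wgrad_ae_le_of_weak_limit hΩ hK hφ hV
  intro h hh l hl
  have key : ∀ m : ℕ, |l V - ∫ x, inner ℝ (h x) (wgrad V x) ∂(vol Ω)| ≤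
      2 * (K * ∫ x, ‖h x - (1 + (1 / ((m : ℝ) + 1)) * ‖h x‖)⁻¹ • h x‖ ∂(vol Ω)) := by
    intro m
    set h' : Rn N → Rn N := fun x => (1 + (1 / ((m : ℝ) + 1)) * ‖h x‖)⁻¹ • h x with hh'
    have hc : Continuous fun z : Rn N => (1 + (1 / ((m : ℝ) + 1)) * ‖z‖)⁻¹ • z := by
      have : ∀ z : Rn N, (1 + (1 / ((m : ℝ) + 1)) * ‖z‖) ≠ 0 := fun z => by positivity
      fun_prop (disch := assumption)
    have hh'L : MemLp h' 2 (vol Ω) := by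
      refine MemLp.of_bound (hc.comp_aestronglyMeasurable hh.1) ((m : ℝ) + 1)
        (Eventually.of_forall fun x => ?_)
      rw [hh', norm_smul, Real.norm_of_nonneg (by positivity), inv_mul_le_iff₀ (by positivity)]
      have : (1 + 1 / ((m : ℝ) + 1) * ‖h x‖) * ((m : ℝ) + 1) = m + 1 + ‖h x‖ := by field_simp
      rw [this]
      linarith [(Nat.cast_nonneg m : (0 : ℝ) ≤ m)]
    have hh'i : Integrable h' (vol Ω) := hh'L.integrable (by norm_num)
    have hbound : ∀ F : Rn N → Rn N, AEStronglyMeasurable F (vol Ω) →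
        (∀ᵐ x ∂(vol Ω), ‖F x‖ ≤ K) →
        |∫ x, inner ℝ (h x) (F x) ∂(vol Ω) - ∫ x, inner ℝ (h' x) (F x) ∂(vol Ω)| ≤
          K * ∫ x, ‖h x - h' x‖ ∂(vol Ω) := by
      intro F hFm hF
      have hint : ∀ k : Rn N → Rn N, Integrable k (vol Ω) →
          Integrable (fun x => (inner ℝ (k x) (F x) : ℝ)) (vol Ω) := fun k hk => by
        refine (hk.norm.mul_const K).mono' (hk.1.inner hFm) ?_
        filter_upwards [hF] with x hx
        exact (abs_real_inner_le_norm _ _).trans (by gcongr)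
      rw [← integral_sub (hint h hh) (hint h' hh'i), mul_comm, ← integral_mul_const,
        ← Real.norm_eq_abs]
      refine norm_integral_le_of_norm_le ((hh.sub hh'i).norm.mul_const K) ?_
      filter_upwards [hF] with x hx
      rw [← inner_sub_left]
      exact (abs_real_inner_le_norm _ _).trans (by gcongr)
    have h1 : |l V - gradFunctional hh'L V| ≤ K * ∫ x, ‖h x - h' x‖ ∂(vol Ω) := by
      refine le_of_tendsto ((hV l).sub (hV (gradFunctional hh'L))).abs
        (Eventually.of_forall fun n => ?_)
      have h2 : gradFunctional hh'L (testH10 Ω (φ n)) =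
          ∫ x, inner ℝ (h' x) (∇ (φ n : Rn N → ℝ) x) ∂(vol Ω) := by
        rw [gradFunctional_apply]
        refine integral_congr_ae ?_
        filter_upwards [wgrad_test_ae (φ n)] with x hx
        rw [hx]
      rw [hl, h2]
      exact hbound _ (continuous_gradient_test Ω (φ n)).aestronglyMeasurable
        (Eventually.of_forall (hφ n))
    have h3 := hbound _ (Lp.aestronglyMeasurable (wgrad V)) hVK
    rw [gradFunctional_apply] at h1
    calc _ ≤ |l V - ∫ x, inner ℝ (h' x) (wgrad V x) ∂(vol Ω)| +
        |∫ x, inner ℝ (h' x) (wgrad V x) ∂(vol Ω) - ∫ x, inner ℝ (h x) (wgrad V x) ∂(vol Ω)| :=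
          abs_sub_le _ _ _
      _ ≤ _ := by rw [two_mul]; exact add_le_add h1 (by rw [abs_sub_comm]; exact h3)
  have hlim : Tendsto (fun m : ℕ => 2 * (K * ∫ x, ‖h x - (1 + (1 / ((m : ℝ) + 1)) * ‖h x‖)⁻¹ • h x‖
      ∂(vol Ω))) atTop (𝓝 0) := by
    simpa using ((tendsto_integral_norm_sub_damped hh).const_mul K).const_mul 2
  have h0 := ge_of_tendsto' hlim key
  exact sub_eq_zero.1 (abs_eq_zero.1 (le_antisymm h0 (abs_nonneg _)))

/-- A Lipschitz function which vanishes outside `Ω` belongs to `H¹₀(Ω)`. -/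
theorem exists_H10_of_lipschitzWith (hΩ : Bornology.IsBounded (Ω : Set (Rn N))) {v : Rn N → ℝ}
    {K : ℝ≥0} (hv : LipschitzWith K v) (hv0 : ∀ x ∉ Ω, v x = 0) :
    ∃ V : H10 Ω, fn V =ᵐ[vol Ω] v ∧ (∀ᵐ x ∂(vol Ω), ‖wgrad V x‖ ≤ K) ∧ IsTestable V := by
  have hfin := isFiniteMeasure_vol hΩ
  have hex : ∀ n : ℕ, ∃ φ : 𝓓(Ω, ℝ), LipschitzWith K φ ∧ ∀ x, |φ x - v x| ≤ 1 / ((n : ℝ) + 1) :=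
    fun n => exists_test_lipschitz_near hΩ hv hv0 (by positivity)
  choose φ hφl hφv using hex
  have hgrad : ∀ n x, ‖∇ (φ n : Rn N → ℝ) x‖ ≤ K := fun n x => by
    rw [norm_gradient_eq]
    exact norm_fderiv_le_of_lipschitz ℝ (hφl n)
  obtain ⟨M, hM⟩ : ∃ M : ℝ, ∀ x ∈ (Ω : Set (Rn N)), ‖v x‖ ≤ M := by
    obtain ⟨M, hM⟩ := (hv.isBounded_image hΩ).exists_norm_le
    exact ⟨M, fun x hx => hM _ (mem_image_of_mem _ hx)⟩
  have hMae : ∀ᵐ x ∂(vol Ω), ‖v x‖ ≤ M := by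
    rw [ae_restrict_iff' Ω.isOpen.measurableSet]
    exact Eventually.of_forall hM
  have hvL : MemLp v 2 (vol Ω) := MemLp.of_bound hv.continuous.aestronglyMeasurable M hMae
  set m : ℝ := (vol Ω).real univ ^ (ENNReal.toReal 2)⁻¹ with hm
  have hm0 : 0 ≤ m := by positivity
  have hfnlim : Tendsto (fun n => fn (testH10 Ω (φ n))) atTop (𝓝 (hvL.toLp v)) := by
    rw [tendsto_iff_norm_sub_tendsto_zero]
    have h0 : Tendsto (fun n : ℕ => m * (1 / ((n : ℝ) + 1))) atTop (𝓝 0) := by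
      simpa using tendsto_one_div_add_atTop_nhds_zero_nat.const_mul m
    refine squeeze_zero (fun _ => norm_nonneg _) (fun n => ?_) h0
    refine Lp.norm_le_of_ae_bound (by positivity) ?_
    filter_upwards [Lp.coeFn_sub (fn (testH10 Ω (φ n))) (hvL.toLp v), fn_test_ae (φ n),
      hvL.coeFn_toLp] with x h1 h2 h3
    rw [h1, Pi.sub_apply, h2, h3]
    exact hφv n x
  obtain ⟨C₁, hC₁⟩ := hfnlim.norm.bddAbove_range
  have hgradn : ∀ n, ‖wgrad (testH10 Ω (φ n))‖ ≤ m * K := fun n => by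
    refine Lp.norm_le_of_ae_bound K.2 ?_
    filter_upwards [wgrad_test_ae (φ n)] with x hx
    rw [hx]
    exact hgrad n x
  have hbound : ∀ n, ‖testH10 Ω (φ n)‖ ≤ C₁ + m * K := fun n => by
    have h1 := norm_sq_eq (testH10 Ω (φ n))
    have h2 : ‖fn (testH10 Ω (φ n))‖ ≤ C₁ := hC₁ (mem_range_self n)
    refine le_trans ?_ (add_le_add h2 (hgradn n))
    refine (sq_le_sq₀ (norm_nonneg _) (by positivity)).1 ?_
    nlinarith [mul_nonneg (norm_nonneg (fn (testH10 Ω (φ n))))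
      (norm_nonneg (wgrad (testH10 Ω (φ n))))]
  obtain ⟨U, V, hU, hV⟩ := exists_ultrafilter_weak_limit hbound
  refine ⟨V, ?_, norm_wgrad_ae_le_of_weak_limit hΩ K.2 hgrad hV,
    isTestable_of_weak_limit hΩ K.2 hgrad hV⟩
  -- The weak limit has the right underlying function, since the functions themselves converge
  -- strongly in `L²`.
  have hfV : fn V = hvL.toLp v := by
    refine ext_inner_left ℝ fun z => ?_
    have h1 := hV ((innerSL ℝ z).comp (fnL Ω))
    have h2 : Tendsto (fun n => ((innerSL ℝ z).comp (fnL Ω)) (testH10 Ω (φ n))) U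
        (𝓝 (innerSL ℝ z (hvL.toLp v))) :=
      ((innerSL ℝ z).continuous.tendsto _).comp (hfnlim.mono_left hU)
    exact tendsto_nhds_unique h1 h2
  rw [hfV]
  exact hvL.coeFn_toLp

end LipschitzFunctions

/-! ### Lipschitz truncation -/

section Truncation

variable {N : ℕ} {Ω : TopologicalSpace.Opens (Rn N)}

/-- Lipschitz truncation: an element `u` of `H¹₀(Ω)` can be changed outside the set where the
maximal function of its gradient is at most `L` so that its gradient is bounded by `C L`. -/
theorem exists_lipschitz_truncation [Nontrivial (Rn N)]
    (hΩ : Bornology.IsBounded (Ω : Set (Rn N))) (hΩl : HasLipschitzBoundary (Ω : Set (Rn N))) :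
    ∃ C : ℝ, 0 < C ∧ ∀ (u : H10 Ω) (L : ℝ), 0 ≤ L → ∃ V : H10 Ω, IsTestable V ∧
      (∀ᵐ x ∂(vol Ω), ‖wgrad V x‖ ≤ C * L) ∧
      ∀ᵐ x ∂(vol Ω), x ∈ maximalSublevel volume (gradENorm u) (ENNReal.ofReal L) →
        fn V x = fn u x := by
  obtain ⟨κ, Ce, hκ, hκ1, hCe, hext⟩ := hΩl.exists_exterior_closedBall Ω.isOpen hΩ
  set C : ℝ := 4 * 2 ^ N + 2 * Ce * (2 / κ) ^ N with hC
  have hC0 : 0 < C := by positivity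
  refine ⟨C, hC0, fun u L hL => ?_⟩
  obtain ⟨φ, hφ, hφm⟩ := exists_seq_test_maximalSublevel hΩ u
  have hφC : ∀ k, ContDiff ℝ 1 (φ k : Rn N → ℝ) := fun k => (φ k).contDiff.of_le (by simp)
  set Lk : ℕ → ℝ := fun k => L + (1 / 2) ^ k with hLk
  have hLk0 : ∀ k, 0 ≤ Lk k := fun k => by positivity
  have hLklim : Tendsto Lk atTop (𝓝 L) := by
    simpa [hLk] using (tendsto_pow_atTop_nhds_zero_of_lt_one (r := (1 / 2 : ℝ)) (by norm_num)
      (by norm_num)).const_add L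
  have hLke : ∀ k, ENNReal.ofReal (Lk k) = ENNReal.ofReal L + ENNReal.ofReal ((1 / 2) ^ k) :=
    fun k => ENNReal.ofReal_add hL (by positivity)
  -- On `G` the estimates for smooth functions hold for the approximations at levels `L + 2 ^ (-k)`
  -- and pass to the limit for this pointwise representative of `u`.
  set G : Set (Rn N) := {x | x ∈ Ω ∧ Tendsto (fun k => φ k x) atTop (𝓝 (fn u x)) ∧
    ∀ᶠ k in atTop, x ∈ maximalSublevel volume (fun y => ‖fderiv ℝ (φ k : Rn N → ℝ) y‖ₑ)
          (ENNReal.ofReal (Lk k))} with hG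
  have hint : ∀ x ∈ G, ∀ y ∈ G, |fn u x - fn u y| ≤ C * L * dist x y := by
    rintro x ⟨-, hx, hxm⟩ y ⟨-, hy, hym⟩
    have h1 : |fn u x - fn u y| ≤ 4 * 2 ^ N * L * dist x y := by
      refine le_of_tendsto_of_tendsto (hx.sub hy).abs
        ((hLklim.const_mul (4 * 2 ^ N)).mul_const (dist x y)) ?_
      filter_upwards [hxm, hym] with k hkx hky
      have := abs_sub_le_of_mem_maximalSublevel (hφC k) (hLk0 k) hkx hky
      rwa [finrank_euclideanSpace_fin] at this
    refine h1.trans ?_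
    gcongr
    rw [hC]
    have : 0 ≤ 2 * Ce * (2 / κ) ^ N := by positivity
    linarith
  have hbd : ∀ x ∈ G, ∀ y ∉ Ω, |fn u x| ≤ C * L * dist x y := by
    rintro x ⟨hxΩ, hx, hxm⟩ y hy
    obtain ⟨c, t, ht, hct, hty, hcb⟩ := hext x hxΩ y hy
    have h1 : |fn u x| ≤ 2 * t * (2 / κ) ^ N * L := by
      refine le_of_tendsto_of_tendsto hx.abs (hLklim.const_mul (2 * t * (2 / κ) ^ N)) ?_
      filter_upwards [hxm] with k hkx
      have := abs_le_of_eqOn_zero_closedBall (hφC k) (hLk0 k) hkx ht hκ hκ1 hct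
        (fun z hz => test_eq_zero_of_notMem (hcb hz))
      rwa [finrank_euclideanSpace_fin] at this
    calc |fn u x| ≤ 2 * t * (2 / κ) ^ N * L := h1
      _ ≤ 2 * (Ce * dist x y) * (2 / κ) ^ N * L := by gcongr
      _ = (2 * Ce * (2 / κ) ^ N) * L * dist x y := by ring
      _ ≤ C * L * dist x y := by
        gcongr
        rw [hC]
        have : (0 : ℝ) ≤ 4 * 2 ^ N := by positivity
        linarith
  classical
  set w : Rn N → ℝ := fun x => if x ∈ Ω then fn u x else 0 with hw
  -- The extension by zero is Lipschitz on the good set together with the complement of `Ω`: two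
  -- good points by the Lipschitz estimate, a good and an exterior point by the exterior ball where
  -- the approximations vanish. Extending from this set forces the value zero outside `Ω`.
  have hwl : LipschitzOnWith (Real.toNNReal (C * L)) w (G ∪ (Ω : Set (Rn N))ᶜ) := by
    refine LipschitzOnWith.of_dist_le_mul fun x hx y hy => ?_
    rw [Real.coe_toNNReal _ (by positivity), Real.dist_eq]
    rcases hx with hx | hx <;> rcases hy with hy | hy
    · simpa only [hw, if_pos hx.1, if_pos hy.1] using hint x hx y hy
    · have hy' : y ∉ Ω := hy
      simpa only [hw, if_pos hx.1, if_neg hy', sub_zero] using hbd x hx y hy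
    · have hx' : x ∉ Ω := hx
      simpa only [hw, if_neg hx', if_pos hy.1, zero_sub, abs_neg, dist_comm] using hbd y hy x hx
    · have hx' : x ∉ Ω := hx
      have hy' : y ∉ Ω := hy
      simp only [hw, if_neg hx', if_neg hy', sub_zero, abs_zero]
      positivity
  obtain ⟨v, hvl, hvw⟩ := hwl.extend_real
  have hv0 : ∀ x ∉ Ω, v x = 0 := fun x hx => by
    rw [← hvw (Or.inr hx)]
    simp only [hw, if_neg hx]
  obtain ⟨V, hfV, hgV, hV⟩ := exists_H10_of_lipschitzWith hΩ hvl hv0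
  refine ⟨V, hV, ?_, ?_⟩
  · filter_upwards [hgV] with x hx
    rwa [Real.coe_toNNReal _ (by positivity)] at hx
  · filter_upwards [hfV, hφ, ae_restrict_of_ae hφm, ae_restrict_mem Ω.isOpen.measurableSet]
      with x h1 h2 h3 hxΩ hxm
    have hxG : x ∈ G := by
      refine ⟨hxΩ, h2, ?_⟩
      simp only [hLke]
      exact h3 _ hxm
    have hxΩ' : x ∈ Ω := hxΩ
    rw [h1, ← hvw (Or.inl hxG)]
    simp only [hw, if_pos hxΩ']

/-- An element of `H¹₀(Ω)` with zero gradient vanishes. -/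
theorem eq_zero_of_wgrad_eq_zero [Nontrivial (Rn N)]
    (hΩ : Bornology.IsBounded (Ω : Set (Rn N))) (hΩl : HasLipschitzBoundary (Ω : Set (Rn N)))
    {u : H10 Ω} (hu : ∀ᵐ x ∂(vol Ω), wgrad u x = 0) : u = 0 := by
  obtain ⟨φ, hφ, hφm⟩ := exists_seq_test_maximalSublevel hΩ u
  obtain ⟨κ, Ce, hκ, hκ1, hCe, hext⟩ := hΩl.exists_exterior_closedBall Ω.isOpen hΩ
  obtain ⟨y, hy⟩ : ∃ y, y ∉ (Ω : Set (Rn N)) := by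
    by_contra! hcon
    have : Bornology.IsBounded (univ : Set (Rn N)) := hΩ.subset fun x _ => hcon x
    exact NormedSpace.unbounded_univ ℝ (Rn N) this
  have hg0 : ∀ᵐ x, gradENorm u x ≤ 0 := by
    rw [ae_restrict_iff' Ω.isOpen.measurableSet] at hu
    filter_upwards [hu] with x hx
    by_cases hxΩ : x ∈ (Ω : Set (Rn N))
    · simp [gradENorm, hx hxΩ]
    · simp [gradENorm, hxΩ]
  have hmax := maximalSublevel_eq_univ hg0
  refine fn_injective hΩ (Lp.ext ?_)
  have h00 : fn (0 : H10 Ω) = 0 := map_zero (fnL Ω)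
  rw [h00]
  filter_upwards [hφ, ae_restrict_of_ae hφm, ae_restrict_mem Ω.isOpen.measurableSet,
    Lp.coeFn_zero ℝ 2 (vol Ω)] with x hx hxm hxΩ h0
  rw [h0, Pi.zero_apply]
  -- With zero gradient the approximations have maximal functions at most `2 ^ (-k)` at `x`.
  -- Comparison with one fixed exterior ball then makes their values at `x` tend to zero.
  obtain ⟨c, t, ht, hct, hty, hcb⟩ := hext x hxΩ y hy
  have hlim : Tendsto (fun k : ℕ => 2 * t * (2 / κ) ^ N * (1 / 2 : ℝ) ^ k) atTop (𝓝 0) := by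
    simpa using (tendsto_pow_atTop_nhds_zero_of_lt_one (r := (1 / 2 : ℝ)) (by norm_num)
      (by norm_num)).const_mul (2 * t * (2 / κ) ^ N)
  have h1 : |fn u x| ≤ 0 := by
    refine le_of_tendsto_of_tendsto hx.abs hlim ?_
    filter_upwards [hxm 0 (by rw [hmax]; trivial)] with k hk
    rw [zero_add] at hk
    have := abs_le_of_eqOn_zero_closedBall ((φ k).contDiff.of_le (by simp)) (by positivity) hk ht
      hκ hκ1 hct (fun z hz => test_eq_zero_of_notMem (hcb hz))
    rwa [finrank_euclideanSpace_fin] at this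
  exact abs_eq_zero.1 (le_antisymm h1 (abs_nonneg _))

/-- The exceptional set of the Lipschitz truncation, with its measure estimate. -/
theorem exists_lipschitz_truncation_off_set [Nontrivial (Rn N)]
    (hΩ : Bornology.IsBounded (Ω : Set (Rn N))) (hΩl : HasLipschitzBoundary (Ω : Set (Rn N))) :
    ∃ C : ℝ, 0 < C ∧ ∀ (u : H10 Ω) (L : ℝ), 0 < L → ∃ (V : H10 Ω) (B : Set (Rn N)),
      MeasurableSet B ∧ IsTestable V ∧ (∀ᵐ x ∂(vol Ω), ‖wgrad V x‖ ≤ C * L) ∧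
      (∀ᵐ x ∂(vol Ω), x ∉ B → wgrad V x = wgrad u x) ∧
      ENNReal.ofReal L * vol Ω B ≤
        ENNReal.ofReal C * ∫⁻ x in {x | L / 2 < ‖wgrad u x‖}, ‖wgrad u x‖ₑ ∂(vol Ω) := by
  obtain ⟨C, hC, h⟩ := exists_lipschitz_truncation hΩ hΩl
  refine ⟨max C (2 * 5 ^ N), lt_max_of_lt_left hC, fun u L hL => ?_⟩
  obtain ⟨V, hVt, hVC, hVu⟩ := h u L hL.le
  set E : Set (Rn N) := (maximalSublevel volume (gradENorm u) (ENNReal.ofReal L))ᶜ with hE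
  -- The measurable hull has the same measure as `E`, so measurability of the sublevel set itself is
  -- not needed.
  refine ⟨V, toMeasurable volume E, measurableSet_toMeasurable _ _, hVt, ?_, ?_, ?_⟩
  · filter_upwards [hVC] with x hx
    exact hx.trans (by gcongr; exact le_max_left _ _)
  · filter_upwards [hVu, wgrad_ae_eq_of_fn_eq hΩ V u] with x h1 h2 hxB
    refine h2 (h1 ?_)
    by_contra hx
    exact hxB (subset_toMeasurable _ _ hx)
  · have h1 := mul_measure_compl_maximalSublevel_le_setLIntegral (μ := (volume : Measure (Rn N)))
      (g := gradENorm u) (L := ENNReal.ofReal L) (by simpa using hL) ENNReal.ofReal_ne_top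
      (measurable_gradENorm u) (lintegral_gradENorm_ne_top hΩ u)
    rw [finrank_euclideanSpace_fin] at h1
    calc ENNReal.ofReal L * vol Ω (toMeasurable volume E)
        ≤ ENNReal.ofReal L * volume (toMeasurable volume E) := by
          gcongr; exact Measure.restrict_le_self
      _ = ENNReal.ofReal L * volume E := by rw [measure_toMeasurable]
      _ ≤ _ := h1
      _ ≤ ENNReal.ofReal (max C (2 * 5 ^ N)) *
          ∫⁻ x in {x | ENNReal.ofReal L / 2 < gradENorm u x}, gradENorm u x := by
          gcongr
          refine le_trans (le_of_eq ?_) (ENNReal.ofReal_le_ofReal (le_max_right _ _))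
          rw [ENNReal.ofReal_mul (by norm_num), ENNReal.ofReal_pow (by norm_num)]
          norm_num
      _ ≤ _ := by
          refine mul_le_mul_right ?_ _
          have hm : Measurable fun x => ‖wgrad u x‖ :=
            (Lp.stronglyMeasurable (wgrad u)).measurable.norm
          rw [Measure.restrict_restrict (measurableSet_lt measurable_const hm),
            ← lintegral_indicator (measurableSet_lt measurable_const (measurable_gradENorm u)),
            ← lintegral_indicator
              ((measurableSet_lt measurable_const hm).inter Ω.isOpen.measurableSet)]
          refine lintegral_mono fun x => ?_
          by_cases hx : x ∈ {x | ENNReal.ofReal L / 2 < gradENorm u x}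
          · rw [indicator_of_mem hx]
            by_cases hxΩ : x ∈ (Ω : Set (Rn N))
            · have hgx : gradENorm u x = ‖wgrad u x‖ₑ := by simp [gradENorm, hxΩ]
              have hx2 : x ∈ {x | L / 2 < ‖wgrad u x‖} ∩ (Ω : Set (Rn N)) := by
                refine ⟨?_, hxΩ⟩
                have hx3 : ENNReal.ofReal L / 2 < gradENorm u x := hx
                have hL2 : ENNReal.ofReal L / 2 = ENNReal.ofReal (L / 2) := by
                  rw [ENNReal.ofReal_div_of_pos two_pos, ENNReal.ofReal_ofNat]
                rw [hgx, ← ofReal_norm, hL2] at hx3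
                exact (ENNReal.ofReal_lt_ofReal_iff_of_nonneg (by positivity)).1 hx3
              rw [indicator_of_mem hx2, hgx]
            · simp [gradENorm, hxΩ]
          · simp [hx]

end Truncation

/-! ### Extension of identities from test functions -/

section Extension

variable {N : ℕ} {Ω : TopologicalSpace.Opens (Rn N)}

theorem norm_sq_L2_eq (w : Lp (Rn N) 2 (vol Ω)) : ‖w‖ ^ 2 = ∫ x, ‖w x‖ ^ 2 ∂(vol Ω) := by
  rw [← real_inner_self_eq_norm_sq, L2.inner_def]
  simp only [real_inner_self_eq_norm_sq]

theorem integrable_norm_sq_wgrad (u : H10 Ω) : Integrable (fun x => ‖wgrad u x‖ ^ 2) (vol Ω) :=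
  (memLp_two_iff_integrable_sq_norm (Lp.aestronglyMeasurable _)).1 (Lp.memLp (wgrad u))

theorem integrable_norm_wgrad (hΩ : Bornology.IsBounded (Ω : Set (Rn N))) (u : H10 Ω) :
    Integrable (fun x => ‖wgrad u x‖) (vol Ω) := by
  have := isFiniteMeasure_vol hΩ
  exact ((Lp.memLp (wgrad u)).integrable (by norm_num)).norm

theorem measurable_norm_wgrad (u : H10 Ω) : Measurable fun x => ‖wgrad u x‖ :=
  (Lp.stronglyMeasurable (wgrad u)).measurable.norm

theorem tendsto_setIntegral_norm_wgrad_gt {f : Rn N → ℝ} (hf : Integrable f (vol Ω)) (u : H10 Ω)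
    {L : ℕ → ℝ} (hL : Tendsto L atTop atTop) :
    Tendsto (fun n => ∫ x in {x | L n / 2 < ‖wgrad u x‖}, f x ∂(vol Ω)) atTop (𝓝 0) := by
  have hms : ∀ n, MeasurableSet {x | L n / 2 < ‖wgrad u x‖} := fun n =>
    measurableSet_lt measurable_const (measurable_norm_wgrad u)
  have h0 : ∫ _, (0 : ℝ) ∂(vol Ω) = 0 := by simp
  simp_rw [← integral_indicator (hms _)]
  rw [← h0]
  refine tendsto_integral_of_dominated_convergence (fun x => ‖f x‖)
    (fun n => hf.1.indicator (hms n)) hf.norm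
    (fun n => Eventually.of_forall fun x => norm_indicator_le_norm_self _ _)
    (Eventually.of_forall fun x => ?_)
  refine tendsto_const_nhds.congr' ?_
  filter_upwards [hL.eventually_ge_atTop (2 * ‖wgrad u x‖)] with n hn
  rw [indicator_of_notMem]
  simp only [mem_ofPred_eq, not_lt]
  linarith

/-- A sequence of Lipschitz truncations of `u` at levels tending to infinity. -/
theorem exists_truncation_seq [Nontrivial (Rn N)]
    (hΩ : Bornology.IsBounded (Ω : Set (Rn N))) (hΩl : HasLipschitzBoundary (Ω : Set (Rn N)))
    (u : H10 Ω) {L : ℕ → ℝ} (hL0 : ∀ n, 0 < L n) (hL : Tendsto L atTop atTop) :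
    ∃ (C : ℝ) (V : ℕ → H10 Ω) (B : ℕ → Set (Rn N)), 0 < C ∧ (∀ n, MeasurableSet (B n)) ∧
      (∀ n, IsTestable (V n)) ∧ (∀ n, ∀ᵐ x ∂(vol Ω), ‖wgrad (V n) x‖ ≤ C * L n) ∧
      (∀ n, ∀ᵐ x ∂(vol Ω), x ∉ B n → wgrad (V n) x = wgrad u x) ∧
      (∀ n, L n * (vol Ω).real (B n) ≤
        C * ∫ x in {x | L n / 2 < ‖wgrad u x‖}, ‖wgrad u x‖ ∂(vol Ω)) ∧
      Tendsto (fun n => (vol Ω) (B n)) atTop (𝓝 0) := by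
  have hfin := isFiniteMeasure_vol hΩ
  obtain ⟨C, hC, h⟩ := exists_lipschitz_truncation_off_set hΩ hΩl
  choose V B hBm hVt hVC hVB hB using fun n => h u (L n) (hL0 n)
  have hg := integrable_norm_wgrad hΩ u
  have hBr : ∀ n, L n * (vol Ω).real (B n) ≤
      C * ∫ x in {x | L n / 2 < ‖wgrad u x‖}, ‖wgrad u x‖ ∂(vol Ω) := fun n => by
    have h1 := hB n
    have h2 : ∫⁻ x in {x | L n / 2 < ‖wgrad u x‖}, ‖wgrad u x‖ₑ ∂(vol Ω) =
        ENNReal.ofReal (∫ x in {x | L n / 2 < ‖wgrad u x‖}, ‖wgrad u x‖ ∂(vol Ω)) := by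
      rw [ofReal_integral_eq_lintegral_ofReal hg.integrableOn
        (Eventually.of_forall fun x => norm_nonneg _)]
      simp only [ofReal_norm]
    rw [h2, ← ENNReal.ofReal_mul hC.le, ← ofReal_measureReal, ← ENNReal.ofReal_mul (hL0 n).le,
      ENNReal.ofReal_le_ofReal_iff (mul_nonneg hC.le
        (integral_nonneg fun x => norm_nonneg _))] at h1
    exact h1
  refine ⟨C, V, B, hC, hBm, hVt, hVC, hVB, hBr, ?_⟩
  have h3 : Tendsto (fun n => C * (∫ x, ‖wgrad u x‖ ∂(vol Ω)) / L n) atTop (𝓝 0) :=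
    hL.const_div_atTop _
  have h4 := ENNReal.tendsto_ofReal h3
  rw [ENNReal.ofReal_zero] at h4
  refine tendsto_of_tendsto_of_tendsto_of_le_of_le tendsto_const_nhds h4 (fun _ => zero_le)
    fun n => ?_
  rw [← ofReal_measureReal (μ := vol Ω)]
  refine ENNReal.ofReal_le_ofReal ?_
  rw [le_div_iff₀ (hL0 n), mul_comm]
  refine (hBr n).trans ?_
  gcongr
  · exact Eventually.of_forall fun x => norm_nonneg _
  · exact Measure.restrict_le_self

/-- Where `g = |∇u| > L / 2` one has `L^(q-1) g ≤ 2^(q-1) g^q`. So `L^q |B|` is bounded by a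
multiple of a tail of the convergent integral `∫ g^q`. -/
theorem tendsto_rpow_mul_measureReal (u : H10 Ω) {L : ℕ → ℝ} (hL0 : ∀ n, 0 < L n)
    (hL : Tendsto L atTop atTop) {C : ℝ} (hC : 0 < C) {B : ℕ → Set (Rn N)}
    (hB : ∀ n, L n * (vol Ω).real (B n) ≤
      C * ∫ x in {x | L n / 2 < ‖wgrad u x‖}, ‖wgrad u x‖ ∂(vol Ω))
    {q : ℝ} (hq : 1 ≤ q) (hgq : Integrable (fun x => ‖wgrad u x‖ ^ q) (vol Ω)) :
    Tendsto (fun n => L n ^ q * (vol Ω).real (B n)) atTop (𝓝 0) := by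
  have h1 : Tendsto (fun n => C * 2 ^ (q - 1) *
      ∫ x in {x | L n / 2 < ‖wgrad u x‖}, ‖wgrad u x‖ ^ q ∂(vol Ω)) atTop (𝓝 0) := by
    simpa using (tendsto_setIntegral_norm_wgrad_gt hgq u hL).const_mul (C * 2 ^ (q - 1))
  refine squeeze_zero (fun n => mul_nonneg (Real.rpow_nonneg (hL0 n).le _) measureReal_nonneg)
    (fun n => ?_) h1
  have hms : MeasurableSet {x | L n / 2 < ‖wgrad u x‖} :=
    measurableSet_lt measurable_const (measurable_norm_wgrad u)
  have hLq : L n ^ q = L n ^ (q - 1) * L n := by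
    rw [← Real.rpow_add_one (hL0 n).ne']; congr 1; ring
  calc L n ^ q * (vol Ω).real (B n) = L n ^ (q - 1) * (L n * (vol Ω).real (B n)) := by
        rw [hLq]; ring
    _ ≤ L n ^ (q - 1) * (C * ∫ x in {x | L n / 2 < ‖wgrad u x‖}, ‖wgrad u x‖ ∂(vol Ω)) :=
        mul_le_mul_of_nonneg_left (hB n) (Real.rpow_nonneg (hL0 n).le _)
    _ = C * ∫ x in {x | L n / 2 < ‖wgrad u x‖}, L n ^ (q - 1) * ‖wgrad u x‖ ∂(vol Ω) := by
        rw [integral_const_mul]; ring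
    _ ≤ C * ∫ x in {x | L n / 2 < ‖wgrad u x‖}, 2 ^ (q - 1) * ‖wgrad u x‖ ^ q ∂(vol Ω) := by
        refine mul_le_mul_of_nonneg_left ?_ hC.le
        refine integral_mono_of_nonneg (Eventually.of_forall fun x =>
          mul_nonneg (Real.rpow_nonneg (hL0 n).le _) (norm_nonneg _))
          (hgq.const_mul _).integrableOn ?_
        filter_upwards [ae_restrict_mem hms] with x hx
        have hx' : L n / 2 < ‖wgrad u x‖ := hx
        have hpos : 0 < ‖wgrad u x‖ := lt_trans (half_pos (hL0 n)) hx'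
        have : ‖wgrad u x‖ ^ q = ‖wgrad u x‖ ^ (q - 1) * ‖wgrad u x‖ := by
          rw [← Real.rpow_add_one hpos.ne']; congr 1; ring
        rw [this, ← mul_assoc, ← Real.mul_rpow (by norm_num) hpos.le]
        refine mul_le_mul_of_nonneg_right ?_ hpos.le
        exact Real.rpow_le_rpow (hL0 n).le (by linarith) (by linarith)
    _ = _ := by rw [integral_const_mul]; ring

/-- The gradients of `V_n` and `u` differ only on `B_n`. There the truncation contributes at most a
multiple of `L² |B_n|`, which is the case `q = 2` above, and `∫_{B_n} |∇u|²` vanishes by absolute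
continuity. -/
theorem tendsto_wgrad_truncation (hΩ : Bornology.IsBounded (Ω : Set (Rn N))) (u : H10 Ω)
    {L : ℕ → ℝ} (hL0 : ∀ n, 0 < L n)
    (hL : Tendsto L atTop atTop) {C : ℝ} (hC : 0 < C) {V : ℕ → H10 Ω} {B : ℕ → Set (Rn N)}
    (hBm : ∀ n, MeasurableSet (B n)) (hVC : ∀ n, ∀ᵐ x ∂(vol Ω), ‖wgrad (V n) x‖ ≤ C * L n)
    (hVB : ∀ n, ∀ᵐ x ∂(vol Ω), x ∉ B n → wgrad (V n) x = wgrad u x)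
    (hB : ∀ n, L n * (vol Ω).real (B n) ≤
      C * ∫ x in {x | L n / 2 < ‖wgrad u x‖}, ‖wgrad u x‖ ∂(vol Ω))
    (hB0 : Tendsto (fun n => (vol Ω) (B n)) atTop (𝓝 0)) :
    Tendsto (fun n => ‖wgrad (V n - u)‖) atTop (𝓝 0) := by
  have hfin := isFiniteMeasure_vol hΩ
  have hg2 := integrable_norm_sq_wgrad u
  have h1 := tendsto_rpow_mul_measureReal u hL0 hL hC hB (q := 2) one_le_two
    (by simpa using hg2)
  simp only [Real.rpow_two] at h1
  have h2 := hg2.tendsto_setIntegral_nhds_zero hB0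
  have h3 : Tendsto (fun n => 2 * C ^ 2 * (L n ^ 2 * (vol Ω).real (B n)) +
      2 * ∫ x in B n, ‖wgrad u x‖ ^ 2 ∂(vol Ω)) atTop (𝓝 0) := by
    simpa using (h1.const_mul (2 * C ^ 2)).add (h2.const_mul 2)
  have h4 : Tendsto (fun n => ‖wgrad (V n - u)‖ ^ 2) atTop (𝓝 0) := by
    refine squeeze_zero (fun n => sq_nonneg _) (fun n => ?_) h3
    rw [norm_sq_L2_eq]
    have hbd : ∀ᵐ x ∂(vol Ω), ‖wgrad (V n - u) x‖ ^ 2 ≤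
        indicator (B n) (fun x => 2 * C ^ 2 * L n ^ 2 + 2 * ‖wgrad u x‖ ^ 2) x := by
      rw [wgrad_sub]
      filter_upwards [Lp.coeFn_sub (wgrad (V n)) (wgrad u), hVC n, hVB n] with x h5 h6 h7
      rw [h5, Pi.sub_apply]
      by_cases hx : x ∈ B n
      · rw [indicator_of_mem hx]
        have h8 := norm_sub_le (wgrad (V n) x) (wgrad u x)
        have h9 : ‖wgrad (V n) x - wgrad u x‖ ≤ C * L n + ‖wgrad u x‖ := h8.trans (by gcongr)
        calc ‖wgrad (V n) x - wgrad u x‖ ^ 2 ≤ (C * L n + ‖wgrad u x‖) ^ 2 := by gcongr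
          _ ≤ _ := by nlinarith [sq_nonneg (C * L n - ‖wgrad u x‖)]
      · rw [h7 hx, indicator_of_notMem hx]; simp
    calc ∫ x, ‖wgrad (V n - u) x‖ ^ 2 ∂(vol Ω)
        ≤ ∫ x, indicator (B n) (fun x => 2 * C ^ 2 * L n ^ 2 + 2 * ‖wgrad u x‖ ^ 2) x ∂(vol Ω) :=
          integral_mono_ae (integrable_norm_sq_wgrad _)
            (((integrable_const _).add (hg2.const_mul 2)).indicator (hBm n)) hbd
      _ = ∫ x in B n, (2 * C ^ 2 * L n ^ 2 + 2 * ‖wgrad u x‖ ^ 2) ∂(vol Ω) :=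
          integral_indicator (hBm n)
      _ = _ := by
          rw [integral_add (integrable_const _) (hg2.const_mul 2).integrableOn,
            setIntegral_const, smul_eq_mul, integral_const_mul (2 : ℝ)]
          ring
  have h5 := h4.sqrt
  simpa using h5

/-- Extension of the identity `l φ = ∫_Ω (h, ∇φ) dx` from test functions to `u`, when `∇u` is in
`L^q` and `h` is dual to `L^q`. -/
theorem eq_integral_of_young [Nontrivial (Rn N)]
    (hΩ : Bornology.IsBounded (Ω : Set (Rn N))) (hΩl : HasLipschitzBoundary (Ω : Set (Rn N)))
    {u : H10 Ω} {h : Rn N → Rn N} (hh : Integrable h (vol Ω)) {l : StrongDual ℝ (H10 Ω)}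
    (hl : ∀ φ : 𝓓(Ω, ℝ), l (testH10 Ω φ) = ∫ x, inner ℝ (h x) (∇ (φ : Rn N → ℝ) x) ∂(vol Ω))
    {C' : ℝ} (hC' : ∀ p, |l p| ≤ C' * ‖wgrad p‖) {q : ℝ} (hq : 1 ≤ q) {k : Rn N → ℝ}
    (hk : Integrable k (vol Ω)) (hy : ∀ᵐ x ∂(vol Ω), ∀ t : ℝ, 0 ≤ t → t * ‖h x‖ ≤ t ^ q + k x)
    (hgq : Integrable (fun x => ‖wgrad u x‖ ^ q) (vol Ω)) :
    l u = ∫ x, inner ℝ (h x) (wgrad u x) ∂(vol Ω) := by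
  have hfin := isFiniteMeasure_vol hΩ
  set L : ℕ → ℝ := fun n => (n : ℝ) + 1 with hLdef
  have hL0 : ∀ n, 0 < L n := fun n => by positivity
  have hL : Tendsto L atTop atTop := tendsto_atTop_add_const_right _ _ tendsto_natCast_atTop_atTop
  obtain ⟨C, V, B, hC, hBm, hVt, hVC, hVB, hB, hB0⟩ := exists_truncation_seq hΩ hΩl u hL0 hL
  have hlim := tendsto_wgrad_truncation hΩ u hL0 hL hC hBm hVC hVB hB hB0
  have hl1 : Tendsto (fun n => l (V n)) atTop (𝓝 (l u)) := by
    rw [tendsto_iff_norm_sub_tendsto_zero]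
    have h0 : Tendsto (fun n => C' * ‖wgrad (V n - u)‖) atTop (𝓝 0) := by
      simpa using hlim.const_mul C'
    refine squeeze_zero (fun _ => norm_nonneg _) (fun n => ?_) h0
    rw [← map_sub]
    exact hC' _
  have hgu : AEStronglyMeasurable (fun x => ‖wgrad u x‖) (vol Ω) :=
    (measurable_norm_wgrad u).aestronglyMeasurable
  have hprod : Integrable (fun x => ‖h x‖ * ‖wgrad u x‖) (vol Ω) := by
    refine (hgq.add hk).mono' (hh.1.norm.mul hgu) ?_
    filter_upwards [hy] with x hx
    rw [Real.norm_of_nonneg (by positivity), mul_comm]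
    exact hx _ (norm_nonneg _)
  have hinner : ∀ w : H10 Ω, Integrable (fun x => ‖h x‖ * ‖wgrad w x‖) (vol Ω) →
      Integrable (fun x => (inner ℝ (h x) (wgrad w x) : ℝ)) (vol Ω) := fun w hw =>
    hw.mono' (hh.1.inner (Lp.aestronglyMeasurable _))
      (Eventually.of_forall fun x => abs_real_inner_le_norm _ _)
  have hprodV : ∀ n, Integrable (fun x => ‖h x‖ * ‖wgrad (V n) x‖) (vol Ω) := fun n => by
    refine (hh.norm.mul_const (C * L n)).mono'
      (hh.1.norm.mul (measurable_norm_wgrad _).aestronglyMeasurable) ?_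
    filter_upwards [hVC n] with x hx
    rw [Real.norm_of_nonneg (by positivity)]
    gcongr
  -- This is the error on the exceptional set. There `|(h, ∇V_n)| ≤ C L |h| ≤ C (L^q + k)` by the
  -- Young-type hypothesis with `t = L`, and `L^q |B_n|` tends to zero.
  have hBh : Tendsto (fun n => ∫ x in B n, (C * (L n ^ q + k x) + ‖h x‖ * ‖wgrad u x‖) ∂(vol Ω))
      atTop (𝓝 0) := by
    have h1 := tendsto_rpow_mul_measureReal u hL0 hL hC hB hq hgq
    have h2 := hk.tendsto_setIntegral_nhds_zero hB0
    have h3 := hprod.tendsto_setIntegral_nhds_zero hB0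
    have h4 := ((h1.add h2).const_mul C).add h3
    simp only [add_zero, mul_zero] at h4
    refine h4.congr fun n => ?_
    have hadd : Integrable (fun x => L n ^ q + k x) ((vol Ω).restrict (B n)) :=
      (integrable_const _).add hk.integrableOn
    have hadd' : Integrable (fun x => C * (L n ^ q + k x)) ((vol Ω).restrict (B n)) :=
      hadd.const_mul C
    rw [integral_add hadd' hprod.integrableOn, integral_const_mul,
      integral_add (integrable_const _) hk.integrableOn, setIntegral_const, smul_eq_mul]
    ring
  have hl2 : Tendsto (fun n => ∫ x, inner ℝ (h x) (wgrad (V n) x) ∂(vol Ω)) atTop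
      (𝓝 (∫ x, inner ℝ (h x) (wgrad u x) ∂(vol Ω))) := by
    rw [tendsto_iff_norm_sub_tendsto_zero]
    refine squeeze_zero (fun _ => norm_nonneg _) (fun n => ?_) hBh
    rw [← integral_sub (hinner _ (hprodV n)) (hinner _ hprod), ← integral_indicator (hBm n)]
    refine norm_integral_le_of_norm_le (Integrable.indicator ?_ (hBm n)) ?_
    · exact (((integrable_const _).add hk).const_mul C).add hprod
    filter_upwards [hVC n, hVB n, hy] with x h1 h2 h3
    by_cases hx : x ∈ B n
    · rw [indicator_of_mem hx, ← inner_sub_right]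
      refine (abs_real_inner_le_norm _ _).trans ?_
      calc ‖h x‖ * ‖wgrad (V n) x - wgrad u x‖ ≤ ‖h x‖ * (C * L n + ‖wgrad u x‖) := by
            gcongr
            exact (norm_sub_le _ _).trans (by gcongr)
        _ = C * (L n * ‖h x‖) + ‖h x‖ * ‖wgrad u x‖ := by ring
        _ ≤ _ := by gcongr; exact h3 _ (hL0 n).le
    · rw [indicator_of_notMem hx, h2 hx, sub_self, norm_zero]
  refine tendsto_nhds_unique hl1 (hl2.congr fun n => ?_)
  exact (hVt n h hh l hl).symm

/-- Elements of `H¹₀(Ω)` with bounded gradient are testable. -/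
theorem isTestable_of_wgrad_bounded [Nontrivial (Rn N)]
    (hΩ : Bornology.IsBounded (Ω : Set (Rn N))) (hΩl : HasLipschitzBoundary (Ω : Set (Rn N)))
    {u : H10 Ω} {M : ℝ} (hM : ∀ᵐ x ∂(vol Ω), ‖wgrad u x‖ ≤ M) : IsTestable u := by
  obtain ⟨C, hC, h⟩ := exists_lipschitz_truncation hΩ hΩl
  obtain ⟨V, hV, -, hVu⟩ := h u |M| (abs_nonneg _)
  have hb : ∀ᵐ x, gradENorm u x ≤ ENNReal.ofReal |M| := by
    rw [ae_restrict_iff' Ω.isOpen.measurableSet] at hM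
    filter_upwards [hM] with x hx
    by_cases hxΩ : x ∈ (Ω : Set (Rn N))
    · rw [gradENorm, indicator_of_mem hxΩ, ← ofReal_norm]
      exact ENNReal.ofReal_le_ofReal ((hx hxΩ).trans (le_abs_self _))
    · simp [gradENorm, hxΩ]
  -- If the gradient is already bounded by `|M|`, truncation at level `|M|` changes nothing, so `u`
  -- is its own truncation.
  have huniv := maximalSublevel_eq_univ hb
  have : V = u := by
    refine fn_injective hΩ (Lp.ext ?_)
    filter_upwards [hVu] with x hx
    exact hx (by rw [huniv]; trivial)
  rwa [← this]

end Extension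

/-! ### Levels at which the truncation error is small -/

section Levels

/-- A geometric sum is at most twice its largest term, and only powers of two below `2 t` occur. The
induction carries the bound `2 ^ n` along, which is what controls the step where a new term appears.
-/
theorem sum_two_pow_ite_le (t : ℝ) (ht : 0 ≤ t) (n : ℕ) :
    ∑ j ∈ Finset.range n, (if (2 : ℝ) ^ j / 2 < t then (2 : ℝ) ^ j else 0) ≤ 4 * t := by
  have : ∑ j ∈ Finset.range n, (if (2 : ℝ) ^ j / 2 < t then (2 : ℝ) ^ j else 0) ≤ 2 ^ n ∧
      ∑ j ∈ Finset.range n, (if (2 : ℝ) ^ j / 2 < t then (2 : ℝ) ^ j else 0) ≤ 4 * t := by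
    induction n with
    | zero => simpa using ht
    | succ n ih =>
      rw [Finset.sum_range_succ, pow_succ]
      split_ifs with h
      · constructor <;> linarith [ih.1]
      · have : (0 : ℝ) < 2 ^ n := by positivity
        constructor <;> linarith [ih.1, ih.2]
  exact this.2

/-- Otherwise `b j > ε / j` for all large `j`, against the divergence of the harmonic series. This
yields smallness only along infinitely many `j`, which suffices. -/
theorem frequently_mul_le_of_summable {b : ℕ → ℝ} (hb : Summable b) {ε : ℝ}
    (hε : 0 < ε) : ∃ᶠ j : ℕ in atTop, (j : ℝ) * b j ≤ ε := by
  intro hcon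
  have h1 : ∀ᶠ j : ℕ in atTop, ‖ε * (1 / (j : ℝ))‖ ≤ b j := by
    filter_upwards [hcon, eventually_gt_atTop 0] with j hj hj0
    have hj0' : (0 : ℝ) < j := by exact_mod_cast hj0
    rw [Real.norm_of_nonneg (by positivity), mul_one_div, div_le_iff₀ hj0', mul_comm]
    exact (not_le.1 hj).le
  have h2 : Summable fun j : ℕ => ε * (1 / (j : ℝ)) :=
    Summable.of_norm_bounded_eventually_nat hb h1
  exact Real.not_summable_one_div_natCast ((summable_mul_left_iff hε.ne').1 h2)

variable {X : Type*} [MeasurableSpace X] {μ : Measure X}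

/-- Sum under the integral: at each point the powers `2 ^ j < 2 g` add up to at most `4 g`, so the
partial sums stay below `4 ∫ g²`. -/
theorem summable_setIntegral_gt {g : X → ℝ} (hgm : Measurable g) (hg0 : ∀ x, 0 ≤ g x)
    (hg : Integrable g μ) (hg2 : Integrable (fun x => g x ^ 2) μ) :
    Summable fun j : ℕ => (2 : ℝ) ^ j * ∫ x in {x | (2 : ℝ) ^ j / 2 < g x}, g x ∂μ := by
  have hms : ∀ j : ℕ, MeasurableSet {x | (2 : ℝ) ^ j / 2 < g x} := fun j =>
    measurableSet_lt measurable_const hgm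
  refine summable_of_sum_range_le (c := ∫ x, 4 * g x ^ 2 ∂μ)
    (fun j => mul_nonneg (by positivity) (integral_nonneg fun x => hg0 x)) fun n => ?_
  have h1 : ∀ j : ℕ, (2 : ℝ) ^ j * ∫ x in {x | (2 : ℝ) ^ j / 2 < g x}, g x ∂μ =
      ∫ x, indicator {x | (2 : ℝ) ^ j / 2 < g x} (fun x => 2 ^ j * g x) x ∂μ := fun j => by
    rw [integral_indicator (hms j), integral_const_mul]
  simp_rw [h1]
  rw [← integral_finsetSum _ fun j _ => (hg.const_mul _).indicator (hms j)]
  refine integral_mono (integrable_finsetSum _ fun j _ => (hg.const_mul _).indicator (hms j))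
    (hg2.const_mul 4) fun x => ?_
  have h2 : ∀ j : ℕ, indicator {x | (2 : ℝ) ^ j / 2 < g x} (fun x => 2 ^ j * g x) x =
      (if (2 : ℝ) ^ j / 2 < g x then (2 : ℝ) ^ j else 0) * g x := fun j => by
    simp [indicator_apply]
  simp_rw [h2]
  rw [← Finset.sum_mul]
  calc _ ≤ 4 * g x * g x :=
        mul_le_mul_of_nonneg_right (sum_two_pow_ite_le _ (hg0 x) n) (hg0 x)
    _ = _ := by ring

theorem integral_pow_le_of_eLpNorm_le {a : X → ℝ} (ham : Measurable a) (ha0 : ∀ x, 0 ≤ a x)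
    {n : ℕ} (hn : n ≠ 0) {s : ℝ} (hs : 0 ≤ s)
    (h : eLpNorm a (ENNReal.ofReal n) μ ≤ ENNReal.ofReal s) :
    Integrable (fun x => a x ^ n) μ ∧ ∫ x, a x ^ n ∂μ ≤ s ^ n := by
  have hp : ENNReal.ofReal (n : ℝ) = (n : ℝ≥0∞) := ENNReal.ofReal_natCast n
  rw [hp] at h
  have hmem : MemLp a n μ := ⟨ham.aestronglyMeasurable, h.trans_lt ENNReal.ofReal_lt_top⟩
  have hn' : (n : ℝ≥0∞) ≠ 0 := by exact_mod_cast hn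
  have hint := hmem.integrable_norm_pow hn
  have h1 := hmem.eLpNorm_eq_integral_rpow_norm hn' (ENNReal.natCast_ne_top n)
  simp only [Real.norm_of_nonneg (ha0 _), ENNReal.toReal_natCast, Real.rpow_natCast] at h1 hint
  refine ⟨hint, ?_⟩
  rw [h1, ENNReal.ofReal_le_ofReal_iff hs] at h
  have h0 : 0 ≤ ∫ x, a x ^ n ∂μ := integral_nonneg fun x => pow_nonneg (ha0 x) n
  calc ∫ x, a x ^ n ∂μ = ((∫ x, a x ^ n ∂μ) ^ ((n : ℝ)⁻¹)) ^ n :=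
        (Real.rpow_inv_natCast_pow h0 hn).symm
    _ ≤ s ^ n := pow_le_pow_left₀ (Real.rpow_nonneg h0 _) h n

/-- Chebyshev's inequality with an exponent growing with the level: for `p = 4 j` the `o(p)`
condition gives `‖a‖_p ≤ j / 2` eventually, so `∫_{a > j} a² ≤ j² 16^(-j)`, which beats the factor
`4 ^ j`. -/
theorem tendsto_four_pow_mul_setIntegral {a : X → ℝ} (ham : Measurable a) (ha0 : ∀ x, 0 ≤ a x)
    (ha2 : Integrable (fun x => a x ^ 2) μ)
    (hLp : Tendsto (fun p : ℝ => eLpNorm a (ENNReal.ofReal p) μ / ENNReal.ofReal p) atTop (𝓝 0)) :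
    Tendsto (fun j : ℕ => (4 : ℝ) ^ j * ∫ x in {x | (j : ℝ) < a x}, a x ^ 2 ∂μ) atTop (𝓝 0) := by
  have h1 : Tendsto (fun j : ℕ => ((4 * j : ℕ) : ℝ)) atTop atTop :=
    tendsto_natCast_atTop_atTop.comp (tendsto_id.const_mul_atTop' (by norm_num))
  -- The ratio `1 / 8` at `p = 4 j` makes the norm at most `j / 2`; the fourth power of this `1 / 2`
  -- supplies the decay `16 ^ (-j)`.
  have h8 : (0 : ℝ≥0∞) < ENNReal.ofReal (1 / 8) := ENNReal.ofReal_pos.2 (by norm_num)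
  have h2 := (hLp.comp h1).eventually (gt_mem_nhds h8)
  have hlim : Tendsto (fun j : ℕ => (j : ℝ) ^ 2 * (1 / 4) ^ j) atTop (𝓝 0) :=
    tendsto_pow_const_mul_const_pow_of_lt_one 2 (by norm_num) (by norm_num)
  refine squeeze_zero' (Eventually.of_forall fun j => mul_nonneg (by positivity)
    (integral_nonneg fun x => sq_nonneg _)) ?_ hlim
  filter_upwards [h2, eventually_ge_atTop 1] with j hj hj1
  have hj0 : (0 : ℝ) < j := by exact_mod_cast hj1
  have hn : 4 * j ≠ 0 := by omega
  have hj' : eLpNorm a (ENNReal.ofReal ((4 * j : ℕ) : ℝ)) μ ≤ ENNReal.ofReal ((j : ℝ) / 2) := by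
    have h3 := hj.le
    simp only [Function.comp] at h3
    rw [ENNReal.div_le_iff (ENNReal.ofReal_pos.2 (by positivity)).ne' ENNReal.ofReal_ne_top,
      ← ENNReal.ofReal_mul (by norm_num)] at h3
    refine h3.trans_eq ?_
    congr 1
    push_cast
    ring
  obtain ⟨hint, hle⟩ := integral_pow_le_of_eLpNorm_le ham ha0 hn (by positivity) hj'
  have hms : MeasurableSet {x | (j : ℝ) < a x} := measurableSet_lt measurable_const ham
  have h4 : (j : ℝ) ^ (4 * j) * ∫ x in {x | (j : ℝ) < a x}, a x ^ 2 ∂μ ≤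
      (j : ℝ) ^ 2 * ((j : ℝ) / 2) ^ (4 * j) := by
    calc _ = ∫ x in {x | (j : ℝ) < a x}, (j : ℝ) ^ (4 * j) * a x ^ 2 ∂μ :=
          (integral_const_mul _ _).symm
      _ ≤ ∫ x in {x | (j : ℝ) < a x}, (j : ℝ) ^ 2 * a x ^ (4 * j) ∂μ := by
          refine setIntegral_mono_on (ha2.const_mul _).integrableOn
            (hint.const_mul _).integrableOn hms fun x hx => ?_
          have hx' : (j : ℝ) < a x := hx
          obtain ⟨m, hm⟩ : ∃ m, 4 * j = m + 2 := ⟨4 * j - 2, by omega⟩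
          rw [hm, pow_add, pow_add]
          have : (j : ℝ) ^ m ≤ a x ^ m := pow_le_pow_left₀ hj0.le hx'.le m
          have h5 : 0 ≤ (j : ℝ) ^ 2 * a x ^ 2 := by positivity
          nlinarith [mul_le_mul_of_nonneg_right this h5]
      _ ≤ ∫ x, (j : ℝ) ^ 2 * a x ^ (4 * j) ∂μ :=
          setIntegral_le_integral (hint.const_mul _) (Eventually.of_forall fun x =>
            mul_nonneg (sq_nonneg _) (pow_nonneg (ha0 x) _))
      _ = (j : ℝ) ^ 2 * ∫ x, a x ^ (4 * j) ∂μ := integral_const_mul _ _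
      _ ≤ _ := mul_le_mul_of_nonneg_left hle (sq_nonneg _)
  have h6 : ((j : ℝ) / 2) ^ (4 * j) = (j : ℝ) ^ (4 * j) * ((1 / 4) ^ j * (1 / 4) ^ j) := by
    rw [div_pow, ← mul_pow, pow_mul 2, div_eq_mul_inv, ← inv_pow]
    norm_num
  have hjp : (0 : ℝ) < (j : ℝ) ^ (4 * j) := by positivity
  have h7 : ∫ x in {x | (j : ℝ) < a x}, a x ^ 2 ∂μ ≤ (j : ℝ) ^ 2 * ((1 / 4) ^ j * (1 / 4) ^ j) := by
    refine le_of_mul_le_mul_left (h4.trans_eq ?_) hjp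
    rw [h6]; ring
  calc (4 : ℝ) ^ j * ∫ x in {x | (j : ℝ) < a x}, a x ^ 2 ∂μ
      ≤ 4 ^ j * ((j : ℝ) ^ 2 * ((1 / 4) ^ j * (1 / 4) ^ j)) :=
        mul_le_mul_of_nonneg_left h7 (by positivity)
    _ = (j : ℝ) ^ 2 * (1 / 4) ^ j * (4 * (1 / 4)) ^ j := by rw [mul_pow]; ring
    _ = _ := by norm_num

/-- Along infinitely many dyadic levels, the error in testing with Lipschitz truncations is
small when the `L^p` norms of `a` are `o(p)`. -/
theorem frequently_truncation_error_le [IsFiniteMeasure μ] {a g : X → ℝ}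
    (ham : Measurable a) (ha0 : ∀ x, 0 ≤ a x) (ha2 : Integrable (fun x => a x ^ 2) μ)
    (hLp : Tendsto (fun p : ℝ => eLpNorm a (ENNReal.ofReal p) μ / ENNReal.ofReal p) atTop (𝓝 0))
    (hgm : Measurable g) (hg0 : ∀ x, 0 ≤ g x) (hg : Integrable g μ)
    (hg2 : Integrable (fun x => g x ^ 2) μ) {B : ℕ → Set X}
    {C : ℝ} (hC : 0 < C)
    (hB : ∀ j : ℕ, (2 : ℝ) ^ j * μ.real (B j) ≤ C * ∫ x in {x | (2 : ℝ) ^ j / 2 < g x}, g x ∂μ)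
    {s t : ℝ} (hs : 0 ≤ s) (ht : 0 ≤ t) {ε : ℝ} (hε : 0 < ε) :
    ∃ᶠ j : ℕ in atTop, (2 : ℝ) ^ j * ∫ x in B j, (s + t * a x) * g x ∂μ ≤ ε := by
  set b : ℕ → ℝ := fun j => (2 : ℝ) ^ j * ∫ x in {x | (2 : ℝ) ^ j / 2 < g x}, g x ∂μ with hbdef
  have hb0 : ∀ j, 0 ≤ b j := fun j => mul_nonneg (by positivity) (integral_nonneg fun x => hg0 x)
  have hbs : Summable b := summable_setIntegral_gt hgm hg0 hg hg2
  have hag : Integrable (fun x => a x * g x) μ := by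
    refine (ha2.add hg2).mono' (ham.mul hgm).aestronglyMeasurable (Eventually.of_forall fun x => ?_)
    rw [Real.norm_of_nonneg (mul_nonneg (ha0 x) (hg0 x))]
    simp only [Pi.add_apply]
    nlinarith [sq_nonneg (a x - g x), sq_nonneg (a x), sq_nonneg (g x)]
  -- On `B j` either `g` exceeds `2 ^ j / 2`, which is counted in `b j`, or it is at most `2 ^ j /
  -- 2`, and then the measure bound on `B j` applies.
  have hBg : ∀ j : ℕ, (2 : ℝ) ^ j * ∫ x in B j, g x ∂μ ≤ (1 + C / 2) * b j := fun j => by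
    have hms : MeasurableSet {x | (2 : ℝ) ^ j / 2 < g x} := measurableSet_lt measurable_const hgm
    have h1 : ∫ x in B j, g x ∂μ ≤
        ∫ x in {x | (2 : ℝ) ^ j / 2 < g x}, g x ∂μ + 2 ^ j / 2 * μ.real (B j) := by
      calc ∫ x in B j, g x ∂μ
          ≤ ∫ x in B j, (indicator {x | (2 : ℝ) ^ j / 2 < g x} g x + 2 ^ j / 2) ∂μ := by
            refine integral_mono hg.integrableOn
              ((hg.indicator hms).integrableOn.add (integrable_const _)) fun x => ?_
            by_cases hx : x ∈ {x | (2 : ℝ) ^ j / 2 < g x}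
            · simp only [indicator_of_mem hx]
              have : (0 : ℝ) < 2 ^ j := by positivity
              linarith
            · simp only [indicator_of_notMem hx]
              simp only [mem_ofPred_eq, not_lt] at hx
              linarith
        _ = ∫ x in B j, indicator {x | (2 : ℝ) ^ j / 2 < g x} g x ∂μ + 2 ^ j / 2 * μ.real (B j) := by
            rw [integral_add (hg.indicator hms).integrableOn (integrable_const _),
              setIntegral_const, smul_eq_mul]
            ring
        _ ≤ _ := by
            have : ∫ x in B j, indicator {x | (2 : ℝ) ^ j / 2 < g x} g x ∂μ ≤
                ∫ x, indicator {x | (2 : ℝ) ^ j / 2 < g x} g x ∂μ :=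
              setIntegral_le_integral (hg.indicator hms) (Eventually.of_forall fun x =>
                indicator_nonneg (fun x _ => hg0 x) x)
            rw [integral_indicator (μ := μ) hms] at this
            linarith
    have h2 : (0 : ℝ) ≤ 2 ^ j := by positivity
    calc _ ≤ (2 : ℝ) ^ j * (∫ x in {x | (2 : ℝ) ^ j / 2 < g x}, g x ∂μ +
          1 / 2 * (C * ∫ x in {x | (2 : ℝ) ^ j / 2 < g x}, g x ∂μ)) := by
          refine mul_le_mul_of_nonneg_left (h1.trans ?_) h2
          linarith [hB j]
      _ = _ := by simp only [hbdef]; ring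
  set K : ℝ := 1 + C / 2 with hK
  have hKpos : 0 < K := by positivity
  have h4 := tendsto_four_pow_mul_setIntegral ham ha0 ha2 hLp
  have h5 : Tendsto (fun j : ℕ => ∫ x in {x | (j : ℝ) < a x}, g x ^ 2 ∂μ) atTop (𝓝 0) := by
    have hms : ∀ j : ℕ, MeasurableSet {x | (j : ℝ) < a x} := fun j =>
      measurableSet_lt measurable_const ham
    have h0 : ∫ _, (0 : ℝ) ∂μ = 0 := by simp
    simp_rw [← integral_indicator (hms _)]
    rw [← h0]
    refine tendsto_integral_of_dominated_convergence (fun x => ‖g x ^ 2‖)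
      (fun n => hg2.1.indicator (hms n)) hg2.norm
      (fun n => Eventually.of_forall fun x => norm_indicator_le_norm_self _ _)
      (Eventually.of_forall fun x => ?_)
    refine tendsto_const_nhds.congr' ?_
    filter_upwards [tendsto_natCast_atTop_atTop.eventually_ge_atTop (a x)] with n hn
    rw [indicator_of_notMem]
    simp only [mem_ofPred_eq, not_lt]
    exact hn
  have h6 : Tendsto (fun j : ℕ => s * (K * b j) + t * ((4 : ℝ) ^ j *
      ∫ x in {x | (j : ℝ) < a x}, a x ^ 2 ∂μ + ∫ x in {x | (j : ℝ) < a x}, g x ^ 2 ∂μ))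
      atTop (𝓝 0) := by
    simpa using ((hbs.tendsto_atTop_zero.const_mul K).const_mul s).add ((h4.add h5).const_mul t)
  -- This tolerance for `j b_j` leaves at most `ε / 2` for the contribution `t K j b_j`. The
  -- remaining terms tend to zero along all `j` and take the other half.
  have hδ : 0 < ε / 2 / (t * K + 1) := by positivity
  have h7 := (frequently_mul_le_of_summable hbs hδ).and_eventually
    (h6.eventually (gt_mem_nhds (half_pos hε)))
  refine h7.mono fun j ⟨h8, h9⟩ => ?_
  have hms : MeasurableSet {x | (j : ℝ) < a x} := measurableSet_lt measurable_const ham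
  -- Split at `a = j`. Below, `s + t a ≤ s + t j`; above, the excess is absorbed by `2 ^ j a g ≤ 4 ^
  -- j a² + g²`.
  have h10 : (2 : ℝ) ^ j * ∫ x in B j, (s + t * a x) * g x ∂μ ≤
      (s + t * j) * ((2 : ℝ) ^ j * ∫ x in B j, g x ∂μ) + t * ((4 : ℝ) ^ j *
      ∫ x in {x | (j : ℝ) < a x}, a x ^ 2 ∂μ + ∫ x in {x | (j : ℝ) < a x}, g x ^ 2 ∂μ) := by
    have hi1 : Integrable (fun x => (s + t * a x) * g x) μ := by
      refine ((hg.const_mul s).add (hag.const_mul t)).congr (Eventually.of_forall fun x => ?_)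
      simp only [Pi.add_apply]; ring
    have hi2 : Integrable (fun x => (s + t * j) * ((2 : ℝ) ^ j * g x)) μ :=
      (hg.const_mul _).const_mul _
    have hi3 : Integrable (fun x => (4 : ℝ) ^ j * a x ^ 2 + g x ^ 2) μ := (ha2.const_mul _).add hg2
    calc (2 : ℝ) ^ j * ∫ x in B j, (s + t * a x) * g x ∂μ
        = ∫ x in B j, (2 : ℝ) ^ j * ((s + t * a x) * g x) ∂μ := (integral_const_mul _ _).symm
      _ ≤ ∫ x in B j, ((s + t * j) * ((2 : ℝ) ^ j * g x) +
          indicator {x | (j : ℝ) < a x} (fun x => t * ((4 : ℝ) ^ j * a x ^ 2 + g x ^ 2)) x) ∂μ := by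
          refine integral_mono (hi1.const_mul _).integrableOn
            (hi2.add ((hi3.const_mul t).indicator hms)).integrableOn fun x => ?_
          have h2j : (0 : ℝ) ≤ 2 ^ j * g x := mul_nonneg (by positivity) (hg0 x)
          by_cases hx : x ∈ {x | (j : ℝ) < a x}
          · simp only [indicator_of_mem hx]
            have h44 : (4 : ℝ) ^ j = 2 ^ j * 2 ^ j := by rw [← mul_pow]; norm_num
            have h11 : (2 : ℝ) ^ j * a x * g x ≤ 4 ^ j * a x ^ 2 + g x ^ 2 := by
              rw [h44]
              nlinarith [sq_nonneg ((2 : ℝ) ^ j * a x - g x), sq_nonneg ((2 : ℝ) ^ j * a x),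
                sq_nonneg (g x)]
            have h12 := mul_le_mul_of_nonneg_left h11 ht
            have h13 : 0 ≤ t * j * ((2 : ℝ) ^ j * g x) := by positivity
            nlinarith
          · simp only [indicator_of_notMem hx]
            simp only [mem_ofPred_eq, not_lt] at hx
            have := mul_le_mul_of_nonneg_left hx ht
            nlinarith [mul_le_mul_of_nonneg_right this h2j]
      _ = (s + t * j) * ((2 : ℝ) ^ j * ∫ x in B j, g x ∂μ) + ∫ x in B j,
          indicator {x | (j : ℝ) < a x} (fun x => t * ((4 : ℝ) ^ j * a x ^ 2 + g x ^ 2)) x ∂μ := by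
          rw [integral_add hi2.integrableOn ((hi3.const_mul t).indicator hms).integrableOn,
            integral_const_mul, integral_const_mul]
      _ ≤ (s + t * j) * ((2 : ℝ) ^ j * ∫ x in B j, g x ∂μ) +
          ∫ x, indicator {x | (j : ℝ) < a x} (fun x => t * ((4 : ℝ) ^ j * a x ^ 2 + g x ^ 2)) x ∂μ := by
          have := setIntegral_le_integral (s := B j) ((hi3.const_mul t).indicator hms)
            (Eventually.of_forall fun x => indicator_nonneg (fun x _ =>
              mul_nonneg ht (by positivity)) x)
          linarith
      _ = _ := by
          rw [integral_indicator hms, integral_const_mul,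
            integral_add (ha2.const_mul _).integrableOn hg2.integrableOn, integral_const_mul]
  have hj0 : (0 : ℝ) ≤ j := j.cast_nonneg
  have h14 : t * (K * (j * b j)) ≤ ε / 2 := by
    have : t * K * (j * b j) ≤ (t * K + 1) * (ε / 2 / (t * K + 1)) :=
      mul_le_mul (by linarith) h8 (mul_nonneg hj0 (hb0 j)) (by positivity)
    rw [mul_div_cancel₀ _ (by positivity)] at this
    linarith
  have h15 := mul_le_mul_of_nonneg_left (hBg j) (show 0 ≤ s + t * j by positivity)
  nlinarith

end Levels

/-! ### Matrix fields -/

section MatrixFields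

variable {N : ℕ} {Ω : TopologicalSpace.Opens (Rn N)}

/-- The product of a matrix and a vector of `ℝ^N` as a continuous bilinear map. -/
def mulVecL : Mat N →L[ℝ] Rn N →L[ℝ] Rn N :=
  LinearMap.toContinuousLinearMap
    ((LinearMap.toContinuousLinearMap : (Rn N →ₗ[ℝ] Rn N) ≃ₗ[ℝ] (Rn N →L[ℝ] Rn N)).toLinearMap ∘ₗ
      (Matrix.toLpLin 2 2).toLinearMap)

theorem form_eq_inner (M : Mat N) (ξ η : Rn N) : form M ξ η = inner ℝ (mulVecL M η) ξ := by
  rw [EuclideanSpace.inner_eq_star_dotProduct]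
  rfl

theorem form_transpose (M : Mat N) (ξ η : Rn N) : form Mᵀ ξ η = form M η ξ := by
  simp only [form]
  rw [Matrix.mulVec_transpose, dotProduct_comm, Matrix.dotProduct_mulVec]

theorem form_add_left (M : Mat N) (ξ ξ' η : Rn N) :
    form M (ξ + ξ') η = form M ξ η + form M ξ' η := by
  simp only [form_eq_inner, inner_add_right]

theorem form_add_right (M : Mat N) (ξ η η' : Rn N) :
    form M ξ (η + η') = form M ξ η + form M ξ η' := by
  simp only [form_eq_inner, map_add, inner_add_left]

theorem form_sub_left (M : Mat N) (ξ ξ' η : Rn N) :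
    form M (ξ - ξ') η = form M ξ η - form M ξ' η := by
  simp only [form_eq_inner, inner_sub_right]

theorem form_sub_right (M : Mat N) (ξ η η' : Rn N) :
    form M ξ (η - η') = form M ξ η - form M ξ η' := by
  simp only [form_eq_inner, map_sub, inner_sub_left]

theorem form_smul_left (M : Mat N) (c : ℝ) (ξ η : Rn N) :
    form M (c • ξ) η = c * form M ξ η := by
  simp only [form_eq_inner, inner_smul_right]

theorem form_smul_right (M : Mat N) (c : ℝ) (ξ η : Rn N) :
    form M ξ (c • η) = c * form M ξ η := by
  simp only [form_eq_inner, map_smul, real_inner_smul_left]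

theorem form_add (M M' : Mat N) (ξ η : Rn N) : form (M + M') ξ η = form M ξ η + form M' ξ η := by
  simp only [form_eq_inner, map_add, _root_.add_apply, inner_add_left]

theorem form_sub (M M' : Mat N) (ξ η : Rn N) : form (M - M') ξ η = form M ξ η - form M' ξ η := by
  simp only [form_eq_inner, map_sub, _root_.sub_apply, inner_sub_left]

theorem form_smul (c : ℝ) (M : Mat N) (ξ η : Rn N) : form (c • M) ξ η = c * form M ξ η := by
  simp only [form_eq_inner, map_smul, _root_.smul_apply, real_inner_smul_left]

theorem form_symPart (M : Mat N) (ξ η : Rn N) :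
    form (symPart M) ξ η = (form M ξ η + form M η ξ) / 2 := by
  rw [symPart, form_smul, form_add, form_transpose]; ring

theorem form_skewPart (M : Mat N) (ξ η : Rn N) :
    form (skewPart M) ξ η = (form M ξ η - form M η ξ) / 2 := by
  rw [skewPart, form_smul, form_sub, form_transpose]; ring

theorem form_symPart_comm (M : Mat N) (ξ η : Rn N) :
    form (symPart M) ξ η = form (symPart M) η ξ := by
  rw [form_symPart, form_symPart]; ring

theorem form_skewPart_swap (M : Mat N) (ξ η : Rn N) :
    form (skewPart M) ξ η = -form (skewPart M) η ξ := by
  rw [form_skewPart, form_skewPart]; ring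

theorem symPart_add_skewPart (M : Mat N) : symPart M + skewPart M = M := by
  rw [symPart, skewPart, ← smul_add, add_add_sub_cancel, ← two_smul ℝ M, smul_smul]
  norm_num

theorem symPart_sub_skewPart (M : Mat N) : symPart M - skewPart M = Mᵀ := by
  rw [symPart, skewPart, ← smul_sub, add_sub_sub_cancel, ← two_smul ℝ Mᵀ, smul_smul]
  norm_num

theorem norm_mulVecL_le (M : Mat N) (η : Rn N) :
    ‖mulVecL M η‖ ≤ (N : ℝ) ^ 2 * ‖M‖ * ‖η‖ := by
  set ζ := mulVecL M η with hζ
  have h1 : ‖ζ‖ ^ 2 = ∑ i, ∑ j, ζ i * (M i j * η j) := by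
    rw [← real_inner_self_eq_norm_sq, hζ, ← form_eq_inner, ← hζ]
    simp only [form, dotProduct, Matrix.mulVec, Finset.mul_sum]
  have h2 : ‖ζ‖ * ‖ζ‖ ≤ ‖ζ‖ * ((N : ℝ) ^ 2 * ‖M‖ * ‖η‖) := by
    calc ‖ζ‖ * ‖ζ‖ = ∑ i, ∑ j, ζ i * (M i j * η j) := by rw [← h1, sq]
      _ ≤ ∑ _i : Fin N, ∑ _j : Fin N, ‖ζ‖ * (‖M‖ * ‖η‖) := by
          refine Finset.sum_le_sum fun i _ => Finset.sum_le_sum fun j _ => ?_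
          refine (le_abs_self _).trans ?_
          rw [abs_mul, abs_mul]
          exact mul_le_mul (PiLp.norm_apply_le ζ i) (mul_le_mul (Matrix.norm_entry_le_entrywise_sup_norm M)
            (PiLp.norm_apply_le η j) (abs_nonneg _) (norm_nonneg _)) (by positivity) (norm_nonneg _)
      _ = _ := by simp; ring
  rcases (norm_nonneg ζ).eq_or_lt with h0 | h0
  · rw [← h0]; positivity
  · exact le_of_mul_le_mul_left h2 h0

/-- For a symmetric form between `0` and `β`, polarisation at `ζ = Sη` and `β η` gives `4 β |ζ|² =
q(ζ + βη) - q(ζ - βη) ≤ β |ζ + βη|²`, and the parallelogram law finishes. Thus ellipticity alone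
makes the symmetric part bounded by `β`. -/
theorem norm_mulVecL_symPart_le {M : Mat N} {α β : ℝ} (hα : 0 < α)
    (hM : ∀ ξ : Rn N, α * ‖ξ‖ ^ 2 ≤ form (symPart M) ξ ξ ∧ form (symPart M) ξ ξ ≤ β * ‖ξ‖ ^ 2)
    (hαβ : α ≤ β) (η : Rn N) : ‖mulVecL (symPart M) η‖ ≤ β * ‖η‖ := by
  have hβ : 0 < β := hα.trans_le hαβ
  set ζ := mulVecL (symPart M) η with hζ
  have h1 : form (symPart M) ζ η = ‖ζ‖ ^ 2 := by
    rw [form_eq_inner, ← hζ, real_inner_self_eq_norm_sq]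
  have h2 := (hM (ζ + β • η)).2
  have h3 := (hM (ζ - β • η)).1
  have h4 : 0 ≤ form (symPart M) (ζ - β • η) (ζ - β • η) := le_trans (by positivity) h3
  have h5 : ‖ζ + β • η‖ ^ 2 + ‖ζ - β • η‖ ^ 2 = 2 * (‖ζ‖ ^ 2 + β ^ 2 * ‖η‖ ^ 2) := by
    have := parallelogram_law_with_norm ℝ ζ (β • η)
    rw [norm_smul, Real.norm_of_nonneg hβ.le] at this
    nlinarith
  have h6 : form (symPart M) (ζ + β • η) (ζ + β • η) - form (symPart M) (ζ - β • η) (ζ - β • η) =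
      4 * β * ‖ζ‖ ^ 2 := by
    simp only [form_add_left, form_add_right, form_sub_left, form_sub_right, form_smul_left,
      form_smul_right, form_symPart_comm M η ζ, h1]
    ring
  have h8 : 4 * β * ‖ζ‖ ^ 2 ≤ β * (2 * (‖ζ‖ ^ 2 + β ^ 2 * ‖η‖ ^ 2)) := by
    rw [← h5, ← h6]
    nlinarith [sq_nonneg ‖ζ - β • η‖]
  have h9 : ‖ζ‖ ^ 2 ≤ (β * ‖η‖) ^ 2 := by
    have : 4 * ‖ζ‖ ^ 2 ≤ 2 * (‖ζ‖ ^ 2 + β ^ 2 * ‖η‖ ^ 2) := by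
      refine le_of_mul_le_mul_left ?_ hβ
      linarith
    nlinarith
  exact (sq_le_sq₀ (norm_nonneg _) (by positivity)).1 h9

theorem continuous_skewPart : Continuous (skewPart : Mat N → Mat N) :=
  (skewPartL (N := N)).continuous

theorem memLp_skewPart (A : L2Mat Ω) : MemLp (fun x => skewPart (A x)) 2 (vol Ω) :=
  (skewPartL (N := N)).comp_memLp' (Lp.memLp A)

theorem memLp_symPart (A : L2Mat Ω) : MemLp (fun x => symPart (A x)) 2 (vol Ω) := by
  have : (fun x => symPart (A x)) = fun x => A x - skewPart (A x) := by
    funext x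
    rw [eq_sub_iff_add_eq, symPart_add_skewPart]
  rw [this]
  exact (Lp.memLp A).sub (memLp_skewPart A)

theorem integrable_mulVecL {F : Rn N → Mat N} (hF : MemLp F 2 (vol Ω)) {v : Rn N → Rn N}
    (hv : MemLp v 2 (vol Ω)) : Integrable (fun x => mulVecL (F x) (v x)) (vol Ω) := by
  refine Integrable.mono' ((hF.norm.integrable_mul hv.norm).const_mul ((N : ℝ) ^ 2))
    (mulVecL.aestronglyMeasurable_comp₂ hF.1 hv.1) (Eventually.of_forall fun x => ?_)
  refine (norm_mulVecL_le _ _).trans_eq ?_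
  simp only [Pi.mul_apply]
  ring

/-- Uniqueness for the adjoint problem when the `L^p` norms of the skew-symmetric part of the
coefficients are `o(p)`. -/
theorem eq_zero_of_adjoint_eq_zero [Nontrivial (Rn N)]
    (hΩ : Bornology.IsBounded (Ω : Set (Rn N))) (hΩl : HasLipschitzBoundary (Ω : Set (Rn N)))
    {α β : ℝ} (hα : 0 < α) (hαβ : α ≤ β) {A : L2Mat Ω}
    (hA : ∀ᵐ x ∂(vol Ω), ∀ ξ : Rn N,
      α * ‖ξ‖ ^ 2 ≤ form (symPart (A x)) ξ ξ ∧ form (symPart (A x)) ξ ξ ≤ β * ‖ξ‖ ^ 2)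
    (hLp : Tendsto (fun p : ℝ => eLpNorm (fun x => skewPart (A x)) (ENNReal.ofReal p) (vol Ω) /
      ENNReal.ofReal p) atTop (𝓝 0)) {u : H10 Ω}
    (hu : ∀ φ : 𝓓(Ω, ℝ),
      ∫ x, form (A x)ᵀ (∇ (φ : Rn N → ℝ) x) (wgrad u x) ∂(vol Ω) = 0) : u = 0 := by
  have hfin := isFiniteMeasure_vol hΩ
  have hβ : 0 < β := hα.trans_le hαβ
  set K : ℝ := (N : ℝ) ^ 2 with hK
  have hK0 : 0 ≤ K := by positivity
  set a : Rn N → ℝ := fun x => ‖skewPart (A x)‖ with hadef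
  have ha0 : ∀ x, 0 ≤ a x := fun x => norm_nonneg _
  have ham : Measurable a :=
    (continuous_skewPart.comp_stronglyMeasurable (Lp.stronglyMeasurable A)).norm.measurable
  have ha2 : Integrable (fun x => a x ^ 2) (vol Ω) := (memLp_skewPart A).norm.integrable_sq
  have hLp' : Tendsto (fun p : ℝ => eLpNorm a (ENNReal.ofReal p) (vol Ω) /
      ENNReal.ofReal p) atTop (𝓝 0) := by
    simpa only [hadef, eLpNorm_norm] using hLp
  set g : Rn N → ℝ := fun x => ‖wgrad u x‖ with hgdef
  have hg0 : ∀ x, 0 ≤ g x := fun x => norm_nonneg _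
  have hgm : Measurable g := measurable_norm_wgrad u
  have hg : Integrable g (vol Ω) := integrable_norm_wgrad hΩ u
  have hg2 : Integrable (fun x => g x ^ 2) (vol Ω) := integrable_norm_sq_wgrad u
  have hag : Integrable (fun x => a x * g x) (vol Ω) :=
    (memLp_skewPart A).norm.integrable_mul (Lp.memLp (wgrad u)).norm
  set h : Rn N → Rn N := fun x => mulVecL (A x)ᵀ (wgrad u x) with hhdef
  have hsplit : ∀ x, h x = mulVecL (symPart (A x)) (wgrad u x) -
      mulVecL (skewPart (A x)) (wgrad u x) := fun x => by
    rw [← _root_.sub_apply, ← map_sub, symPart_sub_skewPart]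
  have hh : Integrable h (vol Ω) :=
    ((integrable_mulVecL (memLp_symPart A) (Lp.memLp (wgrad u))).sub
      (integrable_mulVecL (memLp_skewPart A) (Lp.memLp (wgrad u)))).congr
      (Eventually.of_forall fun x => (hsplit x).symm)
  have hhb : ∀ᵐ x ∂(vol Ω), ‖h x‖ ≤ (β + K * a x) * g x := by
    filter_upwards [hA] with x hx
    rw [hsplit]
    refine (norm_sub_le _ _).trans ?_
    have h1 := norm_mulVecL_symPart_le hα hx hαβ (wgrad u x)
    have h2 := norm_mulVecL_le (skewPart (A x)) (wgrad u x)
    rw [add_mul]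
    exact add_le_add h1 h2
  -- The skew part drops out on the diagonal, so the full coefficient matrix is still coercive
  -- pointwise.
  have hhu : ∀ᵐ x ∂(vol Ω), α * g x ^ 2 ≤ inner ℝ (h x) (wgrad u x) := by
    filter_upwards [hA] with x hx
    rw [← form_eq_inner, form_transpose]
    have h1 := (hx (wgrad u x)).1
    rw [form_symPart] at h1
    linarith
  obtain ⟨C, V, B, hC, hBm, hVt, hVC, hVB, hB, hB0⟩ := exists_truncation_seq hΩ hΩl u
    (L := fun j => (2 : ℝ) ^ j) (fun j => by positivity)
    (tendsto_pow_atTop_atTop_of_one_lt one_lt_two)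
  -- Testability with the zero functional: the homogeneous equation extends from test functions to
  -- the truncations although `h` is only integrable.
  have hzero : ∀ j, ∫ x, inner ℝ (h x) (wgrad (V j) x) ∂(vol Ω) = 0 := fun j => by
    have := hVt j h hh 0 fun φ => by
      rw [_root_.zero_apply, ← hu φ]
      simp only [form_eq_inner, hhdef]
    rw [← this]
    rfl
  have hi1 : Integrable (fun x => (β + K * a x) * g x) (vol Ω) := by
    refine ((hg.const_mul β).add (hag.const_mul K)).congr (Eventually.of_forall fun x => ?_)
    simp only [Pi.add_apply]; ring
  -- Off `B j` the integrand `(h, ∇V_j)` equals `(h, ∇u) ≥ α g²`. On `B j` it is bounded below using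
  -- `|∇V_j| ≤ C 2 ^ j`, and the missing `α g²` is added back.
  have hmain : ∀ j, α * ∫ x, g x ^ 2 ∂(vol Ω) ≤
      C * ((2 : ℝ) ^ j * ∫ x in B j, (β + K * a x) * g x ∂(vol Ω)) +
        α * ∫ x in B j, g x ^ 2 ∂(vol Ω) := fun j => by
    have hiV : Integrable (fun x => (inner ℝ (h x) (wgrad (V j) x) : ℝ)) (vol Ω) := by
      refine (hh.norm.mul_const (C * 2 ^ j)).mono'
        (hh.1.inner (Lp.aestronglyMeasurable _)) ?_
      filter_upwards [hVC j] with x hx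
      exact (abs_real_inner_le_norm _ _).trans (mul_le_mul_of_nonneg_left hx (norm_nonneg _))
    have hi2 : Integrable (fun x => C * 2 ^ j * ((β + K * a x) * g x) + α * g x ^ 2) (vol Ω) :=
      (hi1.const_mul _).add (hg2.const_mul _)
    have h1 : ∫ x, α * g x ^ 2 ∂(vol Ω) ≤ ∫ x, (inner ℝ (h x) (wgrad (V j) x) + indicator (B j)
        (fun x => C * 2 ^ j * ((β + K * a x) * g x) + α * g x ^ 2) x) ∂(vol Ω) := by
      refine integral_mono_ae (hg2.const_mul α) (hiV.add (hi2.indicator (hBm j))) ?_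
      filter_upwards [hhb, hhu, hVC j, hVB j] with x h2 h3 h4 h5
      by_cases hx : x ∈ B j
      · simp only [indicator_of_mem hx]
        have h6 := (abs_le.1 (abs_real_inner_le_norm (h x) (wgrad (V j) x))).1
        have h7 : ‖h x‖ * ‖wgrad (V j) x‖ ≤ ((β + K * a x) * g x) * (C * 2 ^ j) :=
          mul_le_mul h2 h4 (norm_nonneg _) ((norm_nonneg _).trans h2)
        linarith
      · simp only [indicator_of_notMem hx, add_zero, h5 hx]
        exact h3
    rw [integral_add hiV (hi2.indicator (hBm j)), hzero, zero_add, integral_indicator (hBm j),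
      integral_add (hi1.const_mul _).integrableOn (hg2.const_mul _).integrableOn,
      integral_const_mul, integral_const_mul, integral_const_mul] at h1
    linarith
  have hle : ∫ x, g x ^ 2 ∂(vol Ω) ≤ 0 := by
    by_contra! hpos
    set ε : ℝ := α * ∫ x, g x ^ 2 ∂(vol Ω) with hε
    have hεpos : 0 < ε := mul_pos hα hpos
    have h1 := frequently_truncation_error_le ham ha0 ha2 hLp' hgm hg0 hg hg2 hC hB hβ.le hK0
      (show 0 < ε / 3 / C by positivity)
    have h2 := ((hg2.tendsto_setIntegral_nhds_zero hB0).const_mul α).eventually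
      (gt_mem_nhds (show α * 0 < ε / 3 by linarith))
    obtain ⟨j, h3, h4⟩ := (h1.and_eventually h2).exists
    have h5 := hmain j
    have h6 : C * ((2 : ℝ) ^ j * ∫ x in B j, (β + K * a x) * g x ∂(vol Ω)) ≤ ε / 3 := by
      calc _ ≤ C * (ε / 3 / C) := mul_le_mul_of_nonneg_left h3 hC.le
        _ = _ := by field_simp
    linarith
  refine eq_zero_of_wgrad_eq_zero hΩ hΩl ?_
  have h7 : ∫ x, g x ^ 2 ∂(vol Ω) = 0 := le_antisymm hle (integral_nonneg fun x => sq_nonneg _)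
  rw [integral_eq_zero_iff_of_nonneg (fun x => sq_nonneg _) hg2] at h7
  filter_upwards [h7] with x hx
  simpa [hgdef] using hx

end MatrixFields

/-! ### The forms generated by the symmetric and skew-symmetric parts -/

section Forms

variable {N : ℕ} {Ω : TopologicalSpace.Opens (Rn N)}

theorem skewForm_add (A : L2Mat Ω) (y : H10 Ω) (φ ψ : 𝓓(Ω, ℝ)) :
    skewForm A y (φ + ψ) = skewForm A y φ + skewForm A y ψ := by
  rw [skewForm, skewForm, skewForm,
    ← integral_add (integrable_skewForm A y φ) (integrable_skewForm A y ψ), gradient_test_add]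
  simp only [Pi.add_apply, form_add_left]

theorem skewForm_smul (A : L2Mat Ω) (y : H10 Ω) (c : ℝ) (φ : 𝓓(Ω, ℝ)) :
    skewForm A y (c • φ) = c * skewForm A y φ := by
  rw [skewForm, skewForm, ← integral_const_mul, gradient_test_smul]
  simp only [Pi.smul_apply, form_smul_left]

theorem sqrt_integral_gradient_eq (φ : 𝓓(Ω, ℝ)) :
    √(∫ x, ‖∇ (φ : Rn N → ℝ) x‖ ^ 2 ∂(vol Ω)) = ‖wgrad (testH10 Ω φ)‖ := by
  rw [Real.sqrt_eq_iff_eq_sq (integral_nonneg fun x => sq_nonneg _) (norm_nonneg _),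
    norm_sq_L2_eq]
  refine integral_congr_ae ?_
  filter_upwards [wgrad_test_ae φ] with x hx
  rw [hx]

theorem tendsto_skewForm_bracket {A : L2Mat Ω} {y p : H10 Ω} (hy : y ∈ D A) {φ : ℕ → 𝓓(Ω, ℝ)}
    (hφ : Tendsto (fun k => testH10 Ω (φ k)) atTop (𝓝 p)) :
    Tendsto (fun k => skewForm A y (φ k)) atTop (𝓝 (bracket A y p)) :=
  (tendsto_bracket hy p).comp (tendsto_comap_iff.2 hφ)

theorem exists_abs_bracket_le {A : L2Mat Ω} {y : H10 Ω} (hy : y ∈ D A) :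
    ∃ C : ℝ, 0 ≤ C ∧ ∀ p, |bracket A y p| ≤ C * ‖wgrad p‖ := by
  obtain ⟨C, hC⟩ := id hy
  refine ⟨|C|, abs_nonneg _, fun p => ?_⟩
  obtain ⟨φ, hφ⟩ := exists_seq_test_tendsto p
  have h1 := (tendsto_skewForm_bracket hy hφ).abs
  have h2 : Tendsto (fun k => |C| * ‖wgrad (testH10 Ω (φ k))‖) atTop (𝓝 (|C| * ‖wgrad p‖)) :=
    ((((wgradL Ω).continuous.tendsto p).comp hφ).norm).const_mul |C|
  refine le_of_tendsto_of_tendsto' h1 h2 fun k => ?_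
  refine (hC _).trans ?_
  rw [sqrt_integral_gradient_eq]
  exact mul_le_mul_of_nonneg_right (le_abs_self C) (norm_nonneg _)

/-- The functional `p ↦ [y, p]_A` for `y ∈ D(A)`. -/
def bracketL {A : L2Mat Ω} {y : H10 Ω} (hy : y ∈ D A) : StrongDual ℝ (H10 Ω) :=
  LinearMap.mkContinuousOfExistsBound
    { toFun := bracket A y
      map_add' := fun p q => by
        obtain ⟨φ, hφ⟩ := exists_seq_test_tendsto p
        obtain ⟨χ, hχ⟩ := exists_seq_test_tendsto q
        have h1 : Tendsto (fun k => testH10 Ω (φ k + χ k)) atTop (𝓝 (p + q)) := by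
          simpa only [map_add] using hφ.add hχ
        have h2 := (tendsto_skewForm_bracket hy hφ).add (tendsto_skewForm_bracket hy hχ)
        simp only [← skewForm_add] at h2
        exact tendsto_nhds_unique (tendsto_skewForm_bracket hy h1) h2
      map_smul' := fun c p => by
        obtain ⟨φ, hφ⟩ := exists_seq_test_tendsto p
        have h1 : Tendsto (fun k => testH10 Ω (c • φ k)) atTop (𝓝 (c • p)) := by
          simpa only [map_smul] using hφ.const_smul c
        have h2 := (tendsto_skewForm_bracket hy hφ).const_mul c
        simp only [← skewForm_smul] at h2
        exact tendsto_nhds_unique (tendsto_skewForm_bracket hy h1) h2 }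
    (by
      obtain ⟨C, hC0, hC⟩ := exists_abs_bracket_le hy
      exact ⟨C, fun p => (hC p).trans (mul_le_mul_of_nonneg_left (norm_wgrad_le p) hC0)⟩)

theorem bracketL_apply {A : L2Mat Ω} {y : H10 Ω} (hy : y ∈ D A) (p : H10 Ω) :
    bracketL hy p = bracket A y p := rfl

theorem bracket_testH10 {A : L2Mat Ω} {y : H10 Ω} (hy : y ∈ D A) (φ : 𝓓(Ω, ℝ)) :
    bracket A y (testH10 Ω φ) = skewForm A y φ :=
  tendsto_nhds_unique (tendsto_skewForm_bracket hy (φ := fun _ => φ) tendsto_const_nhds)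
    tendsto_const_nhds

theorem symPart_add (M M' : Mat N) : symPart (M + M') = symPart M + symPart M' := by
  simp only [symPart, Matrix.transpose_add, ← smul_add]
  congr 1
  abel

theorem symPart_smul (c : ℝ) (M : Mat N) : symPart (c • M) = c • symPart M := by
  simp only [symPart, Matrix.transpose_smul, ← smul_add]
  rw [smul_comm]

theorem skewPart_add (M M' : Mat N) : skewPart (M + M') = skewPart M + skewPart M' :=
  map_add skewPartL M M'

theorem skewPart_smul (c : ℝ) (M : Mat N) : skewPart (c • M) = c • skewPart M :=
  map_smul skewPartL c M

theorem controlPath_ae (A B : L2Mat Ω) (θ : ℝ) :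
    ∀ᵐ x ∂(vol Ω), controlPath A B θ x = (1 - θ) • A x + θ • B x := by
  filter_upwards [Lp.coeFn_add A (θ • (B - A)), Lp.coeFn_smul θ (B - A), Lp.coeFn_sub B A]
    with x h1 h2 h3
  rw [controlPath, h1, Pi.add_apply, h2, Pi.smul_apply, h3, Pi.sub_apply, smul_sub, sub_smul,
    one_smul]
  abel

theorem skewForm_controlPath (A B : L2Mat Ω) (θ : ℝ) (y : H10 Ω) (φ : 𝓓(Ω, ℝ)) :
    skewForm (controlPath A B θ) y φ = (1 - θ) * skewForm A y φ + θ * skewForm B y φ := by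
  simp only [skewForm]
  rw [← integral_const_mul, ← integral_const_mul,
    ← integral_add ((integrable_skewForm A y φ).const_mul _)
      ((integrable_skewForm B y φ).const_mul _)]
  refine integral_congr_ae ?_
  filter_upwards [controlPath_ae A B θ] with x hx
  rw [hx, skewPart_add, skewPart_smul, skewPart_smul, form_add, form_smul, form_smul]

theorem bracket_controlPath {A B : L2Mat Ω} {θ : ℝ} {y : H10 Ω} (hA : y ∈ D A) (hB : y ∈ D B)
    (hAB : y ∈ D (controlPath A B θ)) (p : H10 Ω) :
    bracket (controlPath A B θ) y p = (1 - θ) * bracket A y p + θ * bracket B y p := by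
  obtain ⟨φ, hφ⟩ := exists_seq_test_tendsto p
  refine tendsto_nhds_unique (tendsto_skewForm_bracket hAB hφ) ?_
  simp only [skewForm_controlPath]
  exact ((tendsto_skewForm_bracket hA hφ).const_mul _).add
    ((tendsto_skewForm_bracket hB hφ).const_mul _)

theorem norm_skewPart_le {A Astar : Mat N} (h : ∀ i j, i < j → |skewPart A i j| ≤ |Astar i j|) :
    ‖skewPart A‖ ≤ ‖Astar‖ := by
  have hskew : ∀ i j, skewPart A i j = -skewPart A j i := fun i j => by
    simp [skewPart]; ring
  rw [Matrix.norm_le_iff (norm_nonneg _)]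
  intro i j
  rw [Real.norm_eq_abs]
  rcases lt_trichotomy i j with hij | hij | hij
  · exact (h i j hij).trans (Matrix.norm_entry_le_entrywise_sup_norm Astar)
  · subst hij
    have : skewPart A i i = 0 := by linarith [hskew i i]
    rw [this, abs_zero]
    exact norm_nonneg _
  · rw [hskew, abs_neg]
    exact (h j i hij).trans (Matrix.norm_entry_le_entrywise_sup_norm Astar)

/-- Young's inequality for three factors with exponents `q`, `s`, `2`, all weights then enlarged to
one. It is applied with `q = 2 + γ` and `s = 2 + 4 / γ`, the pair in the integrability condition. -/
theorem mul_mul_le_rpow_add {q s t a g : ℝ} (hq : 0 < q) (hs : 0 < s) (hqs : 1 / q + 1 / s = 1 / 2)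
    (ht : 0 ≤ t) (ha : 0 ≤ a) (hg : 0 ≤ g) : t * (a * g) ≤ t ^ q + (a ^ s + g ^ 2) := by
  have h := Real.geom_mean_le_arith_mean3_weighted (w₁ := 1 / q) (w₂ := 1 / s) (w₃ := 1 / 2)
    (p₁ := t ^ q) (p₂ := a ^ s) (p₃ := g ^ (2 : ℝ)) (by positivity) (by positivity) (by positivity)
    (by positivity) (by positivity) (by positivity) (by linarith)
  rw [← Real.rpow_mul ht, ← Real.rpow_mul ha, ← Real.rpow_mul hg, mul_one_div_cancel hq.ne',
    mul_one_div_cancel hs.ne', mul_one_div_cancel two_ne_zero, Real.rpow_one, Real.rpow_one,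
    Real.rpow_one, Real.rpow_two] at h
  have h1 : 1 / q ≤ 1 := by linarith [one_div_pos.2 hq, one_div_pos.2 hs]
  have h2 : 1 / s ≤ 1 := by linarith [one_div_pos.2 hq, one_div_pos.2 hs]
  have h3 : 0 ≤ t ^ q := Real.rpow_nonneg ht _
  have h4 : 0 ≤ a ^ s := Real.rpow_nonneg ha _
  nlinarith [sq_nonneg g]

/-- For `p` with the integrability condition, `[y, p]_A` is given by the integral. -/
theorem bracket_eq_integral [Nontrivial (Rn N)]
    (hΩ : Bornology.IsBounded (Ω : Set (Rn N))) (hΩl : HasLipschitzBoundary (Ω : Set (Rn N)))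
    {A Astar : L2Mat Ω}
    (hA : ∀ᵐ x ∂(vol Ω), ∀ i j, i < j → |skewPart (A x) i j| ≤ |Astar x i j|)
    {y p : H10 Ω} (hy : y ∈ D A) (hp : RegularFor Astar p) :
    bracket A y p = ∫ x, form (skewPart (A x)) (wgrad p x) (wgrad y x) ∂(vol Ω) := by
  simp only [form_eq_inner]
  have hfin := isFiniteMeasure_vol hΩ
  set h : Rn N → Rn N := fun x => mulVecL (skewPart (A x)) (wgrad y x) with hh
  have hhi : Integrable h (vol Ω) := integrable_mulVecL (memLp_skewPart A) (Lp.memLp (wgrad y))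
  have hl : ∀ φ : 𝓓(Ω, ℝ), bracketL hy (testH10 Ω φ) =
      ∫ x, inner ℝ (h x) (∇ (φ : Rn N → ℝ) x) ∂(vol Ω) := fun φ => by
    rw [bracketL_apply, bracket_testH10 hy]
    simp only [skewForm, form_eq_inner, hh]
  have hbdd : MemLp (wgrad p) ⊤ (vol Ω) →
      bracket A y p = ∫ x, inner ℝ (h x) (wgrad p x) ∂(vol Ω) := fun hp' => by
    refine isTestable_of_wgrad_bounded hΩ hΩl (M := (eLpNormEssSup (wgrad p) (vol Ω)).toReal) ?_
      h hhi (bracketL hy) hl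
    have hfin' : eLpNormEssSup (wgrad p) (vol Ω) < ⊤ := by
      have := hp'.2
      rwa [eLpNorm_exponent_top] at this
    filter_upwards [enorm_ae_le_eLpNormEssSup (wgrad p) (vol Ω)] with x hx
    rw [← toReal_enorm]
    exact ENNReal.toReal_mono hfin'.ne hx
  obtain ⟨γ, hγ, hp' | ⟨hA', hp'⟩⟩ := hp
  · exact hbdd hp'
  -- For `γ = ∞` the second alternative says that the gradient is bounded, so it falls under the
  -- first.
  by_cases hγt : γ = ⊤
  · refine hbdd ?_
    rwa [hγt, add_top] at hp'
  have hg : 0 < γ.toReal := ENNReal.toReal_pos hγ.ne' hγt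
  set r := γ.toReal with hr
  have hγr : γ = ENNReal.ofReal r := (ENNReal.ofReal_toReal hγt).symm
  have hq : (2 + γ : ℝ≥0∞) = ENNReal.ofReal (2 + r) := by
    rw [ENNReal.ofReal_add zero_le_two hg.le, ← hγr]; norm_num
  have hs : (2 + 4 / γ : ℝ≥0∞) = ENNReal.ofReal (2 + 4 / r) := by
    rw [ENNReal.ofReal_add zero_le_two (by positivity), ENNReal.ofReal_div_of_pos hg, ← hγr]
    norm_num
  obtain ⟨C, -, hC⟩ := exists_abs_bracket_le hy
  have hs0 : 0 < 2 + 4 / r := by positivity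
  have hq0 : 0 < 2 + r := by positivity
  have hai : Integrable (fun x => ((N : ℝ) ^ 2 * ‖Astar x‖) ^ (2 + 4 / r)) (vol Ω) := by
    rw [hs] at hA'
    have h1 := hA'.integrable_norm_rpow (ENNReal.ofReal_pos.2 hs0).ne' ENNReal.ofReal_ne_top
    rw [ENNReal.toReal_ofReal hs0.le] at h1
    refine (h1.const_mul (((N : ℝ) ^ 2) ^ (2 + 4 / r))).congr (Eventually.of_forall fun x => ?_)
    simp only
    rw [Real.mul_rpow (by positivity) (norm_nonneg _)]
  have hgq : Integrable (fun x => ‖wgrad p x‖ ^ (2 + r)) (vol Ω) := by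
    rw [hq] at hp'
    have h1 := hp'.integrable_norm_rpow (ENNReal.ofReal_pos.2 hq0).ne' ENNReal.ofReal_ne_top
    rwa [ENNReal.toReal_ofReal hq0.le] at h1
  have hk : Integrable (fun x => ((N : ℝ) ^ 2 * ‖Astar x‖) ^ (2 + 4 / r) + ‖wgrad y x‖ ^ 2)
      (vol Ω) := hai.add (integrable_norm_sq_wgrad y)
  refine eq_integral_of_young (l := bracketL hy) hΩ hΩl hhi hl hC (by linarith) hk ?_ hgq
  filter_upwards [hA] with x hx t ht
  have h1 : ‖h x‖ ≤ (N : ℝ) ^ 2 * ‖Astar x‖ * ‖wgrad y x‖ := by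
    refine (norm_mulVecL_le _ _).trans ?_
    exact mul_le_mul_of_nonneg_right (mul_le_mul_of_nonneg_left (norm_skewPart_le hx)
      (by positivity)) (norm_nonneg _)
  refine (mul_le_mul_of_nonneg_left h1 ht).trans ?_
  refine mul_mul_le_rpow_add hq0 hs0 ?_ ht (by positivity) (norm_nonneg _)
  field_simp
  ring

/-- The bounds `α I ≤ A^sym ≤ β I` almost everywhere. -/
def IsElliptic (α β : ℝ) (A : L2Mat Ω) : Prop :=
  ∀ᵐ x ∂(vol Ω), ∀ ξ : Rn N,
    α * ‖ξ‖ ^ 2 ≤ form (symPart (A x)) ξ ξ ∧ form (symPart (A x)) ξ ξ ≤ β * ‖ξ‖ ^ 2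

theorem IsElliptic.memLp {α β : ℝ} (hα : 0 < α) (hαβ : α ≤ β) {A : L2Mat Ω}
    (hA : IsElliptic α β A) (y : H10 Ω) :
    MemLp (fun x => mulVecL (symPart (A x)) (wgrad y x)) 2 (vol Ω) := by
  refine MemLp.of_le_mul (c := β) (Lp.memLp (wgrad y))
    (mulVecL.aestronglyMeasurable_comp₂ (memLp_symPart A).1 (Lp.aestronglyMeasurable _)) ?_
  filter_upwards [hA] with x hx
  exact norm_mulVecL_symPart_le hα hx hαβ _

/-- `∫_Ω (∇u, A^sym ∇v) dx`. -/
def symForm (A : L2Mat Ω) (u v : H10 Ω) : ℝ :=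
  ∫ x, form (symPart (A x)) (wgrad u x) (wgrad v x) ∂(vol Ω)

theorem symForm_comm (A : L2Mat Ω) (u v : H10 Ω) : symForm A u v = symForm A v u := by
  simp only [symForm, form_symPart_comm _ (wgrad u _)]

theorem IsElliptic.integrable {α β : ℝ} (hα : 0 < α) (hαβ : α ≤ β) {A : L2Mat Ω}
    (hA : IsElliptic α β A) (u v : H10 Ω) :
    Integrable (fun x => form (symPart (A x)) (wgrad u x) (wgrad v x)) (vol Ω) := by
  simp only [form_eq_inner]
  exact integrable_inner_wgrad_of_memLp (hA.memLp hα hαβ v) u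

theorem IsElliptic.gradFunctional_eq {α β : ℝ} (hα : 0 < α) (hαβ : α ≤ β) {A : L2Mat Ω}
    (hA : IsElliptic α β A) (u v : H10 Ω) :
    gradFunctional (hA.memLp hα hαβ v) u = symForm A u v := by
  rw [gradFunctional_apply]
  simp only [symForm, form_eq_inner]

theorem symForm_controlPath {α β : ℝ} (hα : 0 < α) (hαβ : α ≤ β) {A B : L2Mat Ω}
    (hA : IsElliptic α β A) (hB : IsElliptic α β B) (θ : ℝ) (u v : H10 Ω) :
    symForm (controlPath A B θ) u v = (1 - θ) * symForm A u v + θ * symForm B u v := by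
  simp only [symForm]
  rw [← integral_const_mul, ← integral_const_mul,
    ← integral_add ((hA.integrable hα hαβ u v).const_mul _)
      ((hB.integrable hα hαβ u v).const_mul _)]
  refine integral_congr_ae ?_
  filter_upwards [controlPath_ae A B θ] with x hx
  rw [hx, symPart_add, symPart_smul, symPart_smul, form_add, form_smul, form_smul]

/-- The weak equation, tested with an arbitrary element of `H¹₀(Ω)`. -/
theorem IsWeakSolution.symForm_add_bracket {α β : ℝ} (hα : 0 < α) (hαβ : α ≤ β) {A : L2Mat Ω}
    (hA : IsElliptic α β A) {f : StrongDual ℝ (H10 Ω)} {y : H10 Ω} (hw : IsWeakSolution f A y)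
    (hy : y ∈ D A) (p : H10 Ω) : symForm A p y + bracket A y p = f p := by
  -- Both sides are continuous functionals that agree on the dense set of test functions.
  have h : (gradFunctional (hA.memLp hα hαβ y) + bracketL hy : StrongDual ℝ (H10 Ω)) = f := by
    refine DFunLike.coe_injective (denseRange_testH10.equalizer (map_continuous _)
      (map_continuous _) ?_)
    funext φ
    simp only [Function.comp, _root_.add_apply]
    rw [hA.gradFunctional_eq hα hαβ, bracketL_apply, bracket_testH10 hy, ← hw φ, symForm, skewForm,
      ← integral_add (hA.integrable hα hαβ _ _) (integrable_skewForm A y φ)]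
    refine integral_congr_ae ?_
    filter_upwards [wgrad_test_ae φ] with x hx
    rw [hx, ← form_add, symPart_add_skewPart]
  rw [← h, _root_.add_apply, hA.gradFunctional_eq hα hαβ, bracketL_apply]

end Forms

/-! ### Convexity of the set of controls -/

section Convexity

variable {N : ℕ} {Ω : TopologicalSpace.Opens (Rn N)}

theorem integrable_mul_divergence {u : Rn N → ℝ} (hu : Integrable u (vol Ω))
    (φ : 𝓓^{1}(Ω, Rn N)) :
    Integrable (fun x => u x *
      (∑ i, (fderiv ℝ (φ : Rn N → Rn N) x (EuclideanSpace.single i 1)) i)) (vol Ω) := by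
  have hc : Continuous (fderiv ℝ (φ : Rn N → Rn N)) := φ.contDiff.continuous_fderiv (by simp)
  have hdc : Continuous fun x =>
      ∑ i, (fderiv ℝ (φ : Rn N → Rn N) x (EuclideanSpace.single i 1)) i :=
    continuous_finsetSum _ fun i _ => (EuclideanSpace.proj (𝕜 := ℝ) i).continuous.comp
      (hc.clm_apply continuous_const)
  have hcs : HasCompactSupport fun x =>
      ∑ i, (fderiv ℝ (φ : Rn N → Rn N) x (EuclideanSpace.single i 1)) i :=
    (φ.hasCompactSupport.fderiv (𝕜 := ℝ)).comp_left
      (g := fun T : Rn N →L[ℝ] Rn N => ∑ i, (T (EuclideanSpace.single i 1)) i) (by simp)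
  obtain ⟨C, hC⟩ := hdc.bounded_above_of_compact_support hcs
  simp_rw [mul_comm (u _)]
  exact hu.bdd_mul (c := C) hdc.aestronglyMeasurable (Eventually.of_forall hC)

theorem totalVariation_convexComb_le {u v w : Rn N → ℝ} (hu : Integrable u (vol Ω))
    (hv : Integrable v (vol Ω)) {θ c : ℝ} (hθ : θ ∈ Icc (0 : ℝ) 1) (hc : 0 ≤ c)
    (hw : ∀ᵐ x ∂(vol Ω), w x = (1 - θ) * u x + θ * v x)
    (huc : totalVariation Ω u ≤ ENNReal.ofReal c) (hvc : totalVariation Ω v ≤ ENNReal.ofReal c) :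
    totalVariation Ω w ≤ ENNReal.ofReal c := by
  simp only [totalVariation, iSup_le_iff] at huc hvc ⊢
  intro φ hφ
  have h1 := (ENNReal.ofReal_le_ofReal_iff hc).1 (huc φ hφ)
  have h2 := (ENNReal.ofReal_le_ofReal_iff hc).1 (hvc φ hφ)
  refine ENNReal.ofReal_le_ofReal ?_
  have h3 : ∫ x, w x * (∑ i, (fderiv ℝ (φ : Rn N → Rn N) x (EuclideanSpace.single i 1)) i)
      ∂(vol Ω) = (1 - θ) * ∫ x, u x *
        (∑ i, (fderiv ℝ (φ : Rn N → Rn N) x (EuclideanSpace.single i 1)) i) ∂(vol Ω) +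
      θ * ∫ x, v x *
        (∑ i, (fderiv ℝ (φ : Rn N → Rn N) x (EuclideanSpace.single i 1)) i) ∂(vol Ω) := by
    rw [← integral_const_mul, ← integral_const_mul, ← integral_add
      ((integrable_mul_divergence hu φ).const_mul _) ((integrable_mul_divergence hv φ).const_mul _)]
    refine integral_congr_ae ?_
    filter_upwards [hw] with x hx
    rw [hx]; ring
  rw [h3]
  nlinarith [mul_le_mul_of_nonneg_left h1 (sub_nonneg.2 hθ.2), mul_le_mul_of_nonneg_left h2 hθ.1]

theorem skew_controlPath (A B : L2Mat Ω) (θ : ℝ) :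
    (controlPath A B θ).skew = (1 - θ) • A.skew + θ • B.skew := by
  have h : controlPath A B θ = (1 - θ) • A + θ • B := by
    rw [controlPath, smul_sub, sub_smul, one_smul]; abel
  rw [h]
  exact (((skewPartL (N := N)).compLpL 2 (vol Ω)).map_add _ _).trans (by
    rw [map_smul, map_smul]; rfl)

/-- Every constraint is convex: total variation is a supremum of linear functionals, and the
ellipticity bounds, the entrywise bound and membership in `Q` are preserved by averaging. This makes
the pairs `(A_θ, y_θ)` legitimate competitors. -/
theorem controlPath_mem_admissible (hΩ : Bornology.IsBounded (Ω : Set (Rn N))) {α β c : ℝ}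
    (hc : 0 ≤ c) {Astar : L2Mat Ω} {Q : Set (L2Mat Ω)} (hQ : Convex ℝ Q) {A B : L2Mat Ω}
    (hA : A ∈ admissible α β c Astar Q) (hB : B ∈ admissible α β c Astar Q) {θ : ℝ}
    (hθ : θ ∈ Icc (0 : ℝ) 1) : controlPath A B θ ∈ admissible α β c Astar Q := by
  have hfin := isFiniteMeasure_vol hΩ
  have h1θ : 0 ≤ 1 - θ := sub_nonneg.2 hθ.2
  have hent : ∀ (M : L2Mat Ω) i j, Integrable (fun x => symPart (M x) i j) (vol Ω) :=
    fun M i j => ((LinearMap.toContinuousLinearMap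
      (Matrix.entryLinearMap ℝ ℝ i j)).comp_memLp' (memLp_symPart M)).integrable (by norm_num)
  refine ⟨⟨fun i j => totalVariation_convexComb_le (hent A i j) (hent B i j) hθ hc ?_
    (hA.1.1 i j) (hB.1.1 i j), ?_⟩, ?_, ?_⟩
  · filter_upwards [controlPath_ae A B θ] with x hx
    rw [hx, symPart_add, symPart_smul, symPart_smul]
    rfl
  · filter_upwards [controlPath_ae A B θ, hA.1.2, hB.1.2] with x hx h1 h2 ξ
    rw [hx, symPart_add, symPart_smul, symPart_smul, form_add, form_smul, form_smul]
    have h3 := mul_le_mul_of_nonneg_left (h1 ξ).1 h1θ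
    have h4 := mul_le_mul_of_nonneg_left (h1 ξ).2 h1θ
    have h5 := mul_le_mul_of_nonneg_left (h2 ξ).1 hθ.1
    have h6 := mul_le_mul_of_nonneg_left (h2 ξ).2 hθ.1
    constructor <;> linarith
  · filter_upwards [controlPath_ae A B θ, hA.2.1, hB.2.1] with x hx h1 h2 i j hij
    rw [hx, skewPart_add, skewPart_smul, skewPart_smul]
    have h3 := mul_le_mul_of_nonneg_left (h1 i j hij) h1θ
    have h4 := mul_le_mul_of_nonneg_left (h2 i j hij) hθ.1
    calc |((1 - θ) • skewPart (A x) + θ • skewPart (B x)) i j|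
        = |(1 - θ) * skewPart (A x) i j + θ * skewPart (B x) i j| := rfl
      _ ≤ |(1 - θ) * skewPart (A x) i j| + |θ * skewPart (B x) i j| := abs_add_le _ _
      _ = (1 - θ) * |skewPart (A x) i j| + θ * |skewPart (B x) i j| := by
          rw [abs_mul, abs_mul, abs_of_nonneg h1θ, abs_of_nonneg hθ.1]
      _ ≤ |Astar x i j| := by linarith
  · rw [skew_controlPath]
    exact hQ hA.2.2 hB.2.2 h1θ hθ.1 (by ring)

end Convexity

/-! ### The first variation of the cost -/

section Variation

variable {N : ℕ} {Ω : TopologicalSpace.Opens (Rn N)}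

theorem symForm_add_left {α β : ℝ} (hα : 0 < α) (hαβ : α ≤ β) {A : L2Mat Ω}
    (hA : IsElliptic α β A) (u u' v : H10 Ω) :
    symForm A (u + u') v = symForm A u v + symForm A u' v := by
  simp only [← hA.gradFunctional_eq hα hαβ, map_add]

theorem symForm_sub_left {α β : ℝ} (hα : 0 < α) (hαβ : α ≤ β) {A : L2Mat Ω}
    (hA : IsElliptic α β A) (u u' v : H10 Ω) :
    symForm A (u - u') v = symForm A u v - symForm A u' v := by
  simp only [← hA.gradFunctional_eq hα hαβ, map_sub]

theorem symForm_smul_left {α β : ℝ} (hα : 0 < α) (hαβ : α ≤ β) {A : L2Mat Ω}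
    (hA : IsElliptic α β A) (c : ℝ) (u v : H10 Ω) :
    symForm A (c • u) v = c * symForm A u v := by
  simp only [← hA.gradFunctional_eq hα hαβ, map_smul, smul_eq_mul]

theorem symForm_sub_right {α β : ℝ} (hα : 0 < α) (hαβ : α ≤ β) {A : L2Mat Ω}
    (hA : IsElliptic α β A) (u v v' : H10 Ω) :
    symForm A u (v - v') = symForm A u v - symForm A u v' := by
  simp only [symForm_comm A u, symForm_sub_left hα hαβ hA]

theorem symForm_add_right {α β : ℝ} (hα : 0 < α) (hαβ : α ≤ β) {A : L2Mat Ω}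
    (hA : IsElliptic α β A) (u v v' : H10 Ω) :
    symForm A u (v + v') = symForm A u v + symForm A u v' := by
  simp only [symForm_comm A u, symForm_add_left hα hαβ hA]

theorem symForm_smul_right {α β : ℝ} (hα : 0 < α) (hαβ : α ≤ β) {A : L2Mat Ω}
    (hA : IsElliptic α β A) (c : ℝ) (u v : H10 Ω) :
    symForm A u (c • v) = c * symForm A u v := by
  simp only [symForm_comm A u, symForm_smul_left hα hαβ hA]

theorem integral_mul_eq_inner (u v w : Lp ℝ 2 (vol Ω)) :
    ∫ x, (u x - v x) * w x ∂(vol Ω) = inner ℝ (u - v) w := by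
  rw [L2.inner_def]
  refine integral_congr_ae ?_
  filter_upwards [Lp.coeFn_sub u v] with x hx
  rw [hx, Pi.sub_apply, mul_comm]
  rfl

theorem cost_eq (yd : Lp ℝ 2 (vol Ω)) (A : L2Mat Ω) (y : H10 Ω) :
    cost yd A y = ‖fn y - yd‖ ^ 2 + symForm A y y := rfl

theorem skewForm_sub_state (A : L2Mat Ω) (y y' : H10 Ω) (φ : 𝓓(Ω, ℝ)) :
    skewForm A (y - y') φ = skewForm A y φ - skewForm A y' φ := by
  rw [skewForm, skewForm, skewForm,
    ← integral_sub (integrable_skewForm A y φ) (integrable_skewForm A y' φ), wgrad_sub]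
  refine integral_congr_ae ?_
  filter_upwards [Lp.coeFn_sub (wgrad y) (wgrad y')] with x hx
  rw [hx, Pi.sub_apply, form_sub_right]

theorem sub_mem_D {A : L2Mat Ω} {y y' : H10 Ω} (hy : y ∈ D A) (hy' : y' ∈ D A) :
    y - y' ∈ D A := by
  obtain ⟨C, hC⟩ := hy
  obtain ⟨C', hC'⟩ := hy'
  refine ⟨C + C', fun φ => ?_⟩
  rw [skewForm_sub_state, add_mul]
  exact (abs_sub _ _).trans (add_le_add (hC φ) (hC' φ))

theorem bracket_sub_state {A : L2Mat Ω} {y y' : H10 Ω} (hy : y ∈ D A) (hy' : y' ∈ D A)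
    (p : H10 Ω) : bracket A (y - y') p = bracket A y p - bracket A y' p := by
  obtain ⟨φ, hφ⟩ := exists_seq_test_tendsto p
  refine tendsto_nhds_unique (tendsto_skewForm_bracket (sub_mem_D hy hy') hφ) ?_
  simp only [skewForm_sub_state]
  exact (tendsto_skewForm_bracket hy hφ).sub (tendsto_skewForm_bracket hy' hφ)

/-- The quasi-adjoint equation, tested with a difference of elements of `D(A)`. -/
theorem IsQuasiAdjoint.eq_bracket [Nontrivial (Rn N)]
    (hΩ : Bornology.IsBounded (Ω : Set (Rn N))) (hΩl : HasLipschitzBoundary (Ω : Set (Rn N)))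
    {α β : ℝ} (hα : 0 < α) (hαβ : α ≤ β) {yd : Lp ℝ 2 (vol Ω)} {A Astar : L2Mat Ω}
    (hA : IsElliptic α β A)
    (hAs : ∀ᵐ x ∂(vol Ω), ∀ i j, i < j → |skewPart (A x) i j| ≤ |Astar x i j|)
    {z ψ : H10 Ω} (hψ : IsQuasiAdjoint yd 1 A z ψ) (hreg : RegularFor Astar ψ) {y y' : H10 Ω}
    (hy : y ∈ D A) (hy' : y' ∈ D A) :
    symForm A ψ (y - y') + (bracket A y ψ - bracket A y' ψ) =
      -2 * inner ℝ (fn z - yd) (fn (y - y')) - 2 * symForm A (y - y') z := by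
  obtain ⟨hint, heq⟩ := hψ (y - y')
  have hs := hA.integrable hα hαβ (y - y') ψ
  -- The equation provides integrability of the full form only. Subtracting the bounded symmetric
  -- part isolates the skew part, so the integral can be split.
  have hk : Integrable (fun x => form (skewPart (A x)) (wgrad (y - y') x) (wgrad ψ x)) (vol Ω) := by
    refine (hs.sub hint).congr (Eventually.of_forall fun x => ?_)
    simp only [Pi.sub_apply, form_sub]; ring
  have h1 : ∫ x, form (skewPart (A x)) (wgrad (y - y') x) (wgrad ψ x) ∂(vol Ω) =
      -(bracket A y ψ - bracket A y' ψ) := by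
    rw [← bracket_sub_state hy hy', bracket_eq_integral hΩ hΩl hAs (sub_mem_D hy hy') hreg,
      ← integral_neg]
    simp only [form_skewPart_swap _ (wgrad (y - y') _)]
  simp only [form_sub] at heq
  rw [integral_sub hs hk, h1, integral_mul_eq_inner] at heq
  have h2 : symForm A ψ (y - y') = symForm A (y - y') ψ := symForm_comm _ _ _
  rw [h2]
  simp only [symForm] at heq ⊢
  linarith

/-- The increment of the cost along a segment of controls, in terms of the quasi-adjoint state
at the midpoint. -/
theorem cost_controlPath_sub_cost [Nontrivial (Rn N)]
    (hΩ : Bornology.IsBounded (Ω : Set (Rn N))) (hΩl : HasLipschitzBoundary (Ω : Set (Rn N)))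
    {α β : ℝ} (hα : 0 < α) (hαβ : α ≤ β) {f : StrongDual ℝ (H10 Ω)} {yd : Lp ℝ 2 (vol Ω)}
    {A B Astar : L2Mat Ω} {θ : ℝ} (hA : IsElliptic α β A) (hB : IsElliptic α β B)
    (hAB : IsElliptic α β (controlPath A B θ))
    (hAs : ∀ᵐ x ∂(vol Ω), ∀ i j, i < j → |skewPart (controlPath A B θ x) i j| ≤ |Astar x i j|)
    {y₀ y ψ : H10 Ω} (hy₀A : y₀ ∈ D A) (hy₀B : y₀ ∈ D B) (hy₀AB : y₀ ∈ D (controlPath A B θ))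
    (hyAB : y ∈ D (controlPath A B θ)) (hw₀ : IsWeakSolution f A y₀)
    (hw : IsWeakSolution f (controlPath A B θ) y)
    (hψ : IsQuasiAdjoint yd 1 (controlPath A B θ) (y₀ + (1 / 2 : ℝ) • (y - y₀)) ψ)
    (hreg : RegularFor Astar ψ) :
    cost yd (controlPath A B θ) y - cost yd A y₀ =
      θ * (symForm B y₀ (y₀ + ψ) - symForm A y₀ (y₀ + ψ) +
        (bracket B y₀ ψ - bracket A y₀ ψ)) := by
  have h1 := hψ.eq_bracket hΩ hΩl hα hαβ hAB hAs hreg hyAB hy₀AB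
  have h2 := hw.symForm_add_bracket hα hαβ hAB hyAB ψ
  have h3 := hw₀.symForm_add_bracket hα hαβ hA hy₀A ψ
  have h4 := bracket_controlPath hy₀A hy₀B hy₀AB ψ
  -- A quadratic function has increment equal to its derivative at the midpoint; `h5` and `h6` state
  -- this for the two parts of the cost.
  have h5 : ‖fn y - yd‖ ^ 2 - ‖fn y₀ - yd‖ ^ 2 =
      2 * inner ℝ (fn (y₀ + (1 / 2 : ℝ) • (y - y₀)) - yd) (fn (y - y₀)) := by
    set a := fn y₀ - yd with ha
    set w := fn (y - y₀) with hw
    have e1 : fn y - yd = a + w := by rw [ha, hw, fn_sub]; abel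
    have e2 : fn (y₀ + (1 / 2 : ℝ) • (y - y₀)) - yd = a + (1 / 2 : ℝ) • w := by
      rw [ha, hw, fn_add, fn_smul]; abel
    rw [e1, e2, norm_add_sq_real, inner_add_left, real_inner_smul_left, real_inner_self_eq_norm_sq]
    ring
  have h6 : symForm (controlPath A B θ) (y - y₀) (y₀ + (1 / 2 : ℝ) • (y - y₀)) =
      (symForm (controlPath A B θ) y y - symForm (controlPath A B θ) y₀ y₀) / 2 := by
    simp only [symForm_add_right hα hαβ hAB, symForm_smul_right hα hαβ hAB,
      symForm_sub_right hα hαβ hAB, symForm_sub_left hα hαβ hAB]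
    rw [symForm_comm (controlPath A B θ) y y₀]
    ring
  have h7 := symForm_controlPath hα hαβ hA hB θ y₀ y₀
  have h8 := symForm_controlPath hα hαβ hA hB θ ψ y₀
  rw [symForm_sub_right hα hαβ hAB] at h1
  rw [cost_eq, cost_eq, symForm_add_right hα hαβ hA, symForm_add_right hα hαβ hB,
    symForm_comm A y₀ ψ, symForm_comm B y₀ ψ]
  -- The quasi-adjoint equation replaces the derivative of the cost. The terms `f ψ` of the two
  -- state equations cancel, and linearity along the segment of controls leaves a common factor `θ`.
  linear_combination h5 + h1 - 2 * h6 - h2 + h3 + h8 + h4 + h7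

/-! ### Passage to the limit -/

/-- The weak formulation of the adjoint problem. -/
def IsAdjoint (yd : Lp ℝ 2 (vol Ω)) (A : L2Mat Ω) (y ψ : H10 Ω) : Prop :=
  ∀ φ : 𝓓(Ω, ℝ), ∫ x, form (A x)ᵀ (∇ (φ : Rn N → ℝ) x) (wgrad ψ x) ∂(vol Ω) =
    - 2 * (∫ x, (fn y x - yd x) * φ x ∂(vol Ω))
      - 2 * ∫ x, form (symPart (A x)) (∇ (φ : Rn N → ℝ) x) (wgrad y x) ∂(vol Ω)

/-- Moving the matrix onto the smooth test function gives a square integrable field. The left side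
of the adjoint equation is therefore a bounded functional of `ψ`, although the coefficients are
unbounded, and so passes to limits. -/
theorem memLp_mulVecL_gradient (A : L2Mat Ω) (φ : 𝓓(Ω, ℝ)) :
    MemLp (fun x => mulVecL (A x) (∇ (φ : Rn N → ℝ) x)) 2 (vol Ω) := by
  obtain ⟨C, hC⟩ := (continuous_gradient_test Ω φ).bounded_above_of_compact_support
    (hasCompactSupport_gradient_test Ω φ)
  refine MemLp.of_le_mul (c := (N : ℝ) ^ 2 * C) (Lp.memLp A)
    (mulVecL.aestronglyMeasurable_comp₂ (Lp.aestronglyMeasurable A)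
      (continuous_gradient_test Ω φ).aestronglyMeasurable) (Eventually.of_forall fun x => ?_)
  refine (norm_mulVecL_le _ _).trans ?_
  calc (N : ℝ) ^ 2 * ‖A x‖ * ‖∇ (φ : Rn N → ℝ) x‖ ≤ (N : ℝ) ^ 2 * ‖A x‖ * C :=
        mul_le_mul_of_nonneg_left (hC x) (by positivity)
    _ = _ := by ring

/-- `ψ ↦ ∫_Ω (∇φ, Aᵗ ∇ψ) dx` for a test function `φ`. -/
theorem gradFunctional_mulVecL_gradient (A : L2Mat Ω) (φ : 𝓓(Ω, ℝ)) (ψ : H10 Ω) :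
    gradFunctional (memLp_mulVecL_gradient A φ) ψ =
      ∫ x, form (A x)ᵀ (∇ (φ : Rn N → ℝ) x) (wgrad ψ x) ∂(vol Ω) := by
  rw [gradFunctional_apply]
  congr 1 with x
  rw [form_transpose, form_eq_inner]

theorem isAdjoint_iff {yd : Lp ℝ 2 (vol Ω)} {A : L2Mat Ω} {y ψ : H10 Ω} :
    IsAdjoint yd A y ψ ↔ ∀ φ : 𝓓(Ω, ℝ), gradFunctional (memLp_mulVecL_gradient A φ) ψ =
      - 2 * inner ℝ (fn y - yd) (fn (testH10 Ω φ)) - 2 * symForm A (testH10 Ω φ) y := by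
  refine forall_congr' fun φ => ?_
  have h1 : ∫ x, (fn y x - yd x) * φ x ∂(vol Ω) = inner ℝ (fn y - yd) (fn (testH10 Ω φ)) := by
    rw [← integral_mul_eq_inner]
    refine integral_congr_ae ?_
    filter_upwards [fn_test_ae φ] with x hx
    rw [hx]
  have h2 : ∫ x, form (symPart (A x)) (∇ (φ : Rn N → ℝ) x) (wgrad y x) ∂(vol Ω) =
      symForm A (testH10 Ω φ) y := by
    refine integral_congr_ae ?_
    filter_upwards [wgrad_test_ae φ] with x hx
    rw [hx]
  rw [gradFunctional_mulVecL_gradient, h1, h2]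

theorem IsQuasiAdjoint.gradFunctional_eq {yd : Lp ℝ 2 (vol Ω)} {A B : L2Mat Ω} {θ : ℝ}
    {z ψ : H10 Ω} (hψ : IsQuasiAdjoint yd 1 (controlPath A B θ) z ψ) (φ : 𝓓(Ω, ℝ)) :
    (1 - θ) * gradFunctional (memLp_mulVecL_gradient A φ) ψ +
      θ * gradFunctional (memLp_mulVecL_gradient B φ) ψ =
      - 2 * inner ℝ (fn z - yd) (fn (testH10 Ω φ)) -
        2 * symForm (controlPath A B θ) (testH10 Ω φ) z := by
  have h1 := (hψ (testH10 Ω φ)).2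
  rw [integral_mul_eq_inner] at h1
  have h2 : ∫ x, form (symPart (controlPath A B θ x) - skewPart (controlPath A B θ x))
      (wgrad (testH10 Ω φ) x) (wgrad ψ x) ∂(vol Ω) =
      (1 - θ) * gradFunctional (memLp_mulVecL_gradient A φ) ψ +
      θ * gradFunctional (memLp_mulVecL_gradient B φ) ψ := by
    rw [gradFunctional_apply, gradFunctional_apply, ← integral_const_mul, ← integral_const_mul,
      ← integral_add ((integrable_inner_wgrad_of_memLp (memLp_mulVecL_gradient A φ) ψ).const_mul _)
        ((integrable_inner_wgrad_of_memLp (memLp_mulVecL_gradient B φ) ψ).const_mul _)]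
    refine integral_congr_ae ?_
    filter_upwards [wgrad_test_ae φ, controlPath_ae A B θ] with x hx hx'
    rw [hx, symPart_sub_skewPart, form_transpose, hx', form_add, form_smul, form_smul,
      form_eq_inner, form_eq_inner]
  rw [← h2, h1]
  simp only [symForm]
  ring

/-- Limits of quasi-adjoint states solve the adjoint problem. -/
theorem isAdjoint_of_tendsto {α β : ℝ} (hα : 0 < α) (hαβ : α ≤ β) {yd : Lp ℝ 2 (vol Ω)}
    {A B : L2Mat Ω} (hA : IsElliptic α β A) (hB : IsElliptic α β B) {t : ℕ → ℝ}
    (ht : Tendsto t atTop (𝓝 0)) {z ψ : ℕ → H10 Ω} {y₀ ψlim : H10 Ω}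
    (hz : ∀ l : StrongDual ℝ (H10 Ω), Tendsto (fun k => l (z k)) atTop (𝓝 (l y₀)))
    (hψ : Tendsto ψ atTop (𝓝 ψlim))
    (hq : ∀ k, IsQuasiAdjoint yd 1 (controlPath A B (t k)) (z k) (ψ k)) :
    IsAdjoint yd A y₀ ψlim := by
  refine isAdjoint_iff.2 fun φ => ?_
  have h1t : Tendsto (fun k => 1 - t k) atTop (𝓝 1) := by simpa using ht.const_sub 1
  have hlin : ∀ l : StrongDual ℝ (H10 Ω), Tendsto (fun k => l (ψ k)) atTop (𝓝 (l ψlim)) :=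
    fun l => (l.continuous.tendsto _).comp hψ
  have h1 : Tendsto (fun k => (1 - t k) * gradFunctional (memLp_mulVecL_gradient A φ) (ψ k) +
      t k * gradFunctional (memLp_mulVecL_gradient B φ) (ψ k)) atTop
      (𝓝 (gradFunctional (memLp_mulVecL_gradient A φ) ψlim)) := by
    simpa using (h1t.mul (hlin _)).add (ht.mul (hlin _))
  have hsym : ∀ M : L2Mat Ω, IsElliptic α β M →
      Tendsto (fun k => symForm M (testH10 Ω φ) (z k)) atTop
        (𝓝 (symForm M (testH10 Ω φ) y₀)) := fun M hM => by
    simp only [symForm_comm M (testH10 Ω φ), ← hM.gradFunctional_eq hα hαβ]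
    exact hz _
  have h2 : Tendsto (fun k => symForm (controlPath A B (t k)) (testH10 Ω φ) (z k)) atTop
      (𝓝 (symForm A (testH10 Ω φ) y₀)) := by
    simp only [symForm_controlPath hα hαβ hA hB]
    simpa using (h1t.mul (hsym A hA)).add (ht.mul (hsym B hB))
  have h3 : Tendsto (fun k => (inner ℝ (fn (z k) - yd) (fn (testH10 Ω φ)) : ℝ)) atTop
      (𝓝 (inner ℝ (fn y₀ - yd) (fn (testH10 Ω φ)))) := by
    have := hz ((innerSL ℝ (fn (testH10 Ω φ))).comp (fnL Ω))
    simp only [inner_sub_left]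
    refine Tendsto.sub_const ?_ _
    simp only [real_inner_comm _ (fn (z _)), real_inner_comm _ (fn y₀)]
    exact this
  refine tendsto_nhds_unique h1 ?_
  simp only [fun k => (hq k).gradFunctional_eq φ]
  exact (h3.const_mul _).sub (h2.const_mul _)

/-- The difference of two solutions solves the homogeneous problem. This is where the growth
condition on the skew part enters. -/
theorem IsAdjoint.unique [Nontrivial (Rn N)]
    (hΩ : Bornology.IsBounded (Ω : Set (Rn N))) (hΩl : HasLipschitzBoundary (Ω : Set (Rn N)))
    {α β : ℝ} (hα : 0 < α) (hαβ : α ≤ β) {A : L2Mat Ω} (hA : IsElliptic α β A)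
    (hLp : Tendsto (fun p : ℝ => eLpNorm (fun x => skewPart (A x)) (ENNReal.ofReal p) (vol Ω) /
      ENNReal.ofReal p) atTop (𝓝 0)) {yd : Lp ℝ 2 (vol Ω)} {y ψ ψ' : H10 Ω}
    (h : IsAdjoint yd A y ψ) (h' : IsAdjoint yd A y ψ') : ψ = ψ' := by
  refine sub_eq_zero.1 (eq_zero_of_adjoint_eq_zero hΩ hΩl hα hαβ hA hLp fun φ => ?_)
  rw [← gradFunctional_mulVecL_gradient, map_sub, isAdjoint_iff.1 h φ, isAdjoint_iff.1 h' φ,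
    sub_self]

/-- For every admissible control there is a solution of the adjoint problem that satisfies the
variational inequality. -/
theorem exists_isAdjoint_and_variational_le [Nontrivial (Rn N)]
    (hΩ : Bornology.IsBounded (Ω : Set (Rn N))) (hΩl : HasLipschitzBoundary (Ω : Set (Rn N)))
    {α β c : ℝ} (hα : 0 < α) (hαβ : α ≤ β) (hc : 0 ≤ c) {Astar : L2Mat Ω} {Q : Set (L2Mat Ω)}
    (hQ : Convex ℝ Q) {f : StrongDual ℝ (H10 Ω)} {yd : Lp ℝ 2 (vol Ω)} {A₀ : L2Mat Ω}
    {y₀ : H10 Ω} (hopt : IsOptimalPair (admissible α β c Astar Q) f yd A₀ y₀)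
    (hH1 : HypH1 (admissible α β c Astar Q) Astar) (hH2 : y₀ ∈ D Astar) {A : L2Mat Ω}
    (hA : A ∈ admissible α β c Astar Q) {y : ℝ → H10 Ω} (hH3 : HypH3 f Astar A₀ y₀ A y)
    (hH4 : HypH4 yd Astar A₀ y₀ A y) :
    ∃ ψ : H10 Ω, IsAdjoint yd A₀ y₀ ψ ∧
      bracket A₀ y₀ ψ - bracket A y₀ ψ ≤ symForm A y₀ (y₀ + ψ) - symForm A₀ y₀ (y₀ + ψ) := by
  obtain ⟨⟨hA₀, hy₀, hw₀⟩, hmin⟩ := hopt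
  obtain ⟨hweak, hconv, hyD⟩ := hH3
  have hA₀e : IsElliptic α β A₀ := hA₀.1.2
  have hAe : IsElliptic α β A := hA.1.2
  -- The midpoint `ε = 1 / 2` makes the formula for the cost increment exact.
  obtain ⟨ψ, hψ, hcomp⟩ := hH4 (fun _ => 1 / 2) fun _ => by constructor <;> norm_num
  set t : ℕ → ℝ := fun k => 1 / ((k : ℝ) + 1) with ht
  have ht0 : ∀ k, 0 < t k := fun k => by positivity
  have ht1 : ∀ k, t k ∈ Ioc (0 : ℝ) 1 := fun k =>
    ⟨ht0 k, (div_le_one (by positivity)).2 (by linarith [k.cast_nonneg (α := ℝ)])⟩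
  have htlim : Tendsto t atTop (𝓝 0) := tendsto_one_div_add_atTop_nhds_zero_nat
  obtain ⟨σ, ψlim, hσ, hψlim⟩ := hcomp t ht1 htlim
  have htσ : Tendsto (fun k => t (σ k)) atTop (𝓝 0) := htlim.comp hσ.tendsto_atTop
  have htσ' : Tendsto (fun k => t (σ k)) atTop (𝓝[>] 0) :=
    tendsto_nhdsWithin_iff.2 ⟨htσ, Eventually.of_forall fun k => ht0 _⟩
  refine ⟨ψlim, isAdjoint_of_tendsto hα hαβ hA₀e hAe htσ
    (z := fun k => y₀ + (1 / 2 : ℝ) • (y (t (σ k)) - y₀)) (fun l => ?_) hψlim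
    fun k => (hψ _ (ht1 _)).1, ?_⟩
  · have h1 := (((hconv l).comp htσ').sub_const (l y₀)).const_mul (1 / 2)
    have h2 := h1.const_add (l y₀)
    simpa [Function.comp_def] using h2
  have hineq : ∀ᶠ k in atTop, 0 ≤ symForm A y₀ (y₀ + ψ (t (σ k))) -
      symForm A₀ y₀ (y₀ + ψ (t (σ k))) + (bracket A y₀ (ψ (t (σ k))) -
        bracket A₀ y₀ (ψ (t (σ k)))) := by
    filter_upwards [htσ'.eventually hyD] with k hk
    set θ := t (σ k) with hθ
    have hθ1 := ht1 (σ k)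
    have hadm := controlPath_mem_admissible hΩ hc hQ hA₀ hA (Ioc_subset_Icc_self hθ1)
    have h1 := cost_controlPath_sub_cost hΩ hΩl hα hαβ hA₀e hAe hadm.1.2 hadm.2.1 hy₀
      (hH1 _ hA hH2) (hH1 _ hadm hH2) (hH1 _ hadm hk) hw₀ (hweak _ hθ1) (hψ _ hθ1).1 (hψ _ hθ1).2
    have h2 := hmin (controlPath A₀ A θ, y θ) ⟨hadm, hH1 _ hadm hk, hweak _ hθ1⟩
    -- The increment of the cost is exactly `θ` times the asserted expression, so optimality gives
    -- its sign after division by `θ > 0`.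
    refine nonneg_of_mul_nonneg_right (a := θ) ?_ hθ1.1
    rw [← h1]
    exact sub_nonneg.2 h2
  have hy₀A : y₀ ∈ D A := hH1 _ hA hH2
  have hsym : ∀ M : L2Mat Ω, IsElliptic α β M →
      Tendsto (fun k => symForm M y₀ (y₀ + ψ (t (σ k)))) atTop
        (𝓝 (symForm M y₀ (y₀ + ψlim))) := fun M hM => by
    simp only [symForm_comm M y₀, ← hM.gradFunctional_eq hα hαβ]
    exact ((gradFunctional (hM.memLp hα hαβ y₀)).continuous.tendsto _).comp
      (hψlim.const_add y₀)
  have hlim := ((hsym A hAe).sub (hsym A₀ hA₀e)).add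
    ((((bracketL hy₀A).continuous.tendsto _).comp hψlim).sub
      (((bracketL hy₀).continuous.tendsto _).comp hψlim))
  have h3 := ge_of_tendsto hlim hineq
  rw [bracketL_apply, bracketL_apply] at h3
  linarith

end Variation

end SkewOCP

end

theorem theorem33p33 {N : ℕ} (hN : 2 ≤ N)
    (Ω : TopologicalSpace.Opens (SkewOCP.Rn N))
    (hΩb : Bornology.IsBounded (Ω : Set (SkewOCP.Rn N)))
    (hΩc : IsConnected (Ω : Set (SkewOCP.Rn N)))
    (hΩl : SkewOCP.HasLipschitzBoundary (Ω : Set (SkewOCP.Rn N)))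
    (α β c : ℝ) (hα : 0 < α) (hαβ : α ≤ β) (hc : 0 < c)
    (Astar : SkewOCP.L2Mat Ω) (hAskew : Astar.IsSkew) (hA0 : Astar ≠ 0)
    (Q : Set (SkewOCP.L2Mat Ω)) (hQskew : ∀ B ∈ Q, SkewOCP.L2Mat.IsSkew B)
    (hQconv : Convex ℝ Q) (hQcomp : IsCompact Q) (hQ0 : (0 : SkewOCP.L2Mat Ω) ∈ Q)
    (f : StrongDual ℝ (SkewOCP.H10 Ω)) (yd : Lp ℝ 2 (SkewOCP.vol Ω))
    (A₀ : SkewOCP.L2Mat Ω) (y₀ : SkewOCP.H10 Ω)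
    (hopt : SkewOCP.IsOptimalPair (SkewOCP.admissible α β c Astar Q) f yd A₀ y₀)
    (hLp : Tendsto
      (fun p : ℝ => eLpNorm (fun x => SkewOCP.skewPart (A₀ x)) (ENNReal.ofReal p)
        (SkewOCP.vol Ω) / ENNReal.ofReal p) atTop (𝓝 0))
    (hH1 : SkewOCP.HypH1 (SkewOCP.admissible α β c Astar Q) Astar)
    (hH2 : y₀ ∈ SkewOCP.D Astar)
    (hH34 : ∀ Ahat ∈ SkewOCP.admissible α β c Astar Q, ∃ y : ℝ → SkewOCP.H10 Ω,
      SkewOCP.HypH3 f Astar A₀ y₀ Ahat y ∧ SkewOCP.HypH4 yd Astar A₀ y₀ Ahat y) :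
    ∃ ψ : SkewOCP.H10 Ω,
      (∀ φ : 𝓓(Ω, ℝ),
        ∫ x, SkewOCP.form (A₀ x) (∇ (φ : SkewOCP.Rn N → ℝ) x) (SkewOCP.wgrad y₀ x) ∂(SkewOCP.vol Ω)
          = f (SkewOCP.testH10 Ω φ)) ∧
      (∀ φ : 𝓓(Ω, ℝ),
        ∫ x, SkewOCP.form (A₀ x)ᵀ (∇ (φ : SkewOCP.Rn N → ℝ) x) (SkewOCP.wgrad ψ x) ∂(SkewOCP.vol Ω)
          = - 2 * (∫ x, (SkewOCP.fn y₀ x - yd x) * φ x ∂(SkewOCP.vol Ω))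
            - 2 * ∫ x, SkewOCP.form (SkewOCP.symPart (A₀ x)) (∇ (φ : SkewOCP.Rn N → ℝ) x)
                (SkewOCP.wgrad y₀ x) ∂(SkewOCP.vol Ω)) ∧
      (∀ A ∈ SkewOCP.admissible α β c Astar Q,
        SkewOCP.bracket A₀ y₀ ψ - SkewOCP.bracket A y₀ ψ ≤
          ∫ x, SkewOCP.form (SkewOCP.symPart (A x) - SkewOCP.symPart (A₀ x)) (SkewOCP.wgrad y₀ x)
            (SkewOCP.wgrad y₀ x + SkewOCP.wgrad ψ x) ∂(SkewOCP.vol Ω)) := by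
  have : Nontrivial (SkewOCP.Rn N) := by
    have : Nonempty (Fin N) := ⟨⟨0, by omega⟩⟩
    infer_instance
  have hA₀ := hopt.1.1
  choose y hH3 hH4 using hH34
  have hex := fun A hA => SkewOCP.exists_isAdjoint_and_variational_le hΩb hΩl hα hαβ hc.le hQconv
    hopt hH1 hH2 hA (hH3 A hA) (hH4 A hA)
  -- Any competitor would produce an adjoint state; `A₀` itself is at hand.
  obtain ⟨ψ, hψ, -⟩ := hex A₀ hA₀
  refine ⟨ψ, hopt.1.2.2, hψ, fun A hA => ?_⟩
  obtain ⟨ψ', hψ', hle⟩ := hex A hA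
  -- The adjoint state found for `A` coincides with the one already fixed, so a single `ψ` serves
  -- all competitors.
  rw [hψ'.unique hΩb hΩl hα hαβ hA₀.1.2 hLp hψ] at hle
  refine hle.trans_eq ?_
  rw [SkewOCP.symForm, SkewOCP.symForm, ← integral_sub
    (SkewOCP.IsElliptic.integrable hα hαβ hA.1.2 y₀ _)
    (SkewOCP.IsElliptic.integrable hα hαβ hA₀.1.2 y₀ _), SkewOCP.wgrad_add]
  refine integral_congr_ae ?_
  filter_upwards [Lp.coeFn_add (SkewOCP.wgrad y₀) (SkewOCP.wgrad ψ)] with x hx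
  rw [hx, Pi.add_apply, SkewOCP.form_sub]
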